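/- Let $N\in\mathbb N$, $\alpha\in(0,\pi)$, $-1<a_1<\dots<a_N<1$, $d_1,\dots,d_N\in\{-1,1\}$, and put $\gamma_n=d_n-\cos\alpha$. Let $\mathbb R^2_+=\mathbb R\times(0,\infty)$ and, for $r>0$, let $\Omega_r(a)=\mathbb R^2_+\setminus\bigcup_{n=1}^N B_r((a_n,0))$. Put $a_0=-1$, $a_{N+1}=1$ and $\sigma_n=\frac\pi2\bigl(\sum_{k=n+1}^N\gamma_k-\sum_{k=1}^n\gamma_k\bigr)$ for $n=0,\dots,N$. Consider the mixed boundary value problem $$\Delta u=0\ \text{in }\mathbb R^2_+,\qquad u=\sigma_n\ \text{on }(a_n,a_{n+1})\times\{0\}\ (n=0,\dots,N),\qquad \frac{\partial u}{\partial x_2}=0\ \text{on }\bigl((-\infty,-1)\cup(1,\infty)\bigr)\times\{0\},$$ for functions $u$ with $$\sup_{r>0}\frac{\|\nabla u\|_{L^2(\Omega_r(a))}^2}{\log(\frac1r+2)}<\infty .$$ Here the Dirichlet condition is understood in the sense of traces, and the Neumann condition in the weak sense: $\int_{\mathbb R^2_+}\nabla u\cdot\nabla\zeta\,dx=0$ for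 every $\zeta\in C_c^\infty(\mathbb R^2)$ whose support does not meet $[-1,1]\times\{0\}$. This problem has a unique solution $u^*_{a,d}$ (the limiting stray-field potential), and its renormalised Dirichlet energy $$W_1(a,d)=E^*_{a,d}(u^*_{a,d})=\frac12\liminf_{r\searrow0}\left(\int_{\Omega_r(a)}|\nabla u^*_{a,d}|^2\,dx-\pi\log\frac1r\sum_{n=1}^N\gamma_n^2\right)$$ equals $$W_1(a,d)=\frac\pi2\sum_{n=1}^N\gamma_n^2\log(2-2a_n^2)+\frac\pi2\sum_{n=1}^N\sum_{k\ne n}\gamma_k\gamma_n\log\frac{1+\sqrt{1-\varrho(a_k,a_n)^2}}{\varrho(a_k,a_n)},\qquad \varrho(b,c)=\frac{|b-c|}{1-bc}.$$ -/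

import Mathlib

open Filter Topology MeasureTheory
open scoped ENNReal ContDiff

noncomputable section

namespace NeelWall

/-- The open upper half-plane; the plane is identified with the complex numbers. -/
def halfPlane : Set ℂ := {z | 0 < z.im}

/-- Admissible wall positions: increasing points of the interval from -1 to 1. -/
def Positions (N : ℕ) : Set (Fin N → ℝ) :=
  {a | StrictMono a ∧ ∀ n, a n ∈ Set.Ioo (-1 : ℝ) 1}

/-- The half-plane with the discs of radius `r` about the points `(a n, 0)` removed. -/
def perforated {N : ℕ} (a : Fin N → ℝ) (r : ℝ) : Set ℂ :=
  halfPlane \ ⋃ n, Metric.ball (a n : ℂ) r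

/-- The integral of `|∇u|²` over `s`, with values in `[0, ∞]`. -/
def dirichlet (u : ℂ → ℝ) (s : Set ℂ) : ℝ≥0∞ :=
  ∫⁻ z in s, ‖gradient u z‖ₑ ^ 2

/-- The metric `|b - c| / (1 - b c)` on the interval from -1 to 1. -/
def rho (b c : ℝ) : ℝ := |b - c| / (1 - b * c)

/-- The weights `γ_n = d_n - cos α`. -/
def weight {N : ℕ} (α : ℝ) (d : Fin N → ℝ) (n : Fin N) : ℝ := d n - Real.cos α

/-- The boundary value on the `n`-th interval, `n = 0, …, N`. With walls numbered from zero,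
the walls to the right of that interval are those with index at least `n`. -/
def boundaryValue {N : ℕ} (γ : Fin N → ℝ) (n : Fin (N + 1)) : ℝ :=
  Real.pi / 2 *
    ((∑ k with n.val ≤ k.val, γ k) - ∑ k with k.val < n.val, γ k)

/-- The `n`-th of the `N + 1` open intervals into which the points of `a` divide the interval
from -1 to 1. -/
def piece {N : ℕ} (a : Fin N → ℝ) (n : Fin (N + 1)) : Set ℝ :=
  {x | x ∈ Set.Ioo (-1 : ℝ) 1 ∧ (∀ k : Fin N, k.val < n.val → a k < x) ∧
    ∀ k : Fin N, n.val ≤ k.val → x < a k}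

/-- The mixed boundary value problem for the limiting stray-field potential. -/
structure IsLimitPotential {N : ℕ} (a γ : Fin N → ℝ) (u : ℂ → ℝ) : Prop where
  harmonic : InnerProductSpace.HarmonicOnNhd u halfPlane
  /-- Membership in the homogeneous Sobolev space with logarithmic growth of the energy at the
  points of `a`: the squared `L²` norm of `∇u` on the perforated half-plane is
  `O(log (1/r + 2))`. As `u` is harmonic, its weak gradient is the classical one. -/
  energy_growth : ∃ C : ℝ, ∀ r : ℝ, 0 < r →
    dirichlet u (perforated a r) ≤ ENNReal.ofReal (C * Real.log (1 / r + 2))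
  /-- Dirichlet data in the sense of traces: the trace of a smooth function whose gradient is
  square integrable near a piece of the boundary is its vertical limit almost everywhere. -/
  trace_eq : ∀ n : Fin (N + 1), ∀ᵐ x : ℝ ∂(volume.restrict (piece a n)),
    Tendsto (fun t : ℝ => u ⟨x, t⟩) (𝓝[>] 0) (𝓝 (boundaryValue γ n))
  /-- The homogeneous Neumann condition on the boundary outside `[-1, 1]`, in weak form; test
  functions need not vanish on that part of the boundary. -/
  neumann : ∀ ζ : ℂ → ℝ, ContDiff ℝ ∞ ζ → HasCompactSupport ζ →
    Disjoint (tsupport ζ) {z : ℂ | z.im = 0 ∧ z.re ∈ Set.Icc (-1 : ℝ) 1} →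
    ∫ z in halfPlane, inner ℝ (gradient u z) (gradient ζ z) = 0

/-- The renormalised Dirichlet energy. -/
def renormalisedEnergy {N : ℕ} (a γ : Fin N → ℝ) (u : ℂ → ℝ) : EReal :=
  ((1 / 2 : ℝ) : EReal) *
    liminf (fun r : ℝ => ((dirichlet u (perforated a r) : ℝ≥0∞) : EReal)
      - ((Real.pi * Real.log (1 / r) * ∑ n, γ n ^ 2 : ℝ) : EReal)) (𝓝[>] 0)

end NeelWall

end

/-! The potential is a superposition of explicit one-wall potentials, whose energies are computed in
a conformal coordinate. The map J = 2w/(1+w²), followed by the Möbius map (J+a)/(1+aJ), sends the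
upper half-disc onto the half-plane, the diameter onto (-1,1), the arc to the two outer rays and 0
to a. This is `discMap a`, with inverse `wallCoord a`. In the coordinate w a wall of weight one at a
has the potential arg w - π/2: it equals -π/2 and π/2 on the two halves of the diameter and has no
radial derivative on the arc. Adding these with weights γ gives `potential`, which solves the
problem (`isLimitPotential_potential`).

Energy. The Dirichlet integral is conformally invariant, and arg w has energy density 1/|w|². As the
disc of radius r about a pulls back to nearly a half-disc of radius r/(2-2a²), the self-energy is π
log(1/r) + π log(2-2a²) + o(1) (`tendsto_selfEnergy`). For two distinct walls the product of the
gradients is integrable on the whole half-plane. In the coordinate of the first wall its integral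
along a ray is the total radial increment of log |(w+q)/(1+qw)|, where -q is the position of the
second wall. This is log(1/|q|) for every angle, so the interaction is π log(1/|q|), and 1/|q| =
(1+√(1-ϱ²))/ϱ (`integral_crossDensity_ray`, `log_inv_abs_relPos`). Expanding the square gives the
formula, with the liminf a limit (`tendsto_totalField_energy`).

Uniqueness. Let h = ∂₁w - i∂₂w for the difference w of two solutions. On (-1,1) the Dirichlet
condition makes h imaginary and √(1-z²) is real; on the outer rays the Neumann condition makes h
real and the root is imaginary. So K = i√(1-z²)h is real on the whole boundary and can be reflected.
The boundary conditions are only weak, so the reflection principle is proved by testing the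
Cauchy–Riemann equations and mollifying (`exists_extension_oddReflection`). The energy bound removes
the singularities at ±1, leaves at most simple poles at the walls, and makes K vanish at infinity. A
pole would give w a jump or a logarithm on the boundary (`residue_eq_zero`). Thus K is entire and
vanishes at infinity, so K = 0 by Liouville and w is constant, hence zero by its trace. -/

namespace NeelWall

/-! ### A conformal map of the half-disc onto the half-plane -/

/-- The upper half of the unit disc. -/
def halfDisc : Set ℂ := {w | ‖w‖ < 1 ∧ 0 < w.im}

/-- The conformal map of the half-disc onto the half-plane that sends `0` to `a` and fixes `±1`. -/
noncomputable def discMap (a : ℝ) (w : ℂ) : ℂ :=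
  (a * (1 + w ^ 2) + 2 * w) / (1 + w ^ 2 + 2 * a * w)

/-- The branch of `√(1 - z²)` that is cut along the real rays outside `[-1, 1]`. -/
noncomputable def sqrtOneSubSq (z : ℂ) : ℂ := (1 - z ^ 2) ^ (1 / 2 : ℂ)

/-- The denominator of `wallCoord`. -/
noncomputable def wallDenom (a : ℝ) (z : ℂ) : ℂ :=
  1 - a * z + (Real.sqrt (1 - a ^ 2) : ℝ) * sqrtOneSubSq z

/-- The inverse of `discMap`. -/
noncomputable def wallCoord (a : ℝ) (z : ℂ) : ℂ := (z - a) / wallDenom a z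

lemma isOpen_halfPlane : IsOpen halfPlane := Complex.isOpen_im_gt 0

lemma measurableSet_halfPlane : MeasurableSet halfPlane := isOpen_halfPlane.measurableSet

lemma isOpen_halfDisc : IsOpen halfDisc :=
  (isOpen_lt continuous_norm continuous_const).inter (Complex.isOpen_im_gt 0)

lemma measurableSet_halfDisc : MeasurableSet halfDisc := isOpen_halfDisc.measurableSet

lemma one_sub_sq_pos {a : ℝ} (ha : a ∈ Set.Ioo (-1 : ℝ) 1) : 0 < 1 - a ^ 2 := by
  nlinarith [ha.1, ha.2]

lemma sq_add_sq_lt_one {w : ℂ} (hw : ‖w‖ < 1) : w.re ^ 2 + w.im ^ 2 < 1 := by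
  have := Complex.sq_norm w
  rw [Complex.normSq_apply] at this
  nlinarith [norm_nonneg w]

lemma discMap_denom_ne_zero {a : ℝ} {w : ℂ} (hw : w ∈ halfDisc) :
    1 + w ^ 2 + 2 * a * w ≠ 0 := by
  intro h
  obtain ⟨h1, h2⟩ := hw
  have h3 := sq_add_sq_lt_one h1
  have hre := congrArg Complex.re h
  have him := congrArg Complex.im h
  simp [pow_two] at hre him
  -- The imaginary part of the denominator is 2 Im w (Re w + a). Once a = -Re w, its real part is 1
  -- - |w|², which is positive.
  have : w.re = -a := by
    have : w.im * (w.re + a) = 0 := by linarith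
    rcases mul_eq_zero.1 this with h | h
    · exact absurd h h2.ne'
    · linarith
  have ha : a = -w.re := by linarith
  subst ha
  nlinarith

lemma im_div_eq (p q : ℂ) : (p / q).im = (p * (starRingEnd ℂ) q).im / Complex.normSq q := by
  rw [Complex.div_im, Complex.mul_im, Complex.conj_re, Complex.conj_im]; ring

/-- The sign of the imaginary part is that of Im w (1 - |w|²). This is used forwards in
`discMap_mem` and backwards in `wallCoord_mem`. -/
lemma discMap_im (a : ℝ) (w : ℂ) :
    (discMap a w).im = 2 * (1 - a ^ 2) * w.im * (1 - ‖w‖ ^ 2)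
      / Complex.normSq (1 + w ^ 2 + 2 * a * w) := by
  rw [discMap, im_div_eq, Complex.sq_norm, Complex.normSq_apply w]
  congr 1
  simp [pow_two]
  ring

lemma discMap_mem {a : ℝ} (ha : a ∈ Set.Ioo (-1 : ℝ) 1) {w : ℂ} (hw : w ∈ halfDisc) :
    discMap a w ∈ halfPlane := by
  have h1 := one_sub_sq_pos ha
  have h2 : 0 < 1 - ‖w‖ ^ 2 := by nlinarith [hw.1, norm_nonneg w]
  have h3 := hw.2
  have h4 := Complex.normSq_pos.2 (discMap_denom_ne_zero (a := a) hw)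
  change 0 < (discMap a w).im
  rw [discMap_im]
  positivity

/-- As with 2w/(1+w²), two points have the same image only if they are equal or inverse to each
other, and inverse points cannot both lie in the unit disc. -/
lemma discMap_injOn {a : ℝ} (ha : a ∈ Set.Ioo (-1 : ℝ) 1) : Set.InjOn (discMap a) halfDisc := by
  intro w hw w' hw' h
  rw [discMap, discMap, div_eq_div_iff (discMap_denom_ne_zero hw) (discMap_denom_ne_zero hw')] at h
  have h1 : (2 * (1 - a ^ 2) : ℂ) * ((w - w') * (1 - w * w')) = 0 := by linear_combination h
  have h2 : (2 * (1 - a ^ 2) : ℂ) ≠ 0 := by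
    have := one_sub_sq_pos ha
    exact_mod_cast (by positivity : (2 * (1 - a ^ 2)) ≠ 0)
  have h3 : 1 - w * w' ≠ 0 := by
    intro h0
    have : ‖w * w'‖ = 1 := by rw [← sub_eq_zero.1 h0]; simp
    rw [norm_mul] at this
    nlinarith [hw.1, hw'.1, norm_nonneg w, norm_nonneg w']
  rcases mul_eq_zero.1 h1 with h | h
  · exact absurd h h2
  · rcases mul_eq_zero.1 h with h | h
    · exact sub_eq_zero.1 h
    · exact absurd h h3

/-! ### The inverse map and the square root of 1 - z² -/

lemma sqrtOneSubSq_sq (z : ℂ) : sqrtOneSubSq z ^ 2 = 1 - z ^ 2 := by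
  rw [sqrtOneSubSq, ← Complex.cpow_nat_mul]; norm_num

lemma one_sub_sq_mem_slitPlane_iff {z : ℂ} :
    1 - z ^ 2 ∈ Complex.slitPlane ↔ z.im ≠ 0 ∨ z.re ∈ Set.Ioo (-1 : ℝ) 1 := by
  rw [Complex.mem_slitPlane_iff]
  simp only [pow_two, Complex.sub_re, Complex.one_re, Complex.mul_re, Complex.sub_im,
    Complex.one_im, Complex.mul_im, Set.mem_Ioo]
  constructor
  · intro h
    by_contra! hc
    obtain ⟨h0, h1⟩ := hc
    rw [h0] at h
    rcases h with h | h
    · have := h1 (by nlinarith)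
      nlinarith
    · simp at h
  · rintro (h | ⟨h1, h2⟩)
    · by_cases hx : z.re = 0
      · left
        rw [hx]
        have : 0 < z.im * z.im := mul_self_pos.2 h
        linarith
      · right
        have := mul_ne_zero hx h
        intro h0
        apply this
        linarith
    · by_cases hx : z.re * z.im = 0
      · left; nlinarith [mul_self_nonneg z.im]
      · right
        intro h0
        apply hx
        linarith

lemma sqrtOneSubSq_re_pos {z : ℂ} (hz : 1 - z ^ 2 ∈ Complex.slitPlane) :
    0 < (sqrtOneSubSq z).re := by
  have h0 := Complex.slitPlane_ne_zero hz
  rw [sqrtOneSubSq, Complex.cpow_def_of_ne_zero h0, Complex.exp_re]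
  refine mul_pos (Real.exp_pos _) (Real.cos_pos_of_mem_Ioo ?_)
  have h1 := Complex.neg_pi_lt_arg (1 - z ^ 2)
  have h2 := (Complex.arg_le_pi (1 - z ^ 2)).lt_of_ne (Complex.mem_slitPlane_iff_arg.1 hz).1
  have : (Complex.log (1 - z ^ 2) * (1 / 2)).im = Complex.arg (1 - z ^ 2) / 2 := by
    rw [show (1 / 2 : ℂ) = ((1 / 2 : ℝ) : ℂ) by norm_num, Complex.im_mul_ofReal, Complex.log_im]
    ring
  rw [this]
  constructor <;> linarith

lemma mem_slitPlane_of_mem_halfPlane {z : ℂ} (hz : z ∈ halfPlane) :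
    1 - z ^ 2 ∈ Complex.slitPlane :=
  one_sub_sq_mem_slitPlane_iff.2 (Or.inl (ne_of_gt hz))

lemma hasDerivAt_sqrtOneSubSq {z : ℂ} (hz : 1 - z ^ 2 ∈ Complex.slitPlane) :
    HasDerivAt sqrtOneSubSq (-z / sqrtOneSubSq z) z := by
  have h1 : HasDerivAt (fun z : ℂ => 1 - z ^ 2) (-(2 * z)) z := by
    simpa using ((hasDerivAt_pow 2 z).const_sub 1)
  have h2 := h1.cpow_const (c := (1 / 2 : ℂ)) hz
  have h0 := Complex.slitPlane_ne_zero hz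
  have hs : sqrtOneSubSq z ≠ 0 := fun h => by
    have := sqrtOneSubSq_re_pos hz
    simp [h] at this
  convert! h2 using 1
  have : (1 - z ^ 2) ^ ((1 : ℂ) / 2 - 1) = (sqrtOneSubSq z)⁻¹ := by
    rw [Complex.cpow_sub _ _ h0, Complex.cpow_one]
    change sqrtOneSubSq z / _ = _
    rw [← sqrtOneSubSq_sq z]
    field_simp
  rw [this]
  field_simp

/-- A difference of squares: (1-az)² - (1-a²)(1-z²) = (z-a)². It yields both the non-vanishing of
`wallDenom` and the form of the square of `wallCoord` as a quotient of the two factors. -/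
lemma wallDenom_mul_conj_eq (a : ℝ) (ha : a ∈ Set.Ioo (-1 : ℝ) 1) (z : ℂ) :
    wallDenom a z * (1 - a * z - (Real.sqrt (1 - a ^ 2) : ℝ) * sqrtOneSubSq z) = (z - a) ^ 2 := by
  have h1 : ((Real.sqrt (1 - a ^ 2) : ℝ) : ℂ) ^ 2 = 1 - a ^ 2 := by
    rw [← Complex.ofReal_pow, Real.sq_sqrt (one_sub_sq_pos ha).le]; push_cast; ring
  have h2 := sqrtOneSubSq_sq z
  rw [wallDenom]
  linear_combination (-sqrtOneSubSq z ^ 2) * h1 - (1 - a ^ 2 : ℂ) * h2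

lemma wallDenom_ne_zero {a : ℝ} (ha : a ∈ Set.Ioo (-1 : ℝ) 1) {z : ℂ}
    (hz : 1 - z ^ 2 ∈ Complex.slitPlane) : wallDenom a z ≠ 0 := by
  intro h
  have h1 := wallDenom_mul_conj_eq a ha z
  rw [h, zero_mul] at h1
  have h2 : z = a := sub_eq_zero.1 (pow_eq_zero_iff (two_ne_zero)|>.1 h1.symm)
  have hs := sqrtOneSubSq_re_pos hz
  have hc := Real.sqrt_pos.2 (one_sub_sq_pos ha)
  have h3 := congrArg Complex.re h
  rw [wallDenom, Complex.add_re, Complex.re_ofReal_mul, h2] at h3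
  rw [h2] at hs
  simp only [Complex.sub_re, Complex.one_re, Complex.re_ofReal_mul, Complex.ofReal_re,
    Complex.zero_re] at h3
  nlinarith [one_sub_sq_pos ha, mul_pos hc hs]

lemma wallCoord_sq {a : ℝ} (ha : a ∈ Set.Ioo (-1 : ℝ) 1) {z : ℂ}
    (hz : 1 - z ^ 2 ∈ Complex.slitPlane) :
    wallCoord a z ^ 2
      = (1 - a * z - (Real.sqrt (1 - a ^ 2) : ℝ) * sqrtOneSubSq z) / wallDenom a z := by
  have h := wallDenom_ne_zero ha hz
  rw [wallCoord, div_pow, ← wallDenom_mul_conj_eq a ha z]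
  field_simp

lemma discMap_wallCoord {a : ℝ} (ha : a ∈ Set.Ioo (-1 : ℝ) 1) {z : ℂ}
    (hz : 1 - z ^ 2 ∈ Complex.slitPlane) : discMap a (wallCoord a z) = z := by
  have h := wallDenom_ne_zero ha hz
  have h1 : 1 + wallCoord a z ^ 2 = 2 * (1 - a * z) / wallDenom a z := by
    rw [wallCoord_sq ha hz, eq_div_iff h, add_mul, div_mul_cancel₀ _ h, wallDenom]; ring
  have h2 : (1 - a ^ 2 : ℂ) ≠ 0 := by exact_mod_cast (one_sub_sq_pos ha).ne'
  rw [discMap, h1, wallCoord]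
  have e1 : a * (2 * (1 - a * z) / wallDenom a z) + 2 * ((z - a) / wallDenom a z)
      = 2 * (1 - a ^ 2) * z / wallDenom a z := by field_simp; ring
  have e2 : 2 * (1 - a * z) / wallDenom a z + 2 * a * ((z - a) / wallDenom a z)
      = 2 * (1 - a ^ 2) / wallDenom a z := by field_simp; ring
  rw [e1, e2]
  field_simp

lemma norm_wallCoord_lt_one {a : ℝ} (ha : a ∈ Set.Ioo (-1 : ℝ) 1) {z : ℂ} (hz : z ∈ halfPlane) :
    ‖wallCoord a z‖ < 1 := by
  have hz' := mem_slitPlane_of_mem_halfPlane hz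
  have hy : 0 < z.im := hz
  have hp := sqrtOneSubSq_re_pos hz'
  have hsq := sqrtOneSubSq_sq z
  have hc := Real.sqrt_pos.2 (one_sub_sq_pos ha)
  have hD := wallDenom_ne_zero ha hz'
  have hn : ‖wallCoord a z‖ ^ 2 < 1 := by
    rw [← norm_pow, wallCoord_sq ha hz', norm_div, div_lt_one (norm_pos_iff.2 hD)]
    rw [← sq_lt_sq₀ (norm_nonneg _) (norm_nonneg _), Complex.sq_norm, Complex.sq_norm, wallDenom]
    -- With P = 1 - az, the claim |P - cs| < |P + cs| amounts to Re(P s̄) > 0.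
    set c := Real.sqrt (1 - a ^ 2)
    set s := sqrtOneSubSq z
    have hre := congrArg Complex.re hsq
    have him := congrArg Complex.im hsq
    simp only [pow_two, Complex.mul_re, Complex.mul_im, Complex.sub_re, Complex.sub_im,
      Complex.one_re, Complex.one_im] at hre him
    have hpq : s.re * s.im = -(z.re * z.im) := by linarith
    have hT : (s.re ^ 2 - z.im ^ 2) * (s.re ^ 2 + z.re ^ 2) = s.re ^ 2 := by
      linear_combination (s.re ^ 2) * hre + (s.re * s.im - z.re * z.im) * hpq
    have hT' : s.re ^ 2 + z.re ^ 2 = s.im ^ 2 + 1 + z.im ^ 2 := by linarith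
    have hax : a * z.re < s.re ^ 2 + z.re ^ 2 := by
      have h1 : 1 < s.re ^ 2 + z.re ^ 2 := by rw [hT']; nlinarith [sq_nonneg s.im]
      have h2 : |a| < 1 := abs_lt.2 ha
      have h3 : a * z.re ≤ |z.re| := by
        calc a * z.re ≤ |a * z.re| := le_abs_self _
          _ = |a| * |z.re| := abs_mul _ _
          _ ≤ 1 * |z.re| := by gcongr
          _ = |z.re| := one_mul _
      by_cases h4 : |z.re| ≤ 1
      · linarith
      · push Not at h4
        have : |z.re| ^ 2 = z.re ^ 2 := sq_abs _
        nlinarith [mul_pos hp hp]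
    -- This is Re(P s̄). Multiplying by the positive factor s.re (s.re² + z.re²) eliminates s.im
    -- through `hpq` and leaves a quantity that is positive by `hax`.
    have hN : 0 < (1 - a * z.re) * s.re - a * z.im * s.im := by
      have hTp : 0 < s.re ^ 2 + z.re ^ 2 := by positivity
      have e : ((1 - a * z.re) * s.re - a * z.im * s.im) * (s.re * (s.re ^ 2 + z.re ^ 2))
          = s.re ^ 2 * (s.re ^ 2 + z.re ^ 2 - a * z.re) := by
        linear_combination (-(a * z.im) * (s.re ^ 2 + z.re ^ 2)) * hpq - a * z.re * hT
      have : 0 < s.re ^ 2 * (s.re ^ 2 + z.re ^ 2 - a * z.re) :=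
        mul_pos (by positivity) (by linarith)
      rw [← e] at this
      exact (pos_iff_pos_of_mul_pos this).2 (by positivity)
    have := mul_pos hc hN
    simp only [Complex.normSq_apply, Complex.sub_re, Complex.one_re, Complex.re_ofReal_mul,
      Complex.im_ofReal_mul, Complex.sub_im, Complex.one_im, Complex.add_re, Complex.add_im]
    nlinarith
  nlinarith [norm_nonneg (wallCoord a z)]

lemma wallCoord_mem {a : ℝ} (ha : a ∈ Set.Ioo (-1 : ℝ) 1) {z : ℂ} (hz : z ∈ halfPlane) :
    wallCoord a z ∈ halfDisc := by
  have h1 := norm_wallCoord_lt_one ha hz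
  refine ⟨h1, ?_⟩
  have h2 := discMap_im a (wallCoord a z)
  rw [discMap_wallCoord ha (mem_slitPlane_of_mem_halfPlane hz)] at h2
  have h3 : 0 < z.im := hz
  by_contra hc
  push Not at hc
  have h4 : 0 < 1 - ‖wallCoord a z‖ ^ 2 := by nlinarith [norm_nonneg (wallCoord a z)]
  have h5 := one_sub_sq_pos ha
  have : 2 * (1 - a ^ 2) * (wallCoord a z).im * (1 - ‖wallCoord a z‖ ^ 2) ≤ 0 := by
    have : 0 ≤ 2 * (1 - a ^ 2) * (1 - ‖wallCoord a z‖ ^ 2) := by positivity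
    nlinarith
  have := div_nonpos_of_nonpos_of_nonneg this
    (Complex.normSq_nonneg (1 + wallCoord a z ^ 2 + 2 * a * wallCoord a z))
  linarith

lemma discMap_image {a : ℝ} (ha : a ∈ Set.Ioo (-1 : ℝ) 1) : discMap a '' halfDisc = halfPlane := by
  apply Set.Subset.antisymm
  · rintro _ ⟨w, hw, rfl⟩
    exact discMap_mem ha hw
  · intro z hz
    exact ⟨_, wallCoord_mem ha hz, discMap_wallCoord ha (mem_slitPlane_of_mem_halfPlane hz)⟩

/-- The derivative of `discMap`. -/
noncomputable def discMapDeriv (a : ℝ) (w : ℂ) : ℂ :=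
  2 * (1 - a ^ 2) * (1 - w ^ 2) / (1 + w ^ 2 + 2 * a * w) ^ 2

lemma hasDerivAt_discMap {a : ℝ} {w : ℂ} (hw : w ∈ halfDisc) :
    HasDerivAt (discMap a) (discMapDeriv a w) w := by
  have h := discMap_denom_ne_zero (a := a) hw
  have h1 : HasDerivAt (fun w : ℂ => a * (1 + w ^ 2) + 2 * w) (a * (2 * w) + 2) w := by
    simpa using ((((hasDerivAt_pow 2 w).const_add 1).const_mul (a : ℂ)).fun_add
      ((hasDerivAt_id w).const_mul 2))
  have h2 : HasDerivAt (fun w : ℂ => 1 + w ^ 2 + 2 * a * w) (2 * w + 2 * a) w := by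
    simpa using (((hasDerivAt_pow 2 w).const_add 1).fun_add ((hasDerivAt_id w).const_mul (2 * a : ℂ)))
  convert! h1.div h2 h using 1
  rw [discMapDeriv]
  congr 1
  ring

lemma det_restrictScalars_toSpanSingleton (c : ℂ) :
    ((ContinuousLinearMap.toSpanSingleton ℂ c).restrictScalars ℝ).det = ‖c‖ ^ 2 := by
  rw [ContinuousLinearMap.det, ← LinearMap.det_toMatrix Complex.basisOneI, Matrix.det_fin_two]
  simp [LinearMap.toMatrix_apply, Complex.sq_norm, Complex.normSq_apply]

lemma hasFDerivWithinAt_discMap {a : ℝ} :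
    ∀ w ∈ halfDisc, HasFDerivWithinAt (discMap a)
      ((ContinuousLinearMap.toSpanSingleton ℂ (discMapDeriv a w)).restrictScalars ℝ) halfDisc w :=
  fun _ hw => ((hasDerivAt_discMap hw).hasFDerivAt.restrictScalars ℝ).hasFDerivWithinAt

lemma lintegral_halfPlane_eq {a : ℝ} (ha : a ∈ Set.Ioo (-1 : ℝ) 1) (F : ℂ → ℝ≥0∞) :
    ∫⁻ z in halfPlane, F z
      = ∫⁻ w in halfDisc, ENNReal.ofReal (‖discMapDeriv a w‖ ^ 2) * F (discMap a w) := by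
  rw [← discMap_image ha, lintegral_image_eq_lintegral_abs_det_fderiv_mul volume
    measurableSet_halfDisc hasFDerivWithinAt_discMap (discMap_injOn ha)]
  simp only [det_restrictScalars_toSpanSingleton, abs_pow, abs_norm]

lemma integral_halfPlane_eq {a : ℝ} (ha : a ∈ Set.Ioo (-1 : ℝ) 1) (F : ℂ → ℝ) :
    ∫ z in halfPlane, F z
      = ∫ w in halfDisc, ‖discMapDeriv a w‖ ^ 2 * F (discMap a w) := by
  rw [← discMap_image ha, integral_image_eq_integral_abs_det_fderiv_smul volume
    measurableSet_halfDisc hasFDerivWithinAt_discMap (discMap_injOn ha)]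
  simp only [det_restrictScalars_toSpanSingleton, abs_pow, abs_norm, smul_eq_mul]

lemma integrableOn_halfPlane_iff {a : ℝ} (ha : a ∈ Set.Ioo (-1 : ℝ) 1) (F : ℂ → ℝ) :
    IntegrableOn F halfPlane
      ↔ IntegrableOn (fun w => ‖discMapDeriv a w‖ ^ 2 * F (discMap a w)) halfDisc := by
  rw [← discMap_image ha, integrableOn_image_iff_integrableOn_abs_det_fderiv_smul volume
    measurableSet_halfDisc hasFDerivWithinAt_discMap (discMap_injOn ha)]
  simp only [det_restrictScalars_toSpanSingleton, abs_pow, abs_norm, smul_eq_mul]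

/-! ### Integrals over the half-disc in polar coordinates -/

/-- The point with polar coordinates `p`. -/
noncomputable def polarPoint (p : ℝ × ℝ) : ℂ := p.1 * (Real.cos p.2 + Real.sin p.2 * Complex.I)

lemma polarPoint_re (p : ℝ × ℝ) : (polarPoint p).re = p.1 * Real.cos p.2 := by
  rw [polarPoint, Complex.re_ofReal_mul]
  simp [-Complex.ofReal_cos, -Complex.ofReal_sin]

lemma polarPoint_im (p : ℝ × ℝ) : (polarPoint p).im = p.1 * Real.sin p.2 := by
  rw [polarPoint, Complex.im_ofReal_mul]
  simp [-Complex.ofReal_cos, -Complex.ofReal_sin]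

lemma norm_polarPoint (p : ℝ × ℝ) : ‖polarPoint p‖ = |p.1| := by
  rw [← Complex.norm_polarCoord_symm p, Complex.polarCoord_symm_apply, polarPoint]

lemma continuous_polarPoint : Continuous polarPoint := by
  unfold polarPoint
  fun_prop

lemma polarPoint_mem_halfDisc_iff {p : ℝ × ℝ} (hp : p ∈ polarCoord.target) :
    polarPoint p ∈ halfDisc ↔ p ∈ Set.Ioo (0 : ℝ) 1 ×ˢ Set.Ioo 0 Real.pi := by
  rw [polarCoord_target] at hp
  obtain ⟨h1, h2, h3⟩ := hp
  simp only [Set.mem_Ioi] at h1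
  simp only [halfDisc, Set.mem_ofPred_eq, norm_polarPoint, polarPoint_im, Set.mem_prod, Set.mem_Ioo,
    abs_of_pos h1, h1, true_and, h3, and_true, mul_pos_iff_of_pos_left]
  refine and_congr_right fun _ => ⟨fun h => ?_, fun h => Real.sin_pos_of_pos_of_lt_pi h h3⟩
  by_contra hc
  exact absurd h (not_lt.2 (Real.sin_nonpos_of_nonpos_of_neg_pi_le (not_lt.1 hc) h2.le))

lemma polarRect_subset : Set.Ioo (0 : ℝ) 1 ×ˢ Set.Ioo 0 Real.pi ⊆ polarCoord.target := by
  rw [polarCoord_target]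
  exact Set.prod_mono (fun x hx => hx.1) (fun x hx => ⟨by linarith [hx.1, Real.pi_pos], hx.2⟩)

lemma lintegral_halfDisc_eq_polar (F : ℂ → ℝ≥0∞) :
    ∫⁻ w in halfDisc, F w = ∫⁻ p in Set.Ioo (0 : ℝ) 1 ×ˢ Set.Ioo 0 Real.pi,
      ENNReal.ofReal p.1 * F (polarPoint p) := by
  rw [← lintegral_indicator measurableSet_halfDisc, ← Complex.lintegral_comp_polarCoord_symm,
    ← lintegral_indicator polarCoord.open_target.measurableSet,
    ← lintegral_indicator (measurableSet_Ioo.prod measurableSet_Ioo)]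
  congr 1 with p
  by_cases hp : p ∈ polarCoord.target
  · rw [Set.indicator_of_mem hp, Complex.polarCoord_symm_apply]
    change _ • halfDisc.indicator F (polarPoint p) = _
    by_cases h : polarPoint p ∈ halfDisc
    · rw [Set.indicator_of_mem h, Set.indicator_of_mem ((polarPoint_mem_halfDisc_iff hp).1 h)]
      rfl
    · rw [Set.indicator_of_notMem h,
        Set.indicator_of_notMem (fun h' => h ((polarPoint_mem_halfDisc_iff hp).2 h')), smul_zero]
  · rw [Set.indicator_of_notMem hp, Set.indicator_of_notMem (fun h => hp (polarRect_subset h))]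

lemma integral_halfDisc_eq_polar (F : ℂ → ℝ) :
    ∫ w in halfDisc, F w = ∫ p in Set.Ioo (0 : ℝ) 1 ×ˢ Set.Ioo 0 Real.pi,
      p.1 * F (polarPoint p) := by
  rw [← integral_indicator measurableSet_halfDisc, ← Complex.integral_comp_polarCoord_symm,
    ← integral_indicator polarCoord.open_target.measurableSet,
    ← integral_indicator (measurableSet_Ioo.prod measurableSet_Ioo)]
  congr 1 with p
  by_cases hp : p ∈ polarCoord.target
  · rw [Set.indicator_of_mem hp, Complex.polarCoord_symm_apply]
    change _ • halfDisc.indicator F (polarPoint p) = _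
    by_cases h : polarPoint p ∈ halfDisc
    · rw [Set.indicator_of_mem h, Set.indicator_of_mem ((polarPoint_mem_halfDisc_iff hp).1 h)]
      rfl
    · rw [Set.indicator_of_notMem h,
        Set.indicator_of_notMem (fun h' => h ((polarPoint_mem_halfDisc_iff hp).2 h')), smul_zero]
  · rw [Set.indicator_of_notMem hp, Set.indicator_of_notMem (fun h => hp (polarRect_subset h))]

/-- The source of the logarithm in the energy: 1/|w|² is the energy density of arg w, and in polar
coordinates it becomes dr/r over an angle π. -/
lemma lintegral_inv_sq_halfDisc {ρ : ℝ} (hρ : 0 < ρ) (hρ1 : ρ ≤ 1) :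
    ∫⁻ w in halfDisc, {w : ℂ | ρ ≤ ‖w‖}.indicator (fun w => ENNReal.ofReal ((‖w‖ ^ 2)⁻¹)) w
      = ENNReal.ofReal (Real.pi * Real.log (1 / ρ)) := by
  rw [lintegral_halfDisc_eq_polar, Measure.volume_eq_prod, ← Measure.prod_restrict,
    lintegral_prod]
  · have h1 : ∀ x ∈ Set.Ioo (0 : ℝ) 1,
        ∫⁻ y in Set.Ioo 0 Real.pi, ENNReal.ofReal (x, y).1 *
          {w : ℂ | ρ ≤ ‖w‖}.indicator (fun w => ENNReal.ofReal ((‖w‖ ^ 2)⁻¹)) (polarPoint (x, y))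
        = (Set.Ici ρ).indicator (fun x => ENNReal.ofReal x⁻¹ * ENNReal.ofReal Real.pi) x := by
      intro x hx
      have hx0 := hx.1
      by_cases h : ρ ≤ x
      · have : ∀ y, {w : ℂ | ρ ≤ ‖w‖}.indicator (fun w => ENNReal.ofReal ((‖w‖ ^ 2)⁻¹))
            (polarPoint (x, y)) = ENNReal.ofReal ((x ^ 2)⁻¹) := by
          intro y
          rw [Set.indicator_of_mem (by simpa [norm_polarPoint, abs_of_pos hx0] using h),
            norm_polarPoint, sq_abs]
        simp only [this]
        rw [Set.indicator_of_mem (by exact h), setLIntegral_const, Real.volume_Ioo, sub_zero,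
          ← ENNReal.ofReal_mul hx0.le]
        congr 2
        field_simp
      · have : ∀ y, {w : ℂ | ρ ≤ ‖w‖}.indicator (fun w => ENNReal.ofReal ((‖w‖ ^ 2)⁻¹))
            (polarPoint (x, y)) = 0 := by
          intro y
          rw [Set.indicator_of_notMem (by simpa [norm_polarPoint, abs_of_pos hx0] using h)]
        simp only [this]
        rw [Set.indicator_of_notMem (by exact h)]
        simp
    rw [setLIntegral_congr_fun measurableSet_Ioo h1, lintegral_indicator measurableSet_Ici,
      Measure.restrict_restrict measurableSet_Ici, lintegral_mul_const _ (by fun_prop)]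
    have h2 : Set.Ici ρ ∩ Set.Ioo 0 1 = Set.Ico ρ 1 := by
      ext x
      simp only [Set.mem_inter_iff, Set.mem_Ici, Set.mem_Ioo, Set.mem_Ico]
      constructor
      · rintro ⟨h, _, h'⟩; exact ⟨h, h'⟩
      · rintro ⟨h, h'⟩; exact ⟨h, by linarith, h'⟩
    rw [h2, ← ofReal_integral_eq_lintegral_ofReal, ← ENNReal.ofReal_mul, mul_comm]
    · congr 2
      rw [integral_Ico_eq_integral_Ioo, ← integral_Ioc_eq_integral_Ioo,
        ← intervalIntegral.integral_of_le hρ1, integral_inv_of_pos hρ one_pos]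
    · exact setIntegral_nonneg measurableSet_Ico fun x hx => inv_nonneg.2 (hρ.le.trans hx.1)
    · have : IntervalIntegrable (fun x : ℝ => x⁻¹) volume ρ 1 := by
        refine intervalIntegral.intervalIntegrable_inv (fun x hx => ?_) continuousOn_id
        rw [Set.uIcc_of_le hρ1] at hx
        exact (hρ.trans_le hx.1).ne'
      rw [intervalIntegrable_iff_integrableOn_Ico_of_le hρ1] at this
      exact this
    · exact (ae_restrict_iff' measurableSet_Ico).2 (ae_of_all _ fun x hx =>
        inv_nonneg.2 (hρ.le.trans hx.1))
  · refine Measurable.aemeasurable ?_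
    refine (by fun_prop : Measurable fun p : ℝ × ℝ => ENNReal.ofReal p.1).mul ?_
    refine Measurable.comp (Measurable.indicator ?_ ?_) continuous_polarPoint.measurable
    · fun_prop
    · exact measurableSet_le measurable_const measurable_norm

lemma integrableOn_inv_norm_sub (c : ℂ) : IntegrableOn (fun w : ℂ => ‖w - c‖⁻¹) halfDisc := by
  have key : IntegrableOn (fun w : ℂ => ‖w‖⁻¹) (Metric.ball 0 (1 + ‖c‖)) := by
    refine ⟨by fun_prop, ?_⟩
    rw [HasFiniteIntegral, ← lintegral_indicator measurableSet_ball,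
      ← Complex.lintegral_comp_polarCoord_symm]
    calc _ ≤ ∫⁻ p in polarCoord.target, (Set.Ioo (-(1 + ‖c‖)) (1 + ‖c‖) ×ˢ
          Set.Ioo (-Real.pi) Real.pi).indicator (fun _ => (1 : ℝ≥0∞)) p := by
          refine setLIntegral_mono' polarCoord.open_target.measurableSet fun p hp => ?_
          rw [polarCoord_target] at hp
          have hp1 : 0 < p.1 := hp.1
          by_cases h : Complex.polarCoord.symm p ∈ Metric.ball (0 : ℂ) (1 + ‖c‖)
          · rw [Set.indicator_of_mem h, Set.indicator_of_mem, Complex.norm_polarCoord_symm,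
              abs_of_pos hp1, smul_eq_mul, Real.enorm_of_nonneg (inv_nonneg.2 hp1.le),
              ← ENNReal.ofReal_mul hp1.le, mul_inv_cancel₀ hp1.ne', ENNReal.ofReal_one]
            rw [mem_ball_zero_iff, Complex.norm_polarCoord_symm, abs_lt] at h
            exact ⟨h, hp.2⟩
          · rw [Set.indicator_of_notMem h, smul_zero]
            exact zero_le
      _ ≤ ∫⁻ p : ℝ × ℝ, (Set.Ioo (-(1 + ‖c‖)) (1 + ‖c‖) ×ˢ
          Set.Ioo (-Real.pi) Real.pi).indicator (fun _ => (1 : ℝ≥0∞)) p := setLIntegral_le_lintegral _ _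
      _ < ⊤ := by
          rw [lintegral_indicator_const (measurableSet_Ioo.prod measurableSet_Ioo), one_mul,
            Measure.volume_eq_prod, Measure.prod_prod, Real.volume_Ioo, Real.volume_Ioo]
          exact ENNReal.mul_lt_top ENNReal.ofReal_lt_top ENNReal.ofReal_lt_top
  have h2 := (measurePreserving_sub_right volume c).integrableOn_comp_preimage
    (measurableEmbedding_subRight c) (f := fun w : ℂ => ‖w‖⁻¹) (s := Metric.ball 0 (1 + ‖c‖))
  refine (h2.2 key).mono_set fun w hw => ?_
  simp only [Set.mem_preimage, mem_ball_zero_iff]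
  calc ‖w - c‖ ≤ ‖w‖ + ‖c‖ := norm_sub_le _ _
    _ < 1 + ‖c‖ := by linarith [hw.1]

/-- The product of the gradients of two Green functions, in the coordinate of the first. -/
noncomputable def crossDensity (q : ℝ) (w : ℂ) : ℝ :=
  (‖w‖ ^ 2)⁻¹ * (w * (1 / (w + q) - q / (1 + q * w))).re

lemma one_add_mul_norm_ge {q : ℝ} {w : ℂ} (hw : ‖w‖ < 1) : 1 - |q| ≤ ‖1 + q * w‖ := by
  have h1 : ‖(1 : ℂ)‖ - ‖(q : ℂ) * w‖ ≤ ‖1 + q * w‖ := by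
    simpa using norm_sub_norm_le (1 : ℂ) (-(q * w))
  rw [norm_one, norm_mul, Complex.norm_real, Real.norm_eq_abs] at h1
  nlinarith [abs_nonneg q, norm_nonneg w]

lemma add_ofReal_ne_zero {q : ℝ} {w : ℂ} (hw : 0 < w.im) : w + q ≠ 0 := fun h => by
  have := congrArg Complex.im h
  simp at this
  linarith

/-- The density has first order singularities at 0 and -q only, since |1+qw| ≥ 1-|q|. The two points
are a distance |q| apart, so 1/(|w||w+q|) ≤ (1/|w| + 1/|w+q|)/|q|. -/
lemma integrableOn_crossDensity {q : ℝ} (hq : |q| < 1) (hq0 : q ≠ 0) :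
    IntegrableOn (crossDensity q) halfDisc := by
  have h1 := integrableOn_inv_norm_sub 0
  have h2 := integrableOn_inv_norm_sub (-(q : ℂ))
  have hmeas : Measurable (crossDensity q) := by
    unfold crossDensity
    refine Measurable.mul (by fun_prop) (Complex.measurable_re.comp ?_)
    fun_prop
  refine Integrable.mono' ((h1.add h2).const_mul ((1 - q ^ 2) / ((1 - |q|) * |q|)))
    hmeas.aestronglyMeasurable ?_
  refine (ae_restrict_iff' measurableSet_halfDisc).2 (ae_of_all _ fun w hw => ?_)
  have hq0' := abs_pos.2 hq0
  have hw0 : 0 < ‖w‖ := norm_pos_iff.2 fun h => by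
    have := hw.2
    simp [h] at this
  have hwq := add_ofReal_ne_zero (q := q) hw.2
  have hwq' := norm_pos_iff.2 hwq
  have h3 := one_add_mul_norm_ge (q := q) hw.1
  have h3' : 0 < ‖1 + q * w‖ := by linarith
  have hqw := norm_pos_iff.1 h3'
  have hqs : 0 < 1 - q ^ 2 := by rw [← sq_abs]; nlinarith
  have e : w * (1 / (w + q) - q / (1 + q * w)) = w * (((1 - q ^ 2 : ℝ) : ℂ) / ((w + q) * (1 + q * w))) := by
    rw [div_sub_div _ _ hwq hqw]
    congr 2
    push_cast
    ring
  simp only [Pi.add_apply, sub_zero, sub_neg_eq_add]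
  rw [crossDensity, e, norm_mul, norm_inv, norm_pow, norm_norm]
  have h4 : |q| ≤ ‖w‖ + ‖w + q‖ := by
    have := norm_sub_le (w + q) w
    simp only [add_sub_cancel_left, Complex.norm_real, Real.norm_eq_abs] at this
    linarith
  calc (‖w‖ ^ 2)⁻¹ * ‖(w * (((1 - q ^ 2 : ℝ) : ℂ) / ((w + q) * (1 + q * w)))).re‖
      ≤ (‖w‖ ^ 2)⁻¹ * ‖w * (((1 - q ^ 2 : ℝ) : ℂ) / ((w + q) * (1 + q * w)))‖ := by
        gcongr
        exact Complex.abs_re_le_norm _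
    _ = (1 - q ^ 2) * (1 / (‖w‖ * ‖w + q‖)) * (1 / ‖1 + q * w‖) := by
        rw [norm_mul, norm_div, norm_mul, Complex.norm_real, Real.norm_of_nonneg hqs.le]
        field_simp
    _ ≤ (1 - q ^ 2) * (|q|⁻¹ * (‖w‖⁻¹ + ‖w + q‖⁻¹)) * (1 / (1 - |q|)) := by
        have : 1 / (‖w‖ * ‖w + q‖) ≤ |q|⁻¹ * (‖w‖⁻¹ + ‖w + q‖⁻¹) := by
          rw [inv_add_inv hw0.ne' hwq'.ne', inv_mul_eq_div, div_div, div_le_div_iff₀ (by positivity)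
            (by positivity)]
          nlinarith [mul_pos hw0 hwq']
        have h5 : 0 < 1 - |q| := by linarith
        gcongr
    _ = _ := by
        have h5 : 0 < 1 - |q| := by linarith
        field_simp

lemma crossDensity_polarPoint {q r θ : ℝ} (hr : 0 < r) :
    r * crossDensity q (polarPoint (r, θ))
      = (r + q * Real.cos θ) / (r ^ 2 + 2 * q * r * Real.cos θ + q ^ 2)
        - (q * Real.cos θ + q ^ 2 * r) / (1 + 2 * q * r * Real.cos θ + q ^ 2 * r ^ 2) := by
  have hre := polarPoint_re (r, θ)
  have him := polarPoint_im (r, θ)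
  have hn := norm_polarPoint (r, θ)
  simp only at hre him hn
  have hcs := Real.sin_sq_add_cos_sq θ
  have hs : Real.sin θ ^ 2 = 1 - Real.cos θ ^ 2 := by linarith
  rw [crossDensity, hn, sq_abs]
  set w := polarPoint (r, θ)
  have e1 : (w * (1 / (w + q))).re
      = r * (r + q * Real.cos θ) / (r ^ 2 + 2 * q * r * Real.cos θ + q ^ 2) := by
    rw [mul_one_div, Complex.div_re, Complex.normSq_apply]
    simp only [Complex.add_re, Complex.add_im, Complex.ofReal_re, Complex.ofReal_im, add_zero,
      hre, him]
    rw [← add_div]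
    congr 1
    · linear_combination (r ^ 2) * hs
    · linear_combination (r ^ 2) * hs
  have e2 : (w * (q / (1 + q * w))).re
      = r * (q * Real.cos θ + q ^ 2 * r) / (1 + 2 * q * r * Real.cos θ + q ^ 2 * r ^ 2) := by
    rw [mul_div_assoc', Complex.div_re, Complex.normSq_apply]
    simp only [Complex.add_re, Complex.add_im, Complex.one_re, Complex.one_im,
      Complex.re_mul_ofReal, Complex.im_mul_ofReal, Complex.re_ofReal_mul, Complex.im_ofReal_mul,
      hre, him, zero_add]
    rw [← add_div]
    congr 1
    · linear_combination (r ^ 2 * q ^ 2) * hs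
    · linear_combination (r ^ 2 * q ^ 2) * hs
  rw [mul_sub, Complex.sub_re, e1, e2]
  field_simp

/-- The integrand is the radial derivative of log |(w+q)/(1+qw)|. The Blaschke factor has modulus
one on the unit circle and value q at the origin, so the integral does not depend on the angle. -/
lemma integral_crossDensity_ray {q θ : ℝ} (hq0 : q ≠ 0)
    (hθ : θ ∈ Set.Ioo 0 Real.pi)
    (hint : IntegrableOn (fun r => r * crossDensity q (polarPoint (r, θ))) (Set.Ioo 0 1)) :
    ∫ r in Set.Ioo (0 : ℝ) 1, r * crossDensity q (polarPoint (r, θ)) = Real.log (1 / |q|) := by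
  have hs := Real.sin_pos_of_pos_of_lt_pi hθ.1 hθ.2
  have hcs := Real.sin_sq_add_cos_sq θ
  have hp1 : ∀ r : ℝ, 0 < r ^ 2 + 2 * q * r * Real.cos θ + q ^ 2 := fun r => by
    have e : r ^ 2 + 2 * q * r * Real.cos θ + q ^ 2
        = (r + q * Real.cos θ) ^ 2 + (q * Real.sin θ) ^ 2 := by
      linear_combination (-q ^ 2) * hcs
    have := mul_ne_zero hq0 hs.ne'
    rw [e]
    positivity
  have hp2 : ∀ r ∈ Set.Icc (0 : ℝ) 1, 0 < 1 + 2 * q * r * Real.cos θ + q ^ 2 * r ^ 2 := by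
    intro r hr
    have e : 1 + 2 * q * r * Real.cos θ + q ^ 2 * r ^ 2
        = (1 + q * r * Real.cos θ) ^ 2 + (q * r * Real.sin θ) ^ 2 := by
      linear_combination (-q ^ 2 * r ^ 2) * hcs
    rw [e]
    rcases eq_or_ne r 0 with h | h
    · simp [h]
    · have := mul_ne_zero (mul_ne_zero hq0 h) hs.ne'
      positivity
  have hder : ∀ r ∈ Set.Icc (0 : ℝ) 1, HasDerivAt (fun r =>
      Real.log (r ^ 2 + 2 * q * r * Real.cos θ + q ^ 2) / 2
        - Real.log (1 + 2 * q * r * Real.cos θ + q ^ 2 * r ^ 2) / 2)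
      ((r + q * Real.cos θ) / (r ^ 2 + 2 * q * r * Real.cos θ + q ^ 2)
        - (q * Real.cos θ + q ^ 2 * r) / (1 + 2 * q * r * Real.cos θ + q ^ 2 * r ^ 2)) r := by
    intro r hr
    have h1 : HasDerivAt (fun r : ℝ => r ^ 2 + 2 * q * r * Real.cos θ + q ^ 2)
        (2 * r + 2 * q * Real.cos θ) r := by
      simpa using (((hasDerivAt_pow 2 r).fun_add
        (((hasDerivAt_id r).const_mul (2 * q)).mul_const (Real.cos θ))).add_const (q ^ 2))
    have h2 : HasDerivAt (fun r : ℝ => 1 + 2 * q * r * Real.cos θ + q ^ 2 * r ^ 2)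
        (2 * q * Real.cos θ + q ^ 2 * (2 * r)) r := by
      simpa using (((((hasDerivAt_id r).const_mul (2 * q)).mul_const (Real.cos θ)).const_add 1).fun_add
        ((hasDerivAt_pow 2 r).const_mul (q ^ 2)))
    convert! ((h1.log (hp1 r).ne').div_const 2).sub ((h2.log (hp2 r hr).ne').div_const 2) using 1
    have := (hp1 r).ne'
    have := (hp2 r hr).ne'
    field_simp
  rw [← integral_Ioc_eq_integral_Ioo, ← intervalIntegral.integral_of_le zero_le_one]
  rw [intervalIntegral.integral_eq_sub_of_hasDerivAt_of_le zero_le_one (f := fun r =>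
      Real.log (r ^ 2 + 2 * q * r * Real.cos θ + q ^ 2) / 2
        - Real.log (1 + 2 * q * r * Real.cos θ + q ^ 2 * r ^ 2) / 2)]
  · have : (1 : ℝ) ^ 2 + 2 * q * 1 * Real.cos θ + q ^ 2 = 1 + 2 * q * 1 * Real.cos θ + q ^ 2 * 1 ^ 2 := by
      ring
    rw [this, sub_self]
    simp
  · exact fun r hr => (hder r hr).continuousAt.continuousWithinAt
  · intro r hr
    rw [crossDensity_polarPoint hr.1]
    exact hder r (Set.Ioo_subset_Icc_self hr)
  · rw [intervalIntegrable_iff_integrableOn_Ioo_of_le zero_le_one]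
    exact hint

lemma integral_crossDensity {q : ℝ} (hq : |q| < 1) (hq0 : q ≠ 0) :
    ∫ w in halfDisc, crossDensity q w = Real.pi * Real.log (1 / |q|) := by
  have hint := integrableOn_crossDensity hq hq0
  have hmeas : Measurable (crossDensity q) := by
    unfold crossDensity
    refine Measurable.mul (by fun_prop) (Complex.measurable_re.comp ?_)
    fun_prop
  have hint' : IntegrableOn (fun p : ℝ × ℝ => p.1 * crossDensity q (polarPoint p))
      (Set.Ioo (0 : ℝ) 1 ×ˢ Set.Ioo 0 Real.pi) := by
    refine ⟨(measurable_fst.mul (hmeas.comp continuous_polarPoint.measurable)).aestronglyMeasurable,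
      ?_⟩
    have h := hint.2
    rw [HasFiniteIntegral, lintegral_halfDisc_eq_polar] at h
    refine lt_of_le_of_lt (setLIntegral_mono' (measurableSet_Ioo.prod measurableSet_Ioo) ?_) h
    intro p hp
    rw [enorm_mul, Real.enorm_of_nonneg hp.1.1.le]
  rw [integral_halfDisc_eq_polar]
  rw [IntegrableOn, Measure.volume_eq_prod, ← Measure.prod_restrict] at hint'
  rw [Measure.volume_eq_prod, ← Measure.prod_restrict, integral_prod_symm _ hint']
  have h1 : ∀ᵐ θ ∂(volume.restrict (Set.Ioo 0 Real.pi)),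
      ∫ r in Set.Ioo (0 : ℝ) 1, (r, θ).1 * crossDensity q (polarPoint (r, θ))
        = Real.log (1 / |q|) := by
    filter_upwards [hint'.prod_left_ae, ae_restrict_mem measurableSet_Ioo] with θ h1 h2
    exact integral_crossDensity_ray hq0 h2 h1
  rw [integral_congr_ae h1]
  simp [Real.pi_pos.le]

/-! ### The field of a single wall -/

/-- The complex gradient `∂₁ - i ∂₂` of the potential of a wall of weight one at `a`. -/
noncomputable def wallField (a : ℝ) (z : ℂ) : ℂ :=
  -Complex.I * (Real.sqrt (1 - a ^ 2) : ℝ) / ((z - a) * sqrtOneSubSq z)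

lemma ofReal_sqrt_one_sub_sq {a : ℝ} (ha : a ∈ Set.Ioo (-1 : ℝ) 1) :
    ((Real.sqrt (1 - a ^ 2) : ℝ) : ℂ) ^ 2 = 1 - a ^ 2 := by
  rw [← Complex.ofReal_pow, Real.sq_sqrt (one_sub_sq_pos ha).le]; push_cast; ring

/-- Squaring removes the square root, so that moduli can be transported without following a branch.
-/
lemma wallField_sq {a : ℝ} (ha : a ∈ Set.Ioo (-1 : ℝ) 1) (z : ℂ) :
    wallField a z ^ 2 = -(1 - a ^ 2) / ((z - a) ^ 2 * (1 - z ^ 2)) := by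
  rw [wallField, div_pow, mul_pow, mul_pow, ofReal_sqrt_one_sub_sq ha, sqrtOneSubSq_sq]
  simp

lemma halfDisc_ne_zero {w : ℂ} (hw : w ∈ halfDisc) : w ≠ 0 := fun h => by
  have := hw.2
  simp [h] at this

lemma discMap_sub {a : ℝ} {w : ℂ} (hw : w ∈ halfDisc) (b : ℝ) :
    discMap a w - b = ((a - b) * (1 + w ^ 2) + 2 * (1 - a * b) * w) / (1 + w ^ 2 + 2 * a * w) := by
  have h := discMap_denom_ne_zero (a := a) hw
  rw [discMap, div_sub' h]
  congr 1
  ring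

lemma one_sub_discMap_sq {a : ℝ} {w : ℂ} (hw : w ∈ halfDisc) :
    1 - discMap a w ^ 2 = (1 - a ^ 2) * (1 - w ^ 2) ^ 2 / (1 + w ^ 2 + 2 * a * w) ^ 2 := by
  have h := discMap_denom_ne_zero (a := a) hw
  rw [discMap, div_pow, one_sub_div (pow_ne_zero 2 h)]
  congr 1
  ring

lemma one_sub_sq_ne_zero_of_mem_halfDisc {w : ℂ} (hw : w ∈ halfDisc) : 1 - w ^ 2 ≠ 0 := by
  intro h
  have : ‖w ^ 2‖ = 1 := by rw [← sub_eq_zero.1 h]; simp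
  rw [norm_pow] at this
  nlinarith [hw.1, norm_nonneg w]

/-- The field pulls back to -i/w, the complex gradient of arg w. Only the modulus is needed, and it
is obtained by comparing squares. -/
lemma norm_discMapDeriv_mul_wallField {a : ℝ} (ha : a ∈ Set.Ioo (-1 : ℝ) 1) {w : ℂ}
    (hw : w ∈ halfDisc) :
    ‖discMapDeriv a w‖ ^ 2 * ‖wallField a (discMap a w)‖ ^ 2 = (‖w‖ ^ 2)⁻¹ := by
  have h := discMap_denom_ne_zero (a := a) hw
  have hw0 := halfDisc_ne_zero hw
  have h1 := one_sub_sq_ne_zero_of_mem_halfDisc hw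
  have h2 : (1 - a ^ 2 : ℂ) ≠ 0 := by exact_mod_cast (one_sub_sq_pos ha).ne'
  rw [← norm_pow, ← norm_pow, ← norm_mul, wallField_sq ha, discMap_sub hw, one_sub_discMap_sq hw,
    discMapDeriv, ← norm_pow, ← norm_inv, ← norm_neg (w ^ 2)⁻¹]
  congr 1
  rw [sub_self, zero_mul, zero_add, show (a : ℂ) * a = a ^ 2 by ring]
  field_simp

/-! ### Interaction energy of two walls -/

/-- The position of the wall at `b`, up to sign, in the coordinate centred at `a`. -/
noncomputable def relPos (a b : ℝ) : ℝ :=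
  (a - b) / ((1 - a * b) + Real.sqrt (1 - a ^ 2) * Real.sqrt (1 - b ^ 2))

lemma abs_sub_lt_one_sub_mul {a b : ℝ} (ha : a ∈ Set.Ioo (-1 : ℝ) 1)
    (hb : b ∈ Set.Ioo (-1 : ℝ) 1) : |a - b| < 1 - a * b := by
  rw [abs_lt]
  constructor <;> nlinarith [ha.1, ha.2, hb.1, hb.2, mul_pos (sub_pos.2 ha.1) (sub_pos.2 hb.2),
    mul_pos (sub_pos.2 ha.2) (sub_pos.2 hb.1)]

lemma one_sub_mul_pos {a b : ℝ} (ha : a ∈ Set.Ioo (-1 : ℝ) 1)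
    (hb : b ∈ Set.Ioo (-1 : ℝ) 1) : 0 < 1 - a * b :=
  (abs_nonneg _).trans_lt (abs_sub_lt_one_sub_mul ha hb)

lemma relPos_denom_pos {a b : ℝ} (ha : a ∈ Set.Ioo (-1 : ℝ) 1) (hb : b ∈ Set.Ioo (-1 : ℝ) 1) :
    0 < (1 - a * b) + Real.sqrt (1 - a ^ 2) * Real.sqrt (1 - b ^ 2) :=
  add_pos_of_pos_of_nonneg (one_sub_mul_pos ha hb) (by positivity)

lemma abs_relPos_lt_one {a b : ℝ} (ha : a ∈ Set.Ioo (-1 : ℝ) 1) (hb : b ∈ Set.Ioo (-1 : ℝ) 1) :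
    |relPos a b| < 1 := by
  have h := relPos_denom_pos ha hb
  rw [relPos, abs_div, abs_of_pos h, div_lt_one h]
  have := abs_sub_lt_one_sub_mul ha hb
  have : 0 ≤ Real.sqrt (1 - a ^ 2) * Real.sqrt (1 - b ^ 2) := by positivity
  linarith

lemma relPos_ne_zero {a b : ℝ} (ha : a ∈ Set.Ioo (-1 : ℝ) 1) (hb : b ∈ Set.Ioo (-1 : ℝ) 1)
    (hab : a ≠ b) : relPos a b ≠ 0 :=
  div_ne_zero (sub_ne_zero.2 hab) (relPos_denom_pos ha hb).ne'

/-- Since (1-ab)² - (a-b)² = (1-a²)(1-b²), dividing numerator and denominator of `relPos` by 1-ab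
gives ϱ and 1+√(1-ϱ²), up to sign. -/
lemma log_inv_abs_relPos {a b : ℝ} (ha : a ∈ Set.Ioo (-1 : ℝ) 1) (hb : b ∈ Set.Ioo (-1 : ℝ) 1) :
    Real.log (1 / |relPos a b|) = Real.log ((1 + Real.sqrt (1 - rho a b ^ 2)) / rho a b) := by
  have h0 := one_sub_mul_pos ha hb
  have h1 : 1 - rho a b ^ 2 = ((1 - a ^ 2) * (1 - b ^ 2)) / (1 - a * b) ^ 2 := by
    rw [rho, div_pow, sq_abs]
    field_simp
    ring
  have h2 : Real.sqrt (1 - rho a b ^ 2)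
      = Real.sqrt (1 - a ^ 2) * Real.sqrt (1 - b ^ 2) / (1 - a * b) := by
    rw [h1, Real.sqrt_div (mul_nonneg (one_sub_sq_pos ha).le (one_sub_sq_pos hb).le),
      Real.sqrt_mul (one_sub_sq_pos ha).le, Real.sqrt_sq h0.le]
  rw [h2, relPos, abs_div, abs_of_pos (relPos_denom_pos ha hb), rho, one_div_div]
  congr 1
  rw [one_add_div h0.ne', div_div_div_cancel_right₀ h0.ne']

/-- All fields share the factor 1/√(1-z²), so their quotients are rational in z. -/
lemma wallField_ratio {a b : ℝ} (ha : a ∈ Set.Ioo (-1 : ℝ) 1) {z : ℂ} (hz : z - a ≠ 0) :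
    wallField b z = wallField a z *
      (Real.sqrt (1 - b ^ 2) / Real.sqrt (1 - a ^ 2) * ((z - a) / (z - b))) := by
  have hc : ((Real.sqrt (1 - a ^ 2) : ℝ) : ℂ) ≠ 0 := by
    exact_mod_cast (Real.sqrt_pos.2 (one_sub_sq_pos ha)).ne'
  simp only [wallField, div_eq_mul_inv, mul_inv]
  field_simp

/-- The right-hand side is w times the logarithmic derivative of the Blaschke factor (w+q)/(1+qw),
which vanishes at the position -q of the second wall. -/
lemma ratio_discMap {a b : ℝ} (ha : a ∈ Set.Ioo (-1 : ℝ) 1) (hb : b ∈ Set.Ioo (-1 : ℝ) 1)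
    (hab : a ≠ b) {w : ℂ} (hw : w ∈ halfDisc) :
    (Real.sqrt (1 - b ^ 2) / Real.sqrt (1 - a ^ 2) * ((discMap a w - a) / (discMap a w - b)) : ℂ)
      = w * (1 / (w + relPos a b) - relPos a b / (1 + relPos a b * w)) := by
  have h := discMap_denom_ne_zero (a := a) hw
  have hca := Real.sqrt_pos.2 (one_sub_sq_pos ha)
  have hc : ((Real.sqrt (1 - a ^ 2) : ℝ) : ℂ) ≠ 0 := by exact_mod_cast hca.ne'
  have hq1 := abs_relPos_lt_one ha hb
  have hq0 := relPos_ne_zero ha hb hab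
  have hd := relPos_denom_pos ha hb
  have hwq := add_ofReal_ne_zero (q := relPos a b) hw.2
  have hqw : 1 + relPos a b * w ≠ 0 := by
    have := one_add_mul_norm_ge (q := relPos a b) hw.1
    exact norm_pos_iff.1 (by linarith)
  have hA : Real.sqrt (1 - a ^ 2) ^ 2 = 1 - a ^ 2 := Real.sq_sqrt (one_sub_sq_pos ha).le
  have hB : Real.sqrt (1 - b ^ 2) ^ 2 = 1 - b ^ 2 := Real.sq_sqrt (one_sub_sq_pos hb).le
  -- This says that -q is a root of the numerator of `discMap a w - b`. That polynomial is invariant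
  -- under w ↦ 1/w up to the factor w², so its other root is -1/q; this is the factorisation `e3`.
  have e1 : (a - b) * (1 + relPos a b ^ 2) = 2 * (1 - a * b) * relPos a b := by
    rw [relPos]
    field_simp
    linear_combination Real.sqrt (1 - b ^ 2) ^ 2 * hA + (1 - a ^ 2) * hB
  have e2 : 2 * Real.sqrt (1 - a ^ 2) * Real.sqrt (1 - b ^ 2) * relPos a b
      = (a - b) * (1 - relPos a b ^ 2) := by
    rw [relPos]
    field_simp
    linear_combination Real.sqrt (1 - b ^ 2) ^ 2 * hA + (1 - a ^ 2) * hB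
  have e1' := congrArg (Complex.ofReal) e1
  have e2' := congrArg (Complex.ofReal) e2
  have hA' := congrArg (Complex.ofReal) hA
  push_cast at e1' e2' hA'
  set q : ℂ := (relPos a b : ℂ)
  have hq0' : q ≠ 0 := Complex.ofReal_ne_zero.2 hq0
  have hab' : (a - b : ℂ) ≠ 0 := by exact_mod_cast sub_ne_zero.2 hab
  have e3 : q * ((a - b) * (1 + w ^ 2) + 2 * (1 - a * b) * w)
      = (a - b) * ((w + q) * (1 + q * w)) := by
    linear_combination (-w) * e1'
  have e4 : ((a - b) * (1 + w ^ 2) + 2 * (1 - a * b) * w : ℂ) ≠ 0 := by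
    intro h0
    rw [h0, mul_zero] at e3
    exact mul_ne_zero hab' (mul_ne_zero hwq hqw) e3.symm
  rw [discMap_sub hw, discMap_sub hw, div_div_div_cancel_right₀ h, div_sub_div _ _ hwq hqw,
    div_mul_div_comm, mul_div_assoc', div_eq_div_iff (mul_ne_zero hc e4) (mul_ne_zero hwq hqw)]
  refine mul_left_cancel₀ hq0' (mul_left_cancel₀ hab' ?_)
  set c : ℂ := (Real.sqrt (1 - a ^ 2) : ℂ)
  set c' : ℂ := (Real.sqrt (1 - b ^ 2) : ℂ)
  calc (a - b) * (q * (c' * ((a - a) * (1 + w ^ 2) + 2 * (1 - a * a) * w) * ((w + q) * (1 + q * w))))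
      = (2 * c * c' * q) * c * w * ((a - b) * ((w + q) * (1 + q * w))) := by
        linear_combination (-2 * (a - b) * q * c' * w * ((w + q) * (1 + q * w))) * hA'
    _ = (a - b) * (q * (w * (1 * (1 + q * w) - (w + q) * q) *
          (c * ((a - b) * (1 + w ^ 2) + 2 * (1 - a * b) * w)))) := by
        rw [e2', ← e3]
        ring

/-- Writing the second field as a multiple of the first turns the inner product into |`wallField
a`|² times the real part of the ratio. -/
lemma crossDensity_eq {a b : ℝ} (ha : a ∈ Set.Ioo (-1 : ℝ) 1) (hb : b ∈ Set.Ioo (-1 : ℝ) 1)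
    (hab : a ≠ b) {w : ℂ} (hw : w ∈ halfDisc) :
    ‖discMapDeriv a w‖ ^ 2 * inner ℝ (wallField a (discMap a w)) (wallField b (discMap a w))
      = crossDensity (relPos a b) w := by
  have hz : discMap a w - a ≠ 0 := by
    have h := discMap_denom_ne_zero (a := a) hw
    have h2 : (1 - a * a : ℂ) ≠ 0 := by
      rw [← pow_two]; exact_mod_cast (one_sub_sq_pos ha).ne'
    rw [discMap_sub hw, sub_self, zero_mul, zero_add]
    exact div_ne_zero (mul_ne_zero (mul_ne_zero two_ne_zero h2) (halfDisc_ne_zero hw)) h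
  rw [wallField_ratio ha hz (b := b), ratio_discMap ha hb hab hw, Complex.inner, mul_right_comm,
    Complex.mul_conj, Complex.re_ofReal_mul, crossDensity,
    ← norm_discMapDeriv_mul_wallField ha hw, Complex.sq_norm, Complex.sq_norm, mul_assoc]

lemma integrableOn_inner_wallField {a b : ℝ} (ha : a ∈ Set.Ioo (-1 : ℝ) 1)
    (hb : b ∈ Set.Ioo (-1 : ℝ) 1) (hab : a ≠ b) :
    IntegrableOn (fun z => inner ℝ (wallField a z) (wallField b z)) halfPlane := by
  rw [integrableOn_halfPlane_iff ha]
  refine (integrableOn_crossDensity (abs_relPos_lt_one ha hb) (relPos_ne_zero ha hb hab)).congr_fun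
    (fun w hw => (crossDensity_eq ha hb hab hw).symm) measurableSet_halfDisc

lemma integral_inner_wallField {a b : ℝ} (ha : a ∈ Set.Ioo (-1 : ℝ) 1)
    (hb : b ∈ Set.Ioo (-1 : ℝ) 1) (hab : a ≠ b) :
    ∫ z in halfPlane, inner ℝ (wallField a z) (wallField b z)
      = Real.pi * Real.log ((1 + Real.sqrt (1 - rho a b ^ 2)) / rho a b) := by
  rw [integral_halfPlane_eq ha, ← log_inv_abs_relPos ha hb,
    ← integral_crossDensity (abs_relPos_lt_one ha hb) (relPos_ne_zero ha hb hab)]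
  exact setIntegral_congr_fun measurableSet_halfDisc fun w hw => crossDensity_eq ha hb hab hw

/-! ### Self-energy of a wall -/

/-- The energy of a single wall outside the disc of radius `r` about it. -/
noncomputable def selfEnergy (a r : ℝ) : ℝ≥0∞ :=
  ∫⁻ z in halfPlane \ Metric.ball (a : ℂ) r, ‖wallField a z‖ₑ ^ 2

lemma selfEnergy_eq {a : ℝ} (ha : a ∈ Set.Ioo (-1 : ℝ) 1) (r : ℝ) :
    selfEnergy a r = ∫⁻ w in halfDisc, {w : ℂ | r ≤ ‖discMap a w - a‖}.indicator
      (fun w => ENNReal.ofReal ((‖w‖ ^ 2)⁻¹)) w := by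
  rw [selfEnergy, Set.sdiff_eq, Set.inter_comm, ← Measure.restrict_restrict
    measurableSet_ball.compl, ← lintegral_indicator measurableSet_ball.compl,
    lintegral_halfPlane_eq ha]
  refine setLIntegral_congr_fun measurableSet_halfDisc fun w hw => ?_
  by_cases h : r ≤ ‖discMap a w - a‖
  · rw [Set.indicator_of_mem (by simpa [Complex.dist_eq] using h), Set.indicator_of_mem (by exact h),
      ← norm_discMapDeriv_mul_wallField ha hw, ENNReal.ofReal_mul (by positivity)]
    congr 1
    rw [ENNReal.ofReal_pow (norm_nonneg _), ofReal_norm]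
  · rw [Set.indicator_of_notMem (by simpa [Complex.dist_eq] using h),
      Set.indicator_of_notMem (by exact h), mul_zero]

lemma norm_discMap_sub {a : ℝ} (ha : a ∈ Set.Ioo (-1 : ℝ) 1) {w : ℂ} (hw : w ∈ halfDisc) :
    ‖discMap a w - a‖ = (2 - 2 * a ^ 2) * ‖w‖ / ‖1 + w ^ 2 + 2 * a * w‖ := by
  have := one_sub_sq_pos ha
  have e : (2 * (1 - a * a) : ℂ) = ((2 - 2 * a ^ 2 : ℝ) : ℂ) := by push_cast; ring
  rw [discMap_sub hw, sub_self, zero_mul, zero_add, norm_div, norm_mul, e, Complex.norm_real,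
    Real.norm_of_nonneg (by linarith)]

lemma norm_discMap_denom_sub_one_le {a : ℝ} (ha : a ∈ Set.Ioo (-1 : ℝ) 1) {w : ℂ}
    (hw : w ∈ halfDisc) : ‖w ^ 2 + 2 * a * w‖ ≤ 3 * ‖w‖ := by
  have h1 : |a| ≤ 1 := (abs_lt.2 ha).le
  have h2 : ‖(2 * a * w : ℂ)‖ = 2 * |a| * ‖w‖ := by
    rw [norm_mul, norm_mul, Complex.norm_real, Real.norm_eq_abs]; norm_num
  have h3 : ‖w ^ 2‖ ≤ ‖w‖ := by
    rw [norm_pow]; nlinarith [hw.1, norm_nonneg w]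
  calc ‖w ^ 2 + 2 * a * w‖ ≤ ‖w ^ 2‖ + ‖(2 * a * w : ℂ)‖ := norm_add_le _ _
    _ ≤ 3 * ‖w‖ := by rw [h2]; nlinarith [norm_nonneg w]

/-- With m = 2 - 2a², |`discMap a w - a`| is m|w| divided by a number between 1-3|w| and 1+3|w|.
Hence a point outside the disc of radius r has |w| ≥ r/(m+3r), and the exact integral over that
half-annulus is the bound. -/
lemma selfEnergy_le {a : ℝ} (ha : a ∈ Set.Ioo (-1 : ℝ) 1) {r : ℝ} (hr : 0 < r) :
    selfEnergy a r ≤ ENNReal.ofReal (Real.pi * Real.log ((2 - 2 * a ^ 2) / r + 3)) := by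
  have hm : 0 < 2 - 2 * a ^ 2 := by linarith [one_sub_sq_pos ha]
  have hρ : 0 < r / (2 - 2 * a ^ 2 + 3 * r) := by positivity
  have hρ1 : r / (2 - 2 * a ^ 2 + 3 * r) ≤ 1 := by
    rw [div_le_one (by positivity)]; linarith
  have e : (2 - 2 * a ^ 2) / r + 3 = 1 / (r / (2 - 2 * a ^ 2 + 3 * r)) := by field_simp
  rw [e, ← lintegral_inv_sq_halfDisc hρ hρ1, selfEnergy_eq ha]
  refine setLIntegral_mono' measurableSet_halfDisc fun w hw => ?_
  by_cases h : r ≤ ‖discMap a w - a‖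
  · rw [Set.indicator_of_mem (by exact h), Set.indicator_of_mem]
    have h1 := norm_discMap_denom_sub_one_le ha hw
    have h2 := norm_pos_iff.2 (discMap_denom_ne_zero (a := a) hw)
    rw [norm_discMap_sub ha hw, le_div_iff₀ h2] at h
    have h3 : 1 - 3 * ‖w‖ ≤ ‖1 + w ^ 2 + 2 * a * w‖ := by
      have := norm_sub_norm_le (1 : ℂ) (-(w ^ 2 + 2 * a * w))
      rw [norm_one, norm_neg, sub_neg_eq_add, ← add_assoc] at this
      linarith
    change _ ≤ ‖w‖
    rw [div_le_iff₀ (by positivity)]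
    nlinarith
  · rw [Set.indicator_of_notMem (by exact h)]
    exact zero_le

/-- Conversely |w| ≥ r/(m-3r) keeps the image outside the disc. The condition 4r ≤ m makes this
radius at most 1. -/
lemma le_selfEnergy {a : ℝ} (ha : a ∈ Set.Ioo (-1 : ℝ) 1) {r : ℝ} (hr : 0 < r)
    (hr' : 4 * r ≤ 2 - 2 * a ^ 2) :
    ENNReal.ofReal (Real.pi * Real.log ((2 - 2 * a ^ 2) / r - 3)) ≤ selfEnergy a r := by
  have hρ : 0 < r / (2 - 2 * a ^ 2 - 3 * r) := div_pos hr (by linarith)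
  have hρ1 : r / (2 - 2 * a ^ 2 - 3 * r) ≤ 1 := by
    rw [div_le_one (by linarith)]; linarith
  have e : (2 - 2 * a ^ 2) / r - 3 = 1 / (r / (2 - 2 * a ^ 2 - 3 * r)) := by field_simp
  rw [e, ← lintegral_inv_sq_halfDisc hρ hρ1, selfEnergy_eq ha]
  refine setLIntegral_mono' measurableSet_halfDisc fun w hw => ?_
  by_cases h : r / (2 - 2 * a ^ 2 - 3 * r) ≤ ‖w‖
  · rw [Set.indicator_of_mem (by exact h), Set.indicator_of_mem]
    have h1 := norm_discMap_denom_sub_one_le ha hw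
    have h2 := norm_pos_iff.2 (discMap_denom_ne_zero (a := a) hw)
    change r ≤ ‖discMap a w - a‖
    rw [norm_discMap_sub ha hw, le_div_iff₀ h2]
    have h3 : ‖1 + w ^ 2 + 2 * a * w‖ ≤ 1 + 3 * ‖w‖ := by
      have := norm_add_le (1 : ℂ) (w ^ 2 + 2 * a * w)
      rw [norm_one, ← add_assoc] at this
      linarith
    rw [div_le_iff₀ (by linarith)] at h
    nlinarith
  · rw [Set.indicator_of_notMem (by exact h)]
    exact zero_le

lemma tendsto_selfEnergy {a : ℝ} (ha : a ∈ Set.Ioo (-1 : ℝ) 1) :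
    Tendsto (fun r => (selfEnergy a r).toReal - Real.pi * Real.log (1 / r)) (𝓝[>] 0)
      (𝓝 (Real.pi * Real.log (2 - 2 * a ^ 2))) := by
  have hm : 0 < 2 - 2 * a ^ 2 := by linarith [one_sub_sq_pos ha]
  have hlim : ∀ s : ℝ, Tendsto (fun r : ℝ => Real.pi * Real.log (2 - 2 * a ^ 2 + s * r)) (𝓝[>] 0)
      (𝓝 (Real.pi * Real.log (2 - 2 * a ^ 2))) := by
    intro s
    have : ContinuousAt (fun r : ℝ => Real.pi * Real.log (2 - 2 * a ^ 2 + s * r)) 0 := by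
      refine continuousAt_const.mul (ContinuousAt.log (by fun_prop) (by simpa using hm.ne'))
    have h := this.tendsto
    simp only [mul_zero, add_zero] at h
    exact h.mono_left nhdsWithin_le_nhds
  have hev : ∀ᶠ r : ℝ in 𝓝[>] 0, 0 < r ∧ 4 * r ≤ 2 - 2 * a ^ 2 := by
    have : ∀ᶠ r : ℝ in 𝓝[>] 0, r < (2 - 2 * a ^ 2) / 4 :=
      (eventually_lt_nhds (by positivity : (0 : ℝ) < (2 - 2 * a ^ 2) / 4)).filter_mono
        nhdsWithin_le_nhds
    filter_upwards [self_mem_nhdsWithin, this] with r h1 h2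
    exact ⟨h1, by linarith⟩
  refine tendsto_of_tendsto_of_tendsto_of_le_of_le' (hlim (-3)) (hlim 3) ?_ ?_
  · filter_upwards [hev] with r hr
    have h1 := ENNReal.toReal_mono ((selfEnergy_le ha hr.1).trans_lt ENNReal.ofReal_lt_top).ne
      (le_selfEnergy ha hr.1 hr.2)
    have e : 2 - 2 * a ^ 2 + -3 * r = ((2 - 2 * a ^ 2) / r - 3) * r := by
      field_simp [hr.1.ne']; ring
    have hp : 1 ≤ (2 - 2 * a ^ 2) / r - 3 := by
      rw [le_sub_iff_add_le, le_div_iff₀ hr.1]; linarith [hr.2]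
    rw [ENNReal.toReal_ofReal (mul_nonneg Real.pi_pos.le (Real.log_nonneg hp))] at h1
    rw [e, Real.log_mul (by linarith) hr.1.ne', one_div, Real.log_inv]
    linarith
  · filter_upwards [hev] with r hr
    have h1 := ENNReal.toReal_mono ENNReal.ofReal_ne_top (selfEnergy_le ha hr.1)
    have e : 2 - 2 * a ^ 2 + 3 * r = ((2 - 2 * a ^ 2) / r + 3) * r := by
      field_simp [hr.1.ne']
    have hp : 1 ≤ (2 - 2 * a ^ 2) / r + 3 := by
      have := div_pos hm hr.1
      linarith
    rw [ENNReal.toReal_ofReal (mul_nonneg Real.pi_pos.le (Real.log_nonneg hp))] at h1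
    rw [e, Real.log_mul (by linarith) hr.1.ne', one_div, Real.log_inv]
    linarith

/-! ### The energy of a superposition of wall fields -/

/-- The complex gradient of the potential of walls at `a` with weights `γ`. -/
noncomputable def totalField {N : ℕ} (a γ : Fin N → ℝ) (z : ℂ) : ℂ := ∑ n, γ n • wallField (a n) z

lemma measurable_sqrtOneSubSq : Measurable sqrtOneSubSq := by
  unfold sqrtOneSubSq
  fun_prop

lemma measurable_wallField (a : ℝ) : Measurable (wallField a) := by
  unfold wallField
  have := measurable_sqrtOneSubSq
  fun_prop

lemma measurable_totalField {N : ℕ} (a γ : Fin N → ℝ) : Measurable (totalField a γ) := by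
  unfold totalField
  exact Finset.measurable_sum _ fun n _ => (measurable_wallField _).fun_const_smul _

lemma enorm_sq_eq_ofReal {E : Type*} [SeminormedAddCommGroup E] (x : E) :
    ‖x‖ₑ ^ 2 = ENNReal.ofReal (‖x‖ ^ 2) := by
  rw [ENNReal.ofReal_pow (norm_nonneg _), ofReal_norm]

lemma measurableSet_perforated {N : ℕ} (a : Fin N → ℝ) (r : ℝ) :
    MeasurableSet (perforated a r) :=
  measurableSet_halfPlane.diff (MeasurableSet.iUnion fun _ => measurableSet_ball)

lemma perforated_subset {N : ℕ} (a : Fin N → ℝ) (r : ℝ) (n : Fin N) :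
    perforated a r ⊆ halfPlane \ Metric.ball (a n : ℂ) r :=
  Set.sdiff_subset_sdiff_right (Set.subset_iUnion (fun n => Metric.ball (a n : ℂ) r) n)

/-- Because m/r + 3 ≤ (1/r + 2)² when m ≤ 2. The self-energy bound thereby takes the form required
in the growth condition, for large r as well as small. -/
lemma log_div_add_three_le {m r : ℝ} (hm : 0 < m) (hm2 : m ≤ 2) (hr : 0 < r) :
    Real.log (m / r + 3) ≤ 2 * Real.log (1 / r + 2) := by
  have h1 : 0 < 1 / r := by positivity
  have h2 : m / r ≤ 2 * (1 / r) := by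
    rw [mul_one_div]; gcongr
  have h0 : 0 < m / r := by positivity
  rw [show (2 : ℝ) * Real.log (1 / r + 2) = Real.log ((1 / r + 2) ^ 2) by
    rw [Real.log_pow]; norm_num]
  apply Real.log_le_log (by linarith)
  nlinarith

lemma lintegral_totalField_le {N : ℕ} {a γ : Fin N → ℝ} (ha : ∀ n, a n ∈ Set.Ioo (-1 : ℝ) 1) :
    ∃ C : ℝ, 0 ≤ C ∧ ∀ r : ℝ, 0 < r → ∫⁻ z in perforated a r, ‖totalField a γ z‖ₑ ^ 2
      ≤ ENNReal.ofReal (C * Real.log (1 / r + 2)) := by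
  refine ⟨∑ n, N * γ n ^ 2 * (Real.pi * 2), Finset.sum_nonneg fun n _ => by positivity,
    fun r hr => ?_⟩
  have hlog : 0 ≤ Real.log (1 / r + 2) := Real.log_nonneg (by
    have : 0 < 1 / r := by positivity
    linarith)
  calc ∫⁻ z in perforated a r, ‖totalField a γ z‖ₑ ^ 2
      ≤ ∫⁻ z in perforated a r, ∑ n, ENNReal.ofReal (N * γ n ^ 2) * ‖wallField (a n) z‖ₑ ^ 2 := by
        refine lintegral_mono fun z => ?_
        simp only [enorm_sq_eq_ofReal]
        have e : ∀ n, ENNReal.ofReal (N * γ n ^ 2) * ENNReal.ofReal (‖wallField (a n) z‖ ^ 2)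
            = ENNReal.ofReal (N * γ n ^ 2 * ‖wallField (a n) z‖ ^ 2) := fun n =>
          (ENNReal.ofReal_mul (by positivity)).symm
        simp only [e]
        rw [← ENNReal.ofReal_sum_of_nonneg fun n _ => by positivity]
        apply ENNReal.ofReal_le_ofReal
        calc ‖totalField a γ z‖ ^ 2 ≤ (∑ n, ‖γ n • wallField (a n) z‖) ^ 2 := by
              gcongr
              exact norm_sum_le _ _
          _ ≤ (Finset.univ : Finset (Fin N)).card * ∑ n, ‖γ n • wallField (a n) z‖ ^ 2 :=
              sq_sum_le_card_mul_sum_sq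
          _ = _ := by
              rw [Finset.card_univ, Fintype.card_fin, Finset.mul_sum]
              refine Finset.sum_congr rfl fun n _ => ?_
              rw [norm_smul, mul_pow, Real.norm_eq_abs, sq_abs]
              ring
    _ = ∑ n, ENNReal.ofReal (N * γ n ^ 2) *
          ∫⁻ z in perforated a r, ‖wallField (a n) z‖ₑ ^ 2 := by
        rw [lintegral_finsetSum _ fun n _ =>
          ((measurable_wallField (a n)).enorm.pow_const 2).const_mul _]
        refine Finset.sum_congr rfl fun n _ => ?_
        rw [lintegral_const_mul _ ((measurable_wallField (a n)).enorm.pow_const 2)]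
    _ ≤ ∑ n, ENNReal.ofReal (N * γ n ^ 2) *
          ENNReal.ofReal (Real.pi * (2 * Real.log (1 / r + 2))) := by
        refine Finset.sum_le_sum fun n _ => ?_
        gcongr
        calc _ ≤ selfEnergy (a n) r := lintegral_mono_set (perforated_subset a r n)
          _ ≤ _ := selfEnergy_le (ha n) hr
          _ ≤ _ := by
            gcongr
            exact log_div_add_three_le (by linarith [one_sub_sq_pos (ha n)])
              (by nlinarith [sq_nonneg (a n)]) hr
    _ = _ := by
        rw [Finset.sum_mul, ENNReal.ofReal_sum_of_nonneg fun n _ => by positivity]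
        refine Finset.sum_congr rfl fun n _ => ?_
        rw [← ENNReal.ofReal_mul (by positivity)]
        congr 1
        ring

/-- Dominated convergence on sets that eventually leave every point behind. It serves for small
discs, thin strips along the boundary, and neighbourhoods of an endpoint or of infinity. -/
lemma tendsto_setIntegral_zero {T : Set ℂ} {f : ℂ → ℝ} (hf : IntegrableOn f T)
    {l : Filter ℝ} [l.IsCountablyGenerated] {A : ℝ → Set ℂ} (hA : ∀ r, MeasurableSet (A r))
    (hAT : ∀ᶠ r in l, A r ⊆ T) (hT : MeasurableSet T) (h : ∀ z ∈ T, ∀ᶠ r in l, z ∉ A r) :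
    Tendsto (fun r => ∫ z in A r, f z) l (𝓝 0) := by
  have h1 : Tendsto (fun r => ∫ z in T, (A r).indicator f z) l (𝓝 (∫ z in T, (0 : ℝ))) := by
    refine tendsto_integral_filter_of_dominated_convergence (fun z => ‖f z‖) ?_ ?_ hf.norm ?_
    · exact Eventually.of_forall fun r => hf.aestronglyMeasurable.indicator (hA r)
    · exact Eventually.of_forall fun r => ae_of_all _ fun z => norm_indicator_le_norm_self _ _
    · refine (ae_restrict_iff' hT).2 (ae_of_all _ fun z hz => ?_)
      refine tendsto_const_nhds.congr' ?_
      filter_upwards [h z hz] with r hr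
      rw [Set.indicator_of_notMem hr]
  simp only [integral_zero] at h1
  refine h1.congr' ?_
  filter_upwards [hAT] with r hr
  rw [setIntegral_indicator (hA r), Set.inter_eq_self_of_subset_right hr]

lemma eventually_mem_perforated {N : ℕ} (a : Fin N → ℝ) {z : ℂ} (hz : z ∈ halfPlane) :
    ∀ᶠ r : ℝ in 𝓝[>] 0, z ∈ perforated a r := by
  have h : ∀ᶠ r : ℝ in 𝓝[>] 0, ∀ n, z ∉ Metric.ball (a n : ℂ) r := by
    refine eventually_all.2 fun n => ?_
    have : 0 < dist z (a n) := by
      refine dist_pos.2 fun h => ?_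
      have h1 : 0 < z.im := hz
      simp [h] at h1
    filter_upwards [(eventually_lt_nhds this).filter_mono nhdsWithin_le_nhds] with r hr
    simpa using hr.le
  filter_upwards [h] with r hr
  exact ⟨hz, by simpa using hr⟩

lemma integrableOn_wallField_sq {a : ℝ} (ha : a ∈ Set.Ioo (-1 : ℝ) 1) {r : ℝ} (hr : 0 < r) :
    IntegrableOn (fun z => ‖wallField a z‖ ^ 2) (halfPlane \ Metric.ball (a : ℂ) r) := by
  refine ⟨((measurable_wallField a).norm.pow_const 2).aestronglyMeasurable, ?_⟩
  refine lt_of_le_of_lt (le_of_eq ?_) ((selfEnergy_le ha hr).trans_lt ENNReal.ofReal_lt_top)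
  refine lintegral_congr fun z => ?_
  rw [enorm_pow, enorm_norm]

lemma setIntegral_norm_sq_eq {f : ℂ → ℂ} (hf : Measurable f) (s : Set ℂ) :
    ∫ z in s, ‖f z‖ ^ 2 = (∫⁻ z in s, ‖f z‖ₑ ^ 2).toReal := by
  rw [integral_eq_lintegral_of_nonneg_ae (ae_of_all _ fun z => by positivity)
    (hf.norm.pow_const 2).aestronglyMeasurable]
  simp only [enorm_sq_eq_ofReal]

/-- The perforated domain differs from the one used in `selfEnergy` by the discs about the other
walls, where this field is square integrable, so that removing them changes nothing in the limit. -/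
lemma tendsto_perforated_diag {N : ℕ} {a : Fin N → ℝ} (hinj : Function.Injective a)
    (ha : ∀ n, a n ∈ Set.Ioo (-1 : ℝ) 1) (n : Fin N) :
    Tendsto (fun r => (∫ z in perforated a r, ‖wallField (a n) z‖ ^ 2)
      - Real.pi * Real.log (1 / r)) (𝓝[>] 0) (𝓝 (Real.pi * Real.log (2 - 2 * a n ^ 2))) := by
  -- Half the distance to the nearest other wall bounds δ, so for r < δ the discs about the other
  -- walls miss the ball of radius δ about `a n`.
  obtain ⟨δ, hδ, hsep⟩ : ∃ δ : ℝ, 0 < δ ∧ ∀ k, k ≠ n → 2 * δ ≤ |a k - a n| := by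
    have h : ∀ᶠ δ : ℝ in 𝓝[>] 0, ∀ k, k ≠ n → 2 * δ ≤ |a k - a n| := by
      refine eventually_all.2 fun k => ?_
      by_cases hk : k = n
      · simp [hk]
      have h0 : 0 < |a k - a n| / 2 := by
        have := abs_pos.2 (sub_ne_zero.2 (hinj.ne hk))
        positivity
      filter_upwards [(eventually_lt_nhds h0).filter_mono nhdsWithin_le_nhds] with δ hδ _
      linarith
    obtain ⟨δ, h1, h2⟩ := (h.and self_mem_nhdsWithin).exists
    exact ⟨δ, h2, h1⟩
  have hint := integrableOn_wallField_sq (ha n) hδ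
  have h0 : Tendsto (fun r => ∫ z in (halfPlane \ Metric.ball (a n : ℂ) r) \ perforated a r,
      ‖wallField (a n) z‖ ^ 2) (𝓝[>] 0) (𝓝 0) := by
    refine tendsto_setIntegral_zero hint (fun r => (measurableSet_halfPlane.diff
      measurableSet_ball).diff (measurableSet_perforated a r)) ?_ (measurableSet_halfPlane.diff
      measurableSet_ball) ?_
    · filter_upwards [(eventually_lt_nhds hδ).filter_mono nhdsWithin_le_nhds] with r hr
      rintro z ⟨⟨hz, hzn⟩, hzp⟩
      refine ⟨hz, fun hb => hzp ⟨hz, fun hu => ?_⟩⟩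
      obtain ⟨k, hk⟩ := Set.mem_iUnion.1 hu
      by_cases hkn : k = n
      · exact hzn (hkn ▸ hk)
      · have h1 := hsep k hkn
        have h2 : |a k - a n| ≤ dist z (a k) + dist z (a n) := by
          rw [dist_comm z]
          refine le_trans (le_of_eq ?_) (dist_triangle (a k : ℂ) z (a n))
          rw [Complex.dist_eq, ← Complex.ofReal_sub, Complex.norm_real, Real.norm_eq_abs]
        have h3 := Metric.mem_ball.1 hk
        have h4 := Metric.mem_ball.1 hb
        linarith
    · intro z hz
      filter_upwards [eventually_mem_perforated a hz.1] with r hr h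
      exact h.2 hr
  have h1 := (tendsto_selfEnergy (ha n)).sub h0
  rw [sub_zero] at h1
  refine h1.congr' ?_
  filter_upwards [self_mem_nhdsWithin] with r hr
  have hr' : 0 < r := hr
  rw [setIntegral_sdiff (measurableSet_perforated a r) (integrableOn_wallField_sq (ha n) hr')
    (perforated_subset a r n), setIntegral_norm_sq_eq (measurable_wallField _) (halfPlane \ _),
    selfEnergy]
  ring

/-- The product of two different fields is integrable on the whole half-plane, so interactions need
no renormalisation. -/
lemma tendsto_perforated_cross {N : ℕ} {a : Fin N → ℝ} (hinj : Function.Injective a)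
    (ha : ∀ n, a n ∈ Set.Ioo (-1 : ℝ) 1) {n k : Fin N} (hk : k ≠ n) :
    Tendsto (fun r => ∫ z in perforated a r, inner ℝ (wallField (a k) z) (wallField (a n) z))
      (𝓝[>] 0) (𝓝 (Real.pi * Real.log ((1 + Real.sqrt (1 - rho (a k) (a n) ^ 2))
        / rho (a k) (a n)))) := by
  have hint := integrableOn_inner_wallField (ha k) (ha n) (hinj.ne hk)
  have h0 := tendsto_setIntegral_zero (l := 𝓝[>] (0 : ℝ)) (A := fun r => halfPlane \ perforated a r)
    hint (fun r => measurableSet_halfPlane.diff (measurableSet_perforated a r))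
    (Eventually.of_forall fun r => Set.sdiff_subset) measurableSet_halfPlane (fun z hz => by
      filter_upwards [eventually_mem_perforated a hz] with r hr h
      exact h.2 hr)
  have h1 := (tendsto_const_nhds (x := ∫ z in halfPlane,
    inner ℝ (wallField (a k) z) (wallField (a n) z)) (f := 𝓝[>] (0 : ℝ))).sub h0
  rw [sub_zero, integral_inner_wallField (ha k) (ha n) (hinj.ne hk)] at h1
  refine h1.congr fun r => ?_
  rw [setIntegral_sdiff (measurableSet_perforated a r) hint Set.sdiff_subset,
    ← integral_inner_wallField (ha k) (ha n) (hinj.ne hk)]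
  ring

lemma norm_totalField_sq {N : ℕ} (a γ : Fin N → ℝ) (z : ℂ) :
    ‖totalField a γ z‖ ^ 2 = ∑ n, γ n ^ 2 * ‖wallField (a n) z‖ ^ 2
      + ∑ n, ∑ k with k ≠ n, γ k * γ n * inner ℝ (wallField (a k) z) (wallField (a n) z) := by
  rw [← real_inner_self_eq_norm_sq, totalField, inner_sum, ← Finset.sum_add_distrib]
  refine Finset.sum_congr rfl fun n _ => ?_
  rw [sum_inner, ← Finset.add_sum_erase _ _ (Finset.mem_univ n)]
  congr 1
  · rw [real_inner_smul_left, real_inner_smul_right, real_inner_self_eq_norm_sq]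
    ring
  · rw [← Finset.filter_ne' Finset.univ n]
    refine Finset.sum_congr rfl fun k _ => ?_
    rw [real_inner_smul_left, real_inner_smul_right]
    ring

lemma tendsto_totalField_energy {N : ℕ} {a : Fin N → ℝ} (γ : Fin N → ℝ)
    (hinj : Function.Injective a) (ha : ∀ n, a n ∈ Set.Ioo (-1 : ℝ) 1) :
    Tendsto (fun r => (∫⁻ z in perforated a r, ‖totalField a γ z‖ₑ ^ 2).toReal
        - Real.pi * Real.log (1 / r) * ∑ n, γ n ^ 2) (𝓝[>] 0)
      (𝓝 (∑ n, γ n ^ 2 * (Real.pi * Real.log (2 - 2 * a n ^ 2))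
        + ∑ n, ∑ k with k ≠ n, γ k * γ n *
          (Real.pi * Real.log ((1 + Real.sqrt (1 - rho (a k) (a n) ^ 2))
            / rho (a k) (a n))))) := by
  have h1 := tendsto_finsetSum Finset.univ fun n _ =>
    (tendsto_perforated_diag hinj ha n).const_mul (γ n ^ 2)
  have h2 := tendsto_finsetSum Finset.univ fun n _ =>
    tendsto_finsetSum (Finset.univ.filter (· ≠ n)) fun k hk =>
      (tendsto_perforated_cross hinj ha (Finset.mem_filter.1 hk).2).const_mul (γ k * γ n)
  refine (h1.add h2).congr' ?_
  filter_upwards [self_mem_nhdsWithin] with r hr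
  have hr' : 0 < r := hr
  have i1 : ∀ n, IntegrableOn (fun z => γ n ^ 2 * ‖wallField (a n) z‖ ^ 2) (perforated a r) :=
    fun n => ((integrableOn_wallField_sq (ha n) hr').mono_set (perforated_subset a r n)).const_mul _
  have i2 : ∀ n, ∀ k ∈ Finset.univ.filter (· ≠ n), IntegrableOn (fun z =>
      γ k * γ n * inner ℝ (wallField (a k) z) (wallField (a n) z)) (perforated a r) :=
    fun n k hk => ((integrableOn_inner_wallField (ha k) (ha n)
      (hinj.ne (Finset.mem_filter.1 hk).2)).mono_set Set.sdiff_subset).const_mul _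
  rw [← setIntegral_norm_sq_eq (measurable_totalField a γ)]
  simp only [norm_totalField_sq]
  rw [integral_add (integrable_finsetSum _ fun n _ => i1 n)
    (integrable_finsetSum _ fun n _ => integrable_finsetSum _ (i2 n)),
    integral_finsetSum _ fun n _ => i1 n,
    integral_finsetSum _ fun n _ => integrable_finsetSum _ (i2 n)]
  rw [Finset.mul_sum, add_sub_right_comm, ← Finset.sum_sub_distrib]
  congr 1
  · refine Finset.sum_congr rfl fun n _ => ?_
    rw [integral_const_mul]
    ring
  · refine Finset.sum_congr rfl fun n _ => ?_
    rw [integral_finsetSum _ (i2 n)]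
    refine Finset.sum_congr rfl fun k _ => ?_
    rw [integral_const_mul]

lemma renormalisedEnergy_eq {N : ℕ} {a γ : Fin N → ℝ} {u : ℂ → ℝ}
    (hinj : Function.Injective a) (ha : ∀ n, a n ∈ Set.Ioo (-1 : ℝ) 1)
    (hu : ∀ z ∈ halfPlane, ‖gradient u z‖ₑ = ‖totalField a γ z‖ₑ) :
    renormalisedEnergy a γ u =
        ((Real.pi / 2 * ∑ n, γ n ^ 2 * Real.log (2 - 2 * a n ^ 2)
          + Real.pi / 2 * ∑ n, ∑ k with k ≠ n, γ k * γ n *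
              Real.log ((1 + Real.sqrt (1 - rho (a k) (a n) ^ 2))
                / rho (a k) (a n)) : ℝ) : EReal) := by
  have h := tendsto_totalField_energy γ hinj ha
  obtain ⟨C, -, hC⟩ := lintegral_totalField_le (γ := γ) ha
  have h1 := (continuous_coe_real_ereal.tendsto _).comp h
  have hd : ∀ r, dirichlet u (perforated a r)
      = ∫⁻ z in perforated a r, ‖totalField a γ z‖ₑ ^ 2 := fun r =>
    setLIntegral_congr_fun (measurableSet_perforated a r) fun z hz => by rw [hu z hz.1]
  have h2 := h1.congr' (f₂ := fun r : ℝ => ((dirichlet u (perforated a r) : ℝ≥0∞) : EReal)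
      - ((Real.pi * Real.log (1 / r) * ∑ n, γ n ^ 2 : ℝ) : EReal)) (by
    filter_upwards [self_mem_nhdsWithin] with r hr
    have hfin := ((hC r hr).trans_lt ENNReal.ofReal_lt_top).ne
    -- The energy for fixed r is finite, so the extended subtraction agrees with the real one.
    rw [hd, Function.comp_apply, EReal.coe_sub, EReal.coe_ennreal_toReal hfin])
  rw [renormalisedEnergy, h2.liminf_eq, ← EReal.coe_mul]
  congr 1
  rw [mul_add, Finset.mul_sum, Finset.mul_sum, Finset.mul_sum, Finset.mul_sum]
  congr 1
  · exact Finset.sum_congr rfl fun n _ => by ring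
  · refine Finset.sum_congr rfl fun n _ => ?_
    rw [Finset.mul_sum, Finset.mul_sum]
    exact Finset.sum_congr rfl fun k _ => by ring

/-! ### Green's formula on the half-plane -/

lemma isPreconnected_halfPlane : IsPreconnected halfPlane :=
  (convex_halfSpace_im_gt 0).isPreconnected

lemma hasGradientAt_re {F : ℂ → ℂ} {f' z : ℂ} (h : HasDerivAt F f' z) :
    HasGradientAt (fun z => (F z).re) ((starRingEnd ℂ) f') z := by
  rw [hasGradientAt_iff_hasFDerivAt]
  have h1 := Complex.reCLM.hasFDerivAt.comp z (h.hasFDerivAt.restrictScalars ℝ)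
  refine h1.congr_fderiv ?_
  ext
  simp [Complex.inner]

/-- Turns the weak Neumann integral into one to which Cauchy's formula applies: ∂₁ + i∂₂ is twice
the ∂̄ operator, and a holomorphic factor passes through it. -/
lemma inner_gradient_eq {h : ℂ} {ζ : ℂ → ℝ} (z : ℂ) :
    inner ℝ ((starRingEnd ℂ) h) (gradient ζ z)
      = (h * (fderiv ℝ ζ z 1 + Complex.I * fderiv ℝ ζ z Complex.I)).re := by
  rw [inner_gradient_right]
  have : (starRingEnd ℂ) h = h.re • (1 : ℂ) + (-h.im) • Complex.I := by
    apply Complex.ext <;> simp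
  rw [this, map_add, map_smul, map_smul]
  simp [sub_eq_add_neg]

/-- The complex derivative `∂₁ ζ + i ∂₂ ζ` of a real function. -/
noncomputable def complexGrad (ζ : ℂ → ℝ) (z : ℂ) : ℂ :=
  fderiv ℝ ζ z 1 + Complex.I * fderiv ℝ ζ z Complex.I

lemma continuous_complexGrad {ζ : ℂ → ℝ} (hζ : ContDiff ℝ ∞ ζ) : Continuous (complexGrad ζ) := by
  have h := hζ.continuous_fderiv (by simp)
  unfold complexGrad
  fun_prop

lemma complexGrad_eq_zero {ζ : ℂ → ℝ} {z : ℂ} (hz : z ∉ tsupport ζ) : complexGrad ζ z = 0 := by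
  have : fderiv ℝ ζ z = 0 := by
    by_contra h
    exact hz (support_fderiv_subset ℝ h)
  simp [complexGrad, this]

lemma setIntegral_reProdIm {f : ℂ → ℂ} {a b c d : ℝ} (hab : a ≤ b) (hcd : c ≤ d)
    (hf : IntegrableOn f (Set.Ioc a b ×ℂ Set.Ioc c d)) :
    ∫ z in Set.Ioc a b ×ℂ Set.Ioc c d, f z
      = ∫ x in a..b, ∫ y in c..d, f (x + y * Complex.I) := by
  have e : Set.Ioc a b ×ℂ Set.Ioc c d
      = Complex.measurableEquivRealProd ⁻¹' (Set.Ioc a b ×ˢ Set.Ioc c d) := by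
    ext z
    simp [Complex.mem_reProdIm, Complex.measurableEquivRealProd_apply]
  have e2 : f = (fun p => f (Complex.measurableEquivRealProd.symm p)) ∘
      Complex.measurableEquivRealProd := by
    ext z; simp
  have hmp := Complex.volume_preserving_equiv_real_prod
  have hemb := Complex.measurableEquivRealProd.measurableEmbedding
  rw [e, e2, hmp.integrableOn_comp_preimage hemb] at hf
  rw [e]
  conv_lhs => rw [e2]
  rw [show (∫ z in Complex.measurableEquivRealProd ⁻¹' (Set.Ioc a b ×ˢ Set.Ioc c d),
      ((fun p => f (Complex.measurableEquivRealProd.symm p)) ∘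
        Complex.measurableEquivRealProd) z)
    = ∫ p in Set.Ioc a b ×ˢ Set.Ioc c d, f (Complex.measurableEquivRealProd.symm p) from
    hmp.setIntegral_preimage_emb hemb
      (fun p => f (Complex.measurableEquivRealProd.symm p)) _]
  rw [Measure.volume_eq_prod] at hf ⊢
  rw [setIntegral_prod _ hf, intervalIntegral.integral_of_le hab]
  refine setIntegral_congr_fun measurableSet_Ioc fun x _ => ?_
  rw [intervalIntegral.integral_of_le hcd]
  refine setIntegral_congr_fun measurableSet_Ioc fun y _ => ?_
  simp only [Complex.measurableEquivRealProd_symm_apply]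
  congr 1
  apply Complex.ext <;> simp

/-- Green's formula above the line at height `t`. -/
lemma integral_line_eq {h : ℂ → ℂ} (hh : DifferentiableOn ℂ h halfPlane) {ζ : ℂ → ℝ}
    (hζ : ContDiff ℝ ∞ ζ) (hc : HasCompactSupport ζ) {t : ℝ} (ht : 0 < t) :
    ∫ x : ℝ, ζ (x + t * Complex.I) • h (x + t * Complex.I)
      = ∫ z in {z : ℂ | t < z.im}, Complex.I * (h z * complexGrad ζ z) := by
  obtain ⟨R₀, hR₀⟩ := hc.isCompact.isBounded.subset_ball 0
  -- The rectangle [-R,R] × [t,R] reaches beyond the support of ζ on three sides, so only its bottom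
  -- side contributes to the boundary integral.
  obtain ⟨R, hR, htR⟩ : ∃ R, R₀ ≤ R ∧ t < R := ⟨max R₀ (t + 1), le_max_left _ _,
    (lt_add_one t).trans_le (le_max_right _ _)⟩
  have hR0 : 0 < R := ht.trans htR
  have hout : ∀ z : ℂ, R ≤ ‖z‖ → z ∉ tsupport ζ := fun z hz hm => by
    have := hR₀ hm
    rw [mem_ball_zero_iff] at this
    linarith
  have hout' : ∀ z : ℂ, R ≤ ‖z‖ → ζ z = 0 := fun z hz => image_eq_zero_of_notMem_tsupport (hout z hz)
  have hcH : ContinuousOn h halfPlane := hh.continuousOn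
  have hg := continuous_complexGrad hζ
  have hsub : (Set.uIcc (-R + t * Complex.I : ℂ).re (R + R * Complex.I : ℂ).re ×ℂ
      Set.uIcc (-R + t * Complex.I : ℂ).im (R + R * Complex.I : ℂ).im) ⊆ halfPlane := by
    intro z hz
    rw [Complex.mem_reProdIm] at hz
    have := hz.2
    simp only [Complex.add_im, Complex.neg_im, Complex.ofReal_im, Complex.mul_im, Complex.ofReal_re,
      Complex.I_im, Complex.I_re, mul_one, mul_zero, add_zero, neg_zero, zero_add,
      Set.uIcc_of_le htR.le] at this
    exact ht.trans_le this.1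
  have hd : ∀ z ∈ halfPlane, HasFDerivAt (fun z => ζ z • h z)
      (ζ z • (ContinuousLinearMap.toSpanSingleton ℂ (deriv h z)).restrictScalars ℝ
        + (fderiv ℝ ζ z).smulRight (h z)) z := by
    intro z hz
    have h1 := (hζ.differentiable (by simp) z).hasFDerivAt
    have h2 := (hh.differentiableAt (isOpen_halfPlane.mem_nhds hz)).hasDerivAt.hasFDerivAt
    exact h1.smul (h2.restrictScalars ℝ)
  -- The derivative of h is complex linear and cancels in this combination; only the derivatives of
  -- ζ remain.
  have hval : ∀ z, Complex.I • (ζ z • (ContinuousLinearMap.toSpanSingleton ℂ (deriv h z)).restrictScalars ℝ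
        + (fderiv ℝ ζ z).smulRight (h z)) 1 - (ζ z • (ContinuousLinearMap.toSpanSingleton ℂ (deriv h z)).restrictScalars ℝ
        + (fderiv ℝ ζ z).smulRight (h z)) Complex.I = Complex.I * (h z * complexGrad ζ z) := by
    intro z
    simp [complexGrad]
    linear_combination (-(h z * fderiv ℝ ζ z Complex.I)) * Complex.I_sq
  have hcont : ContinuousOn (fun z => Complex.I * (h z * complexGrad ζ z)) halfPlane := by fun_prop
  have key := Complex.integral_boundary_rect_of_continuousOn_of_hasFDerivAt_real
    (fun z => ζ z • h z) _ (-R + t * Complex.I) (R + R * Complex.I)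
    ((hζ.continuous.continuousOn.smul hcH).mono hsub)
    (fun z hz => hd z (hsub (by
      rw [Complex.mem_reProdIm] at hz ⊢
      exact ⟨Set.Ioo_subset_Icc_self hz.1, Set.Ioo_subset_Icc_self hz.2⟩))) (by
      simp only [hval]
      refine (hcont.mono hsub).integrableOn_compact ?_
      exact isCompact_uIcc.reProdIm isCompact_uIcc)
  simp only [hval] at key
  simp only [Complex.add_im, Complex.neg_im, Complex.ofReal_im, Complex.mul_im, Complex.ofReal_re,
    Complex.I_im, Complex.I_re, mul_one, mul_zero, add_zero, neg_zero, zero_add, Complex.add_re,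
    Complex.neg_re, Complex.mul_re, sub_zero] at key
  have z1 : ∀ x : ℝ, ζ (x + R * Complex.I) = 0 := fun x => hout' _ (by
    have := Complex.abs_im_le_norm (x + R * Complex.I)
    simp [abs_of_pos hR0] at this
    exact this)
  have z2 : ∀ y : ℝ, ζ (R + y * Complex.I) = 0 := fun y => hout' _ (by
    have := Complex.abs_re_le_norm (R + y * Complex.I)
    simp [abs_of_pos hR0] at this
    exact this)
  have z3 : ∀ y : ℝ, ζ ((-R : ℝ) + y * Complex.I) = 0 := fun y => hout' _ (by
    have := Complex.abs_re_le_norm ((-R : ℝ) + y * Complex.I)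
    simpa [abs_of_pos hR0] using this)
  simp only [z1, z2, z3, zero_smul, intervalIntegral.integral_zero, smul_zero, sub_zero,
    add_zero] at key
  have hRR : -R ≤ R := by linarith
  have hint : IntegrableOn (fun z => Complex.I * (h z * complexGrad ζ z))
      (Set.Ioc (-R) R ×ℂ Set.Ioc t R) := by
    have hK : IsCompact (Set.Icc (-R) R ×ℂ Set.Icc t R) := isCompact_Icc.reProdIm isCompact_Icc
    refine ((hcont.mono fun z hz => ?_).integrableOn_compact hK).mono_set fun z hz => ?_
    · rw [Complex.mem_reProdIm] at hz
      exact ht.trans_le hz.2.1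
    · rw [Complex.mem_reProdIm] at hz ⊢
      exact ⟨Set.Ioc_subset_Icc_self hz.1, Set.Ioc_subset_Icc_self hz.2⟩
  rw [← setIntegral_reProdIm hRR htR.le hint] at key
  have l1 : ∫ x : ℝ, ζ (x + t * Complex.I) • h (x + t * Complex.I)
      = ∫ x in (-R)..R, ζ (x + t * Complex.I) • h (x + t * Complex.I) := by
    rw [intervalIntegral.integral_eq_integral_of_support_subset]
    intro x hx
    by_contra hx'
    apply hx
    have : R ≤ |x| := by
      by_contra hlt
      rw [not_le, abs_lt] at hlt
      exact hx' ⟨hlt.1, hlt.2.le⟩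
    have h2 : R ≤ ‖(x + t * Complex.I : ℂ)‖ := by
      have := Complex.abs_re_le_norm (x + t * Complex.I)
      simp at this
      linarith
    simp only [hout' _ h2, zero_smul]
  rw [l1, key]
  symm
  refine setIntegral_eq_of_subset_of_forall_sdiff_eq_zero
    (measurableSet_lt measurable_const Complex.measurable_im) (fun z hz => ?_) fun z hz => ?_
  · rw [Complex.mem_reProdIm] at hz
    exact hz.2.1
  · have h2 : R ≤ ‖z‖ := by
      by_contra hlt
      rw [not_le] at hlt
      have h3 := abs_lt.1 ((Complex.abs_re_le_norm z).trans_lt hlt)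
      have h4 := abs_lt.1 ((Complex.abs_im_le_norm z).trans_lt hlt)
      refine hz.2 ?_
      rw [Complex.mem_reProdIm]
      exact ⟨⟨h3.1, h3.2.le⟩, ⟨hz.1, h4.2.le⟩⟩
    simp [complexGrad_eq_zero (hout z h2)]

/-- Green's formula on the half-plane, with the boundary integral as a limit. -/
lemma tendsto_integral_line {h : ℂ → ℂ} (hh : DifferentiableOn ℂ h halfPlane) {ζ : ℂ → ℝ}
    (hζ : ContDiff ℝ ∞ ζ) (hc : HasCompactSupport ζ)
    (hint : IntegrableOn (fun z => h z * complexGrad ζ z) halfPlane) :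
    Tendsto (fun t : ℝ => ∫ x : ℝ, ζ (x + t * Complex.I) * (h (x + t * Complex.I)).im) (𝓝[>] 0)
      (𝓝 (∫ z in halfPlane, (h z * complexGrad ζ z).re)) := by
  have hre : IntegrableOn (fun z => (h z * complexGrad ζ z).re) halfPlane := hint.re
  have h0 := tendsto_setIntegral_zero (l := 𝓝[>] (0 : ℝ)) hre
    (A := fun t => halfPlane \ {z : ℂ | t < z.im})
    (fun t => measurableSet_halfPlane.diff (measurableSet_lt measurable_const Complex.measurable_im))
    (Eventually.of_forall fun t => Set.sdiff_subset) measurableSet_halfPlane (fun z hz => by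
      filter_upwards [(eventually_lt_nhds (show 0 < z.im from hz)).filter_mono nhdsWithin_le_nhds]
        with t ht hm
      exact hm.2 ht)
  have h1 := (tendsto_const_nhds (x := ∫ z in halfPlane, (h z * complexGrad ζ z).re)
    (f := 𝓝[>] (0 : ℝ))).sub h0
  rw [sub_zero] at h1
  refine h1.congr' ?_
  filter_upwards [self_mem_nhdsWithin] with t ht
  have ht' : 0 < t := ht
  have hsub : {z : ℂ | t < z.im} ⊆ halfPlane := fun z hz => ht'.trans hz
  rw [setIntegral_sdiff (measurableSet_lt measurable_const Complex.measurable_im) hre hsub,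
    sub_sub_cancel]
  have key := integral_line_eq hh hζ hc ht'
  -- As Im(iX) = Re X, the imaginary part of Green's formula is the Neumann pairing.
  have key2 := congrArg Complex.im key
  have hcl : Continuous fun x : ℝ => h (x + t * Complex.I) :=
    hh.continuousOn.comp_continuous (by fun_prop) fun x => by
      change 0 < (x + t * Complex.I : ℂ).im
      simpa using ht'
  have i1 : Integrable fun x : ℝ => ζ (x + t * Complex.I) • h (x + t * Complex.I) := by
    refine Continuous.integrable_of_hasCompactSupport
      ((hζ.continuous.comp (by fun_prop)).smul hcl) ?_
    have : HasCompactSupport fun x : ℝ => ζ (x + t * Complex.I) := by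
      refine hc.comp_isClosedEmbedding (g := fun x : ℝ => (x + t * Complex.I : ℂ)) ?_
      exact (Homeomorph.addRight (t * Complex.I : ℂ)).isClosedEmbedding.comp
        Complex.isometry_ofReal.isClosedEmbedding
    exact this.smul_right
  have i2 : IntegrableOn (fun z => Complex.I * (h z * complexGrad ζ z)) {z : ℂ | t < z.im} :=
    (hint.mono_set hsub).const_mul _
  rw [← Complex.imCLM_apply, ← Complex.imCLM_apply, ← ContinuousLinearMap.integral_comp_comm _ i1,
    ← ContinuousLinearMap.integral_comp_comm _ i2] at key2
  simp only [Complex.imCLM_apply, Complex.smul_im, smul_eq_mul, Complex.I_mul_im] at key2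
  exact key2.symm

/-! ### The limiting stray-field potential -/

/-- The potential of walls at `a` with weights `γ`. -/
noncomputable def potential {N : ℕ} (a γ : Fin N → ℝ) (z : ℂ) : ℝ :=
  ∑ n, γ n * ((wallCoord (a n) z).arg - Real.pi / 2)

/-- A holomorphic function whose real part is the potential up to a constant. -/
noncomputable def complexPotential {N : ℕ} (a γ : Fin N → ℝ) (z : ℂ) : ℂ :=
  ∑ n, γ n * (-Complex.I * Complex.log (wallCoord (a n) z) - Real.pi / 2)

lemma complexPotential_re {N : ℕ} (a γ : Fin N → ℝ) (z : ℂ) :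
    (complexPotential a γ z).re = potential a γ z := by
  rw [complexPotential, potential, Complex.re_sum]
  refine Finset.sum_congr rfl fun n _ => ?_
  rw [Complex.re_ofReal_mul, Complex.sub_re, neg_mul, Complex.neg_re, Complex.I_mul_re,
    Complex.log_im, neg_neg]
  congr 2
  rw [show ((Real.pi : ℂ) / 2) = ((Real.pi / 2 : ℝ) : ℂ) by push_cast; ring, Complex.ofReal_re]

lemma sqrtOneSubSq_ne_zero {z : ℂ} (hz : 1 - z ^ 2 ∈ Complex.slitPlane) : sqrtOneSubSq z ≠ 0 :=
  fun h => by
    have := sqrtOneSubSq_re_pos hz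
    simp [h] at this

lemma sub_ofReal_ne_zero {a : ℝ} {z : ℂ} (hz : z ∈ halfPlane) : z - a ≠ 0 := fun h => by
  have h1 : 0 < z.im := hz
  rw [sub_eq_zero.1 h] at h1
  simp at h1

lemma hasDerivAt_wallCoord {a : ℝ} (ha : a ∈ Set.Ioo (-1 : ℝ) 1) {z : ℂ}
    (hz : 1 - z ^ 2 ∈ Complex.slitPlane) :
    HasDerivAt (wallCoord a) (Real.sqrt (1 - a ^ 2) /
      (sqrtOneSubSq z * wallDenom a z)) z := by
  have hs := sqrtOneSubSq_ne_zero hz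
  have hD := wallDenom_ne_zero ha hz
  have h1 : HasDerivAt (wallDenom a)
      (-a + (Real.sqrt (1 - a ^ 2) : ℝ) * (-z / sqrtOneSubSq z)) z := by
    have := (((hasDerivAt_id z).const_mul (a : ℂ)).const_sub 1).fun_add
      ((hasDerivAt_sqrtOneSubSq hz).const_mul ((Real.sqrt (1 - a ^ 2) : ℝ) : ℂ))
    simp only [mul_one, id] at this
    exact this
  convert! ((hasDerivAt_id z).sub_const (a : ℂ)).div h1 hD using 1
  have hc := ofReal_sqrt_one_sub_sq ha
  have hsq := sqrtOneSubSq_sq z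
  rw [div_eq_div_iff (mul_ne_zero hs hD) (pow_ne_zero 2 hD)]
  have e : -z / sqrtOneSubSq z * sqrtOneSubSq z = -z := div_mul_cancel₀ _ hs
  have hDd : wallDenom a z = 1 - a * z + (Real.sqrt (1 - a ^ 2) : ℝ) * sqrtOneSubSq z := rfl
  simp only [id]
  set s := sqrtOneSubSq z
  set c : ℂ := ((Real.sqrt (1 - a ^ 2) : ℝ) : ℂ)
  set D := wallDenom a z
  have : (1 * D - (z - a) * (-a + c * (-z / s))) * s = c * D := by
    linear_combination (-(z - a) * c) * e + (s - c) * hDd - s * hc + c * hsq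
  linear_combination (-D) * this

/-- In the logarithmic derivative of `wallCoord` the factor `wallDenom` cancels, which leaves the
simple form of `wallField`. -/
lemma hasDerivAt_log_wallCoord {a : ℝ} (ha : a ∈ Set.Ioo (-1 : ℝ) 1) {z : ℂ}
    (hz : z ∈ halfPlane) :
    HasDerivAt (fun z => -Complex.I * Complex.log (wallCoord a z) - Real.pi / 2)
      (wallField a z) z := by
  have hz' := mem_slitPlane_of_mem_halfPlane hz
  have hw := wallCoord_mem ha hz
  have h1 : wallCoord a z ∈ Complex.slitPlane :=
    Complex.mem_slitPlane_iff.2 (Or.inr hw.2.ne')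
  have h2 := (((hasDerivAt_wallCoord ha hz').clog h1).const_mul (-Complex.I)).sub_const
    ((Real.pi : ℂ) / 2)
  convert! h2 using 1
  have hs := sqrtOneSubSq_ne_zero hz'
  have hD := wallDenom_ne_zero ha hz'
  have hza := sub_ofReal_ne_zero (a := a) hz
  rw [wallField, wallCoord]
  field_simp

lemma hasDerivAt_complexPotential {N : ℕ} {a : Fin N → ℝ} (γ : Fin N → ℝ)
    (ha : ∀ n, a n ∈ Set.Ioo (-1 : ℝ) 1) {z : ℂ} (hz : z ∈ halfPlane) :
    HasDerivAt (complexPotential a γ) (totalField a γ z) z := by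
  have := HasDerivAt.fun_sum (u := Finset.univ) fun n _ =>
    (hasDerivAt_log_wallCoord (ha n) hz).const_mul (γ n : ℂ)
  convert! this using 1

lemma hasGradientAt_potential {N : ℕ} {a : Fin N → ℝ} (γ : Fin N → ℝ)
    (ha : ∀ n, a n ∈ Set.Ioo (-1 : ℝ) 1) {z : ℂ} (hz : z ∈ halfPlane) :
    HasGradientAt (potential a γ) ((starRingEnd ℂ) (totalField a γ z)) z := by
  have := hasGradientAt_re (hasDerivAt_complexPotential γ ha hz)
  simpa only [complexPotential_re] using this

lemma differentiableOn_complexPotential {N : ℕ} {a : Fin N → ℝ} (γ : Fin N → ℝ)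
    (ha : ∀ n, a n ∈ Set.Ioo (-1 : ℝ) 1) :
    DifferentiableOn ℂ (complexPotential a γ) halfPlane := fun _ hz =>
  (hasDerivAt_complexPotential γ ha hz).differentiableAt.differentiableWithinAt

lemma differentiableOn_totalField {N : ℕ} {a : Fin N → ℝ} (γ : Fin N → ℝ)
    (ha : ∀ n, a n ∈ Set.Ioo (-1 : ℝ) 1) : DifferentiableOn ℂ (totalField a γ) halfPlane :=
  ((differentiableOn_complexPotential γ ha).deriv isOpen_halfPlane).congr fun _ hz =>
    (hasDerivAt_complexPotential γ ha hz).deriv.symm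

lemma harmonicOnNhd_potential {N : ℕ} {a : Fin N → ℝ} (γ : Fin N → ℝ)
    (ha : ∀ n, a n ∈ Set.Ioo (-1 : ℝ) 1) :
    InnerProductSpace.HarmonicOnNhd (potential a γ) halfPlane := by
  intro z hz
  have := ((differentiableOn_complexPotential γ ha).analyticAt
    (isOpen_halfPlane.mem_nhds hz)).harmonicAt_re
  simpa only [complexPotential_re] using this

lemma sqrtOneSubSq_ofReal {x : ℝ} (hx : x ∈ Set.Ioo (-1 : ℝ) 1) :
    sqrtOneSubSq x = (Real.sqrt (1 - x ^ 2) : ℝ) := by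
  rw [sqrtOneSubSq, Real.sqrt_eq_rpow, Complex.ofReal_cpow (one_sub_sq_pos hx).le]
  push_cast
  rfl

lemma wallCoord_ofReal {a x : ℝ} (hx : x ∈ Set.Ioo (-1 : ℝ) 1) :
    wallCoord a x = ((x - a) /
      (1 - a * x + Real.sqrt (1 - a ^ 2) * Real.sqrt (1 - x ^ 2)) : ℝ) := by
  rw [wallCoord, wallDenom, sqrtOneSubSq_ofReal hx]
  push_cast
  rfl

lemma ofReal_mem_slitPlane {x : ℝ} (hx : x ∈ Set.Ioo (-1 : ℝ) 1) :
    1 - (x : ℂ) ^ 2 ∈ Complex.slitPlane :=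
  one_sub_sq_mem_slitPlane_iff.2 (Or.inr (by simpa using hx))

lemma tendsto_vertical (x : ℝ) : Tendsto (fun t : ℝ => (⟨x, t⟩ : ℂ)) (𝓝[>] 0) (𝓝[halfPlane] x) := by
  refine tendsto_nhdsWithin_iff.2 ⟨?_, ?_⟩
  · have h : Continuous fun t : ℝ => (⟨x, t⟩ : ℂ) := by
      have : (fun t : ℝ => (⟨x, t⟩ : ℂ)) = fun t : ℝ => (x + t * Complex.I : ℂ) := by
        ext t; apply Complex.ext <;> simp
      rw [this]
      fun_prop
    have h2 := (h.tendsto 0).mono_left (nhdsWithin_le_nhds (s := Set.Ioi 0))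
    exact h2
  · filter_upwards [self_mem_nhdsWithin] with t ht
    exact ht

/-- On (-1,1) the coordinate is real with the sign of x-a. Inside the half-plane its values have
positive imaginary part, and from that side the argument is continuous even at the negative axis. -/
lemma tendsto_arg_wallCoord {a x : ℝ} (ha : a ∈ Set.Ioo (-1 : ℝ) 1)
    (hx : x ∈ Set.Ioo (-1 : ℝ) 1) (hxa : x ≠ a) :
    Tendsto (fun z => (wallCoord a z).arg) (𝓝[halfPlane] x)
      (𝓝 (if x < a then Real.pi else 0)) := by
  have hD := relPos_denom_pos ha hx
  have hc : Tendsto (wallCoord a) (𝓝[halfPlane] x) (𝓝 (wallCoord a x)) :=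
    (hasDerivAt_wallCoord ha (ofReal_mem_slitPlane hx)).continuousAt.tendsto.mono_left
      nhdsWithin_le_nhds
  rcases hxa.lt_or_gt with h | h
  · rw [if_pos h]
    have hneg : (x - a) / (1 - a * x + Real.sqrt (1 - a ^ 2) * Real.sqrt (1 - x ^ 2)) < 0 :=
      div_neg_of_neg_of_pos (sub_neg.2 h) hD
    have h1 : ContinuousWithinAt Complex.arg {z | 0 ≤ z.im} (wallCoord a x) := by
      rw [wallCoord_ofReal hx]
      exact Complex.continuousWithinAt_arg_of_re_neg_of_im_zero (by rwa [Complex.ofReal_re])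
        (Complex.ofReal_im _)
    have h2 : (wallCoord a x).arg = Real.pi := by
      rw [wallCoord_ofReal hx, Complex.arg_ofReal_of_neg hneg]
    rw [← h2]
    refine h1.tendsto.comp (tendsto_nhdsWithin_iff.2 ⟨hc, ?_⟩)
    filter_upwards [self_mem_nhdsWithin] with z hz
    exact (wallCoord_mem ha hz).2.le
  · rw [if_neg h.le.not_gt]
    have hpos : 0 < (x - a) / (1 - a * x + Real.sqrt (1 - a ^ 2) * Real.sqrt (1 - x ^ 2)) :=
      div_pos (sub_pos.2 h) hD
    have h2 : (wallCoord a x).arg = 0 := by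
      rw [wallCoord_ofReal hx, Complex.arg_ofReal_of_nonneg hpos.le]
    rw [← h2]
    refine (Complex.continuousAt_arg ?_).tendsto.comp hc
    rw [wallCoord_ofReal hx]
    exact Complex.ofReal_mem_slitPlane.2 hpos

lemma tendsto_potential {N : ℕ} {a : Fin N → ℝ} (γ : Fin N → ℝ)
    (ha : ∀ n, a n ∈ Set.Ioo (-1 : ℝ) 1) {n : Fin (N + 1)} {x : ℝ} (hx : x ∈ piece a n) :
    Tendsto (fun t : ℝ => potential a γ ⟨x, t⟩) (𝓝[>] 0) (𝓝 (boundaryValue γ n)) := by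
  obtain ⟨hx1, hx2, hx3⟩ := hx
  have hne : ∀ k, x ≠ a k := fun k => by
    rcases lt_or_ge k.val n.val with h | h
    · exact (hx2 k h).ne'
    · exact (hx3 k h).ne
  have h := tendsto_finsetSum Finset.univ fun k _ =>
    (((tendsto_arg_wallCoord (ha k) hx1 (hne k)).comp (tendsto_vertical x)).sub_const
      (Real.pi / 2)).const_mul (γ k)
  refine h.trans_eq ?_
  congr 1
  rw [boundaryValue, ← Finset.sum_filter_add_sum_filter_not Finset.univ
    (fun k : Fin N => n.val ≤ k.val), mul_sub, Finset.mul_sum, Finset.mul_sum, sub_eq_add_neg,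
    ← Finset.sum_neg_distrib]
  simp only [not_le]
  congr 1
  · refine Finset.sum_congr rfl fun k hk => ?_
    rw [if_pos (hx3 k (Finset.mem_filter.1 hk).2)]
    ring
  · refine Finset.sum_congr rfl fun k hk => ?_
    rw [if_neg (hx2 k (Finset.mem_filter.1 hk).2).le.not_gt]
    ring

/-! ### Continuation across the outer rays and the Neumann condition -/

/-- The branch of `√(1 - z²)` that is cut along `[-1, 1]` and equals `sqrtOneSubSq` above. -/
noncomputable def outerSqrt (z : ℂ) : ℂ := -Complex.I * z * (1 - z⁻¹ ^ 2) ^ (1 / 2 : ℂ)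

/-- The segment from `-1` to `1`. -/
def segmentIcc : Set ℂ := {z : ℂ | z.im = 0 ∧ z.re ∈ Set.Icc (-1 : ℝ) 1}

lemma isClosed_segmentIcc : IsClosed segmentIcc :=
  (isClosed_eq Complex.continuous_im continuous_const).inter
    (isClosed_Icc.preimage Complex.continuous_re)

lemma halfPlane_subset_compl_segmentIcc : halfPlane ⊆ segmentIccᶜ := fun z hz h => by
  have h1 : 0 < z.im := hz
  exact h1.ne' h.1

lemma zero_mem_segmentIcc : (0 : ℂ) ∈ segmentIcc := ⟨rfl, by simp⟩

lemma inv_mem_slitPlane_of_notMem {z : ℂ} (hz : z ∉ segmentIcc) :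
    1 - z⁻¹ ^ 2 ∈ Complex.slitPlane := by
  have hz0 : z ≠ 0 := fun h => hz (h ▸ zero_mem_segmentIcc)
  rw [one_sub_sq_mem_slitPlane_iff]
  by_cases h : z.im = 0
  · right
    have e : z = (z.re : ℂ) := by apply Complex.ext <;> simp [h]
    have h1 : ¬ (z.re ∈ Set.Icc (-1 : ℝ) 1) := fun h1 => hz ⟨h, h1⟩
    rw [e, ← Complex.ofReal_inv, Complex.ofReal_re]
    rw [Set.mem_Icc, ← abs_le, not_le] at h1
    rw [Set.mem_Ioo, ← abs_lt, abs_inv]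
    exact inv_lt_one_of_one_lt₀ h1
  · left
    rw [Complex.inv_im]
    exact div_ne_zero (neg_ne_zero.2 h) (Complex.normSq_pos.2 hz0).ne'

lemma outerSqrt_sq {z : ℂ} (hz : z ≠ 0) : outerSqrt z ^ 2 = 1 - z ^ 2 := by
  rw [outerSqrt, mul_pow, mul_pow, neg_sq, Complex.I_sq, ← Complex.cpow_nat_mul]
  norm_num
  field_simp
  ring

lemma outerSqrt_ne_zero {z : ℂ} (hz : z ∉ segmentIcc) : outerSqrt z ≠ 0 := by
  have hz0 : z ≠ 0 := fun h => hz (h ▸ zero_mem_segmentIcc)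
  have h := Complex.slitPlane_ne_zero (inv_mem_slitPlane_of_notMem hz)
  intro h0
  have h1 := outerSqrt_sq hz0
  rw [h0, zero_pow two_ne_zero] at h1
  apply h
  field_simp
  linear_combination h1

lemma differentiableAt_outerSqrt {z : ℂ} (hz : z ∉ segmentIcc) :
    DifferentiableAt ℂ outerSqrt z := by
  have hz0 : z ≠ 0 := fun h => hz (h ▸ zero_mem_segmentIcc)
  have h := inv_mem_slitPlane_of_notMem hz
  have h1 : DifferentiableAt ℂ (fun z : ℂ => 1 - z⁻¹ ^ 2) z :=
    (differentiableAt_const _).sub ((differentiableAt_inv hz0).pow 2)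
  have h2 : DifferentiableAt ℂ (fun z : ℂ => (1 - z⁻¹ ^ 2) ^ (1 / 2 : ℂ)) z :=
    (h1.hasDerivAt.cpow_const h).differentiableAt
  exact (differentiableAt_id.const_mul (-Complex.I)).mul h2

/-- Two continuous square roots of the same non-vanishing function on a connected set that agree at
the point i. -/
lemma outerSqrt_eq {z : ℂ} (hz : z ∈ halfPlane) : outerSqrt z = sqrtOneSubSq z := by
  have h1 : ContinuousOn outerSqrt halfPlane := fun z hz =>
    (differentiableAt_outerSqrt (halfPlane_subset_compl_segmentIcc hz)).continuousAt.continuousWithinAt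
  have h2 : ContinuousOn sqrtOneSubSq halfPlane := fun z hz =>
    (hasDerivAt_sqrtOneSubSq (mem_slitPlane_of_mem_halfPlane hz)).continuousAt.continuousWithinAt
  have hI : Complex.I ∈ halfPlane := by simp [halfPlane]
  refine isPreconnected_halfPlane.eq_of_sq_eq h1 h2 (fun z hz => ?_) (fun hz => ?_) hI ?_ hz
  · have hz0 : z ≠ 0 := fun h => by
      have h1 : 0 < z.im := hz
      simp [h] at h1
    simp only [Pi.pow_apply]
    rw [outerSqrt_sq hz0, sqrtOneSubSq_sq]
  · exact sqrtOneSubSq_ne_zero (mem_slitPlane_of_mem_halfPlane hz)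
  · rw [outerSqrt, sqrtOneSubSq, neg_mul, Complex.I_mul_I, neg_neg, one_mul, Complex.inv_I, neg_sq]

/-- The continuation of the total field across the rays outside `[-1, 1]`. -/
noncomputable def outerField {N : ℕ} (a γ : Fin N → ℝ) (z : ℂ) : ℂ :=
  ∑ n, γ n • (-Complex.I * (Real.sqrt (1 - a n ^ 2) : ℝ) / ((z - a n) * outerSqrt z))

lemma outerField_eq {N : ℕ} (a γ : Fin N → ℝ) {z : ℂ} (hz : z ∈ halfPlane) :
    outerField a γ z = totalField a γ z := by
  simp only [outerField, totalField, wallField, outerSqrt_eq hz]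

lemma continuousOn_outerField {N : ℕ} {a : Fin N → ℝ} (γ : Fin N → ℝ)
    (ha : ∀ n, a n ∈ Set.Ioo (-1 : ℝ) 1) : ContinuousOn (outerField a γ) segmentIccᶜ := by
  unfold outerField
  refine continuousOn_finsetSum _ fun n _ => ContinuousOn.fun_const_smul (ContinuousOn.div
    continuousOn_const ((by fun_prop : ContinuousOn (fun z : ℂ => z - a n) _).fun_mul fun z hz =>
      (differentiableAt_outerSqrt hz).continuousAt.continuousWithinAt) fun z hz => ?_) _
  refine mul_ne_zero (fun h => hz ?_) (outerSqrt_ne_zero hz)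
  rw [sub_eq_zero.1 h]
  exact ⟨by simp, by simpa using Set.Ioo_subset_Icc_self (ha n)⟩

lemma outerSqrt_ofReal {x : ℝ} (hx : (x : ℂ) ∉ segmentIcc) :
    outerSqrt x = -Complex.I * ((x * (1 - x⁻¹ ^ 2) ^ (1 / 2 : ℝ) : ℝ) : ℂ) := by
  have h := inv_mem_slitPlane_of_notMem hx
  have h1 : 0 ≤ 1 - x⁻¹ ^ 2 := by
    have : (1 - (x : ℂ)⁻¹ ^ 2) = ((1 - x⁻¹ ^ 2 : ℝ) : ℂ) := by push_cast; rfl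
    rw [this] at h
    exact (Complex.ofReal_mem_slitPlane.1 h).le
  rw [outerSqrt, mul_assoc]
  congr 1
  rw [Complex.ofReal_mul, Complex.ofReal_cpow h1]
  push_cast
  rfl

/-- On the outer rays the root is purely imaginary, which makes the field real. Its imaginary part
is -∂₂ of the potential, so this is the Neumann condition in classical form. -/
lemma outerField_ofReal_im {N : ℕ} (a γ : Fin N → ℝ) {x : ℝ} (hx : (x : ℂ) ∉ segmentIcc) :
    (outerField a γ x).im = 0 := by
  rw [outerField, Complex.im_sum]
  refine Finset.sum_eq_zero fun n _ => ?_
  have : (-Complex.I * (Real.sqrt (1 - a n ^ 2) : ℝ) / ((x - a n) * outerSqrt x) : ℂ)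
      = ((Real.sqrt (1 - a n ^ 2) / ((x - a n) * (x * (1 - x⁻¹ ^ 2) ^ (1 / 2 : ℝ))) : ℝ) : ℂ) := by
    rw [outerSqrt_ofReal hx, mul_left_comm, mul_div_mul_left _ _ (neg_ne_zero.2 Complex.I_ne_zero)]
    push_cast
    rfl
  rw [this, Complex.smul_im, Complex.ofReal_im, smul_zero]

lemma continuous_of_continuousOn_of_tsupport {X E : Type*} [TopologicalSpace X]
    [TopologicalSpace E] [Zero E] {f : X → E} {U : Set X} (hU : IsOpen U) (hf : ContinuousOn f U)
    (hs : tsupport f ⊆ U) : Continuous f := by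
  rw [continuous_iff_continuousAt]
  intro x
  by_cases hx : x ∈ tsupport f
  · exact hf.continuousAt (hU.mem_nhds (hs hx))
  · exact (continuousAt_const (y := (0 : E))).congr
      (notMem_tsupport_iff_eventuallyEq.1 hx).symm

/-- Green's formula expresses the integral as a limit of line integrals. The support of ζ avoids the
segment, so `outerField` continues the integrand continuously to the real line, where it vanishes.
-/
lemma neumann_potential {N : ℕ} {a : Fin N → ℝ} (γ : Fin N → ℝ)
    (ha : ∀ n, a n ∈ Set.Ioo (-1 : ℝ) 1) {ζ : ℂ → ℝ} (hζ : ContDiff ℝ ∞ ζ)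
    (hc : HasCompactSupport ζ) (hd : Disjoint (tsupport ζ) segmentIcc) :
    ∫ z in halfPlane, inner ℝ (gradient (potential a γ) z) (gradient ζ z) = 0 := by
  have hsub : tsupport ζ ⊆ segmentIccᶜ := hd.subset_compl_right
  have hcont := continuousOn_outerField γ ha
  have hg := continuous_complexGrad hζ
  have hU : IsOpen segmentIccᶜ := isClosed_segmentIcc.isOpen_compl
  have hΨ : Continuous fun z => ζ z * (outerField a γ z).im := by
    refine continuous_of_continuousOn_of_tsupport hU ?_
      ((tsupport_mul_subset_left (f := ζ)).trans hsub)
    exact hζ.continuous.continuousOn.mul (Complex.continuous_im.comp_continuousOn hcont)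
  have hΨc : HasCompactSupport fun z => ζ z * (outerField a γ z).im := hc.mul_right
  have hgs : tsupport (complexGrad ζ) ⊆ tsupport ζ :=
    closure_minimal (fun z hz => by
      by_contra h
      exact hz (complexGrad_eq_zero h)) (isClosed_tsupport ζ)
  have hgc : HasCompactSupport (complexGrad ζ) :=
    hc.isCompact.of_isClosed_subset (isClosed_tsupport _) hgs
  have hint : IntegrableOn (fun z => totalField a γ z * complexGrad ζ z) halfPlane := by
    have h1 : Continuous fun z => outerField a γ z * complexGrad ζ z := by
      refine continuous_of_continuousOn_of_tsupport hU (hcont.mul hg.continuousOn)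
        ((tsupport_mul_subset_right (g := complexGrad ζ)).trans (hgs.trans hsub))
    have h2 : HasCompactSupport fun z => outerField a γ z * complexGrad ζ z := hgc.mul_left
    refine (h1.integrable_of_hasCompactSupport h2).integrableOn.congr_fun (fun z hz => ?_)
      measurableSet_halfPlane
    simp only
    rw [outerField_eq a γ hz]
  have key := tendsto_integral_line (differentiableOn_totalField γ ha) hζ hc hint
  have hlim : Tendsto (fun t : ℝ => ∫ x : ℝ, ζ (x + t * Complex.I) *
      (totalField a γ (x + t * Complex.I)).im) (𝓝[>] 0) (𝓝 0) := by
    obtain ⟨R, hR⟩ := hc.isCompact.isBounded.subset_closedBall 0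
    obtain ⟨M, hM⟩ := hΨ.bounded_above_of_compact_support hΨc
    have hz0 : ∫ x : ℝ, ζ (x + (0 : ℝ) * Complex.I) *
        (outerField a γ (x + (0 : ℝ) * Complex.I)).im = 0 := by
      refine integral_eq_zero_of_ae (ae_of_all _ fun x => ?_)
      simp only [Complex.ofReal_zero, zero_mul, add_zero, Pi.zero_apply]
      by_cases hx : (x : ℂ) ∈ tsupport ζ
      · rw [outerField_ofReal_im a γ (hsub hx), mul_zero]
      · rw [image_eq_zero_of_notMem_tsupport hx, zero_mul]
    have h0 : Tendsto (fun t : ℝ => ∫ x : ℝ, ζ (x + t * Complex.I) *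
        (outerField a γ (x + t * Complex.I)).im) (𝓝[>] 0) (𝓝 0) := by
      refine LE.le.trans_eq ?_ (congrArg 𝓝 hz0)
      refine tendsto_integral_filter_of_dominated_convergence
        ((Set.Icc (-R) R).indicator fun _ => M) ?_ ?_ ?_ ?_
      · exact Eventually.of_forall fun t =>
          (hΨ.comp (by fun_prop : Continuous fun x : ℝ =>
            (x + t * Complex.I : ℂ))).aestronglyMeasurable
      · refine Eventually.of_forall fun t => ae_of_all _ fun x => ?_
        by_cases hx : x ∈ Set.Icc (-R) R
        · rw [Set.indicator_of_mem hx]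
          exact hM _
        · rw [Set.indicator_of_notMem hx]
          have : (x + t * Complex.I : ℂ) ∉ tsupport ζ := fun h => hx (by
            have h1 := mem_closedBall_zero_iff.1 (hR h)
            have h2 := (Complex.abs_re_le_norm (x + t * Complex.I)).trans h1
            simpa [abs_le] using h2)
          rw [image_eq_zero_of_notMem_tsupport this, zero_mul, norm_zero]
      · rw [integrable_indicator_iff measurableSet_Icc]
        exact integrableOn_const (by simp)
      · refine ae_of_all _ fun x => ?_
        have h1 : Continuous fun t : ℝ => ζ (x + t * Complex.I) *
            (outerField a γ (x + t * Complex.I)).im :=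
          hΨ.comp (by fun_prop : Continuous fun t : ℝ => (x + t * Complex.I : ℂ))
        have h2 := (h1.tendsto 0).mono_left (nhdsWithin_le_nhds (s := Set.Ioi 0))
        exact h2
    refine h0.congr' ?_
    filter_upwards [self_mem_nhdsWithin] with t ht
    have ht' : 0 < t := ht
    refine integral_congr_ae (ae_of_all _ fun x => ?_)
    simp only
    rw [outerField_eq]
    simpa [halfPlane] using ht'
  rw [← tendsto_nhds_unique key hlim]
  refine setIntegral_congr_fun measurableSet_halfPlane fun z hz => ?_
  rw [(hasGradientAt_potential γ ha hz).gradient, inner_gradient_eq]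
  rfl

theorem isLimitPotential_potential {N : ℕ} {a : Fin N → ℝ} (γ : Fin N → ℝ)
    (ha : ∀ n, a n ∈ Set.Ioo (-1 : ℝ) 1) : IsLimitPotential a γ (potential a γ) where
  harmonic := harmonicOnNhd_potential γ ha
  energy_growth := by
    obtain ⟨C, -, hC⟩ := lintegral_totalField_le (γ := γ) ha
    refine ⟨C, fun r hr => (le_of_eq ?_).trans (hC r hr)⟩
    refine setLIntegral_congr_fun (measurableSet_perforated a r) fun z hz => ?_
    rw [(hasGradientAt_potential γ ha hz.1).gradient, RCLike.enorm_conj]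
  trace_eq n := by
    have hm : MeasurableSet (piece a n) := by
      refine measurableSet_Ioo.inter (MeasurableSet.inter ?_ ?_)
      · have : {x : ℝ | ∀ k : Fin N, k.val < n.val → a k < x}
            = ⋂ k : Fin N, ⋂ _ : k.val < n.val, Set.Ioi (a k) := by ext; simp
        refine (congrArg MeasurableSet this).mpr ?_
        exact MeasurableSet.iInter fun k => MeasurableSet.iInter fun _ => measurableSet_Ioi
      · have : {x : ℝ | ∀ k : Fin N, n.val ≤ k.val → x < a k}
            = ⋂ k : Fin N, ⋂ _ : n.val ≤ k.val, Set.Iio (a k) := by ext; simp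
        refine (congrArg MeasurableSet this).mpr ?_
        exact MeasurableSet.iInter fun k => MeasurableSet.iInter fun _ => measurableSet_Iio
    exact (ae_restrict_iff' hm).2 (ae_of_all _ fun x hx => tendsto_potential γ ha hx)
  neumann ζ hζ hc hd := neumann_potential γ ha hζ hc hd

/-! ### The mean value property on discs -/

lemma setIntegral_ball_eq_polar (F : ℂ → ℂ) (r : ℝ) :
    ∫ w in Metric.ball 0 r, F w = ∫ p in Set.Ioo (0 : ℝ) r ×ˢ Set.Ioo (-Real.pi) Real.pi,
      p.1 • F (polarPoint p) := by
  rw [← integral_indicator Metric.isOpen_ball.measurableSet, ← Complex.integral_comp_polarCoord_symm,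
    ← integral_indicator polarCoord.open_target.measurableSet,
    ← integral_indicator (measurableSet_Ioo.prod measurableSet_Ioo)]
  congr 1 with p
  by_cases hp : p ∈ polarCoord.target
  · rw [Set.indicator_of_mem hp, Complex.polarCoord_symm_apply]
    change _ • (Metric.ball 0 r).indicator F (polarPoint p) = _
    have hp' := hp
    rw [polarCoord_target, Set.mem_prod, Set.mem_Ioi] at hp'
    have h : polarPoint p ∈ Metric.ball 0 r ↔
        p ∈ Set.Ioo (0 : ℝ) r ×ˢ Set.Ioo (-Real.pi) Real.pi := by
      rw [mem_ball_zero_iff, norm_polarPoint, abs_of_pos hp'.1, Set.mem_prod, Set.mem_Ioo]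
      tauto
    by_cases h1 : polarPoint p ∈ Metric.ball 0 r
    · rw [Set.indicator_of_mem h1, Set.indicator_of_mem (h.1 h1)]
    · rw [Set.indicator_of_notMem h1, Set.indicator_of_notMem (fun h' => h1 (h.2 h')), smul_zero]
  · rw [Set.indicator_of_notMem hp, Set.indicator_of_notMem fun h => hp ?_]
    rw [polarCoord_target]
    exact ⟨h.1.1, h.2⟩

lemma integral_circle_eq {f : ℂ → ℂ} {z : ℂ} {ρ : ℝ} (hρ : 0 ≤ ρ)
    (hf : DiffContOnCl ℂ f (Metric.ball z ρ)) :
    ∫ θ in Set.Ioo (-Real.pi) Real.pi, f (z + polarPoint (ρ, θ)) = (2 * Real.pi) • f z := by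
  have h := DiffContOnCl.circleAverage (f := f) (c := z) (R := ρ) (by rwa [abs_of_nonneg hρ])
  rw [Real.circleAverage_eq_integral_add (-Real.pi)] at h
  have e : ∀ θ, circleMap z ρ (θ + -Real.pi) = z + polarPoint (ρ, θ + -Real.pi) := fun θ => by
    rw [circleMap, polarPoint]
    simp [Complex.exp_mul_I]
  simp only [e] at h
  rw [intervalIntegral.integral_comp_add_right (fun θ => f (z + polarPoint (ρ, θ)))] at h
  rw [← h, smul_inv_smul₀ (by positivity), ← integral_Ioc_eq_integral_Ioo,
    ← intervalIntegral.integral_of_le (by linarith [Real.pi_pos])]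
  congr 1 <;> ring

lemma setIntegral_radial_aux {f : ℂ → ℂ} {z : ℂ} {r : ℝ}
    (hd : DifferentiableOn ℂ f (Metric.ball z r)) (hc : ContinuousOn f (Metric.closedBall z r))
    {ψ : ℝ → ℝ} (hψ : Continuous ψ) :
    ∫ w in Metric.ball 0 r, ψ ‖w‖ • f (z + w)
      = (∫ ρ in Set.Ioo 0 r, ρ * ψ ρ * (2 * Real.pi)) • f z := by
  rw [setIntegral_ball_eq_polar _ r, Measure.volume_eq_prod, setIntegral_prod, ← integral_smul_const]
  · refine setIntegral_congr_fun measurableSet_Ioo fun ρ hρ => ?_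
    have h2 : Metric.ball z ρ ⊆ Metric.ball z r := Metric.ball_subset_ball hρ.2.le
    have := integral_circle_eq (f := f) (z := z) hρ.1.le ⟨hd.mono h2, hc.mono
      (Metric.closure_ball_subset_closedBall.trans (Metric.closedBall_subset_closedBall hρ.2.le))⟩
    simp only [norm_polarPoint, abs_of_pos hρ.1, smul_smul]
    rw [integral_smul, this, smul_smul]
  · have hK : IsCompact (Set.Icc 0 r ×ˢ Set.Icc (-Real.pi) Real.pi) := isCompact_Icc.prod isCompact_Icc
    refine IntegrableOn.mono_set (t := Set.Icc 0 r ×ˢ Set.Icc (-Real.pi) Real.pi) ?_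
      (Set.prod_mono Set.Ioo_subset_Icc_self Set.Ioo_subset_Icc_self)
    rw [← Measure.volume_eq_prod]
    refine ContinuousOn.integrableOn_compact hK ?_
    refine continuous_fst.continuousOn.fun_smul (ContinuousOn.fun_smul ?_ ?_)
    · exact (hψ.comp (continuous_norm.comp continuous_polarPoint)).continuousOn
    · refine hc.comp (continuous_const.add continuous_polarPoint).continuousOn fun p hp => ?_
      rw [mem_closedBall_iff_norm, add_sub_cancel_left, norm_polarPoint, abs_of_nonneg hp.1.1]
      exact hp.1.2

/-- The mean value property with a radial weight. -/
lemma setIntegral_radial {f : ℂ → ℂ} {z : ℂ} {r : ℝ}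
    (hd : DifferentiableOn ℂ f (Metric.ball z r)) (hc : ContinuousOn f (Metric.closedBall z r))
    {ψ : ℝ → ℝ} (hψ : Continuous ψ) :
    ∫ w in Metric.ball 0 r, ψ ‖w‖ • f (z + w) = (∫ w in Metric.ball (0 : ℂ) r, ψ ‖w‖) • f z := by
  rw [setIntegral_radial_aux hd hc hψ]
  -- The constant function 1 identifies the scalar factor as the total mass of the weight.
  have h1 := setIntegral_radial_aux (f := fun _ => 1) (z := 0) (r := r) (differentiableOn_const _)
    continuousOn_const hψ
  rw [integral_smul_const, Complex.real_smul, Complex.real_smul, mul_one, mul_one] at h1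
  rw [← Complex.ofReal_injective h1]

/-- The square of a holomorphic function at the centre of a disc is at most its mean. -/
lemma enorm_sq_le_lintegral_ball {f : ℂ → ℂ} {z : ℂ} {r : ℝ} (hr : 0 < r)
    (hd : DifferentiableOn ℂ f (Metric.ball z r)) (hc : ContinuousOn f (Metric.closedBall z r)) :
    ENNReal.ofReal (Real.pi * r ^ 2) * ‖f z‖ₑ ^ 2 ≤ ∫⁻ w in Metric.ball z r, ‖f w‖ₑ ^ 2 := by
  -- The mean value property is applied to the holomorphic function f², which makes subharmonicity
  -- of |f|² unnecessary.
  have h := setIntegral_radial (f := fun w => f w ^ 2) (hd.pow 2) (hc.pow 2)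
    (continuous_const (y := (1 : ℝ)))
  simp only [one_smul, integral_const, smul_eq_mul, mul_one, MeasurableSet.univ,
    measureReal_restrict_apply, Set.univ_inter] at h
  have hv : volume.real (Metric.ball (0 : ℂ) r) = Real.pi * r ^ 2 := by
    rw [Measure.real, Complex.volume_ball, ENNReal.toReal_mul, ENNReal.toReal_pow,
      ENNReal.toReal_ofReal hr.le]
    simp [mul_comm]
  have e : ∫⁻ w in Metric.ball z r, ‖f w‖ₑ ^ 2 = ∫⁻ w in Metric.ball 0 r, ‖f (z + w)‖ₑ ^ 2 := by
    rw [← lintegral_indicator Metric.isOpen_ball.measurableSet,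
      ← lintegral_indicator Metric.isOpen_ball.measurableSet,
      ← lintegral_add_left_eq_self _ z]
    congr 1 with w
    by_cases hw : w ∈ Metric.ball 0 r
    · rw [Set.indicator_of_mem hw, Set.indicator_of_mem]
      simpa using hw
    · rw [Set.indicator_of_notMem hw, Set.indicator_of_notMem]
      simpa using hw
  rw [e]
  calc _ = ‖(Real.pi * r ^ 2) • f z ^ 2‖ₑ := by
        rw [enorm_smul, enorm_pow, Real.enorm_of_nonneg (by positivity)]
    _ ≤ ∫⁻ w in Metric.ball 0 r, ‖f (z + w) ^ 2‖ₑ := by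
        rw [← hv, ← h]
        exact enorm_integral_le_lintegral_enorm _
    _ = _ := by simp only [enorm_pow]

/-! ### Weak solutions of the Cauchy–Riemann equations across the real line -/

/-- Derivatives of the convolution fall on φ, so `hw` is the Cauchy–Riemann equation for the
mollified function at z. -/
lemma differentiableAt_mollify {K : ℂ → ℂ} (hK : Integrable K) {φ : ℂ → ℝ} (hφ : ContDiff ℝ ∞ φ)
    (hc : HasCompactSupport φ) {z : ℂ} (hw : ∫ t, complexGrad φ (z - t) * K t = 0) :
    DifferentiableAt ℂ (fun z => ∫ t, φ (z - t) • K t) z := by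
  set L : ℂ →L[ℝ] ℝ →L[ℝ] ℂ := (ContinuousLinearMap.lsmul ℝ ℝ).flip
  have h1 := hc.hasFDerivAt_convolution_right L hK.locallyIntegrable
    (hφ.of_le (by exact_mod_cast le_top)) z
  have happ : ∀ v : ℂ, (convolution K (fderiv ℝ φ) (L.precompR ℂ) volume z) v
      = ∫ t, fderiv ℝ φ (z - t) v • K t := fun v =>
    convolution_precompR_apply L hK.locallyIntegrable (hc.fderiv ℝ)
      (hφ.continuous_fderiv (by simp)) z v
  have hint : ∀ v : ℂ, Integrable fun t => fderiv ℝ φ (z - t) v • K t := fun v =>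
    HasCompactSupport.convolutionExists_right L (g := fun t => fderiv ℝ φ t v)
      ((hc.fderiv ℝ).comp_left (g := fun l : ℂ →L[ℝ] ℝ => l v) rfl) hK.locallyIntegrable
      ((hφ.continuous_fderiv (by simp)).clm_apply continuous_const) z
  refine differentiableAt_complex_iff_differentiableAt_real.2 ⟨h1.differentiableAt, ?_⟩
  change fderiv ℝ (convolution K φ L volume) z Complex.I
    = Complex.I • fderiv ℝ (convolution K φ L volume) z 1
  rw [h1.fderiv, happ, happ]
  have e : ∫ t, complexGrad φ (z - t) * K t
      = (∫ t, fderiv ℝ φ (z - t) 1 • K t)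
        + Complex.I * ∫ t, fderiv ℝ φ (z - t) Complex.I • K t := by
    rw [← integral_const_mul, ← integral_add (hint 1) ((hint Complex.I).const_mul _)]
    refine integral_congr_ae (ae_of_all _ fun t => ?_)
    simp only [complexGrad, Complex.real_smul]
    ring
  rw [hw] at e
  rw [smul_eq_mul]
  linear_combination Complex.I * e + (∫ t, fderiv ℝ φ (z - t) Complex.I • K t) * Complex.I_sq

/-- A radial bump function. -/
noncomputable def radialBump (ε : ℝ) (t : ℝ) : ℝ := Real.smoothTransition (1 - t ^ 2 / ε ^ 2)

/-- The profile depends on t only through t², so composing it with the norm is smooth at the origin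
too. -/
lemma contDiff_radialBump_norm (ε : ℝ) : ContDiff ℝ ∞ fun w : ℂ => radialBump ε ‖w‖ := by
  have : ContDiff ℝ ∞ fun w : ℂ => 1 - ‖w‖ ^ 2 / ε ^ 2 :=
    contDiff_const.sub ((contDiff_norm_sq ℝ).div_const _)
  exact Real.smoothTransition.contDiff.comp this

lemma continuous_radialBump (ε : ℝ) : Continuous (radialBump ε) :=
  Real.smoothTransition.continuous.comp (by fun_prop)

lemma radialBump_eq_zero {ε t : ℝ} (hε : 0 < ε) (ht : ε ≤ t) : radialBump ε t = 0 := by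
  refine Real.smoothTransition.zero_of_nonpos ?_
  rw [sub_nonpos, one_le_div (by positivity)]
  gcongr

lemma radialBump_pos {ε t : ℝ} (hε : 0 < ε) (h0 : 0 ≤ t) (ht : t < ε) : 0 < radialBump ε t := by
  refine Real.smoothTransition.pos_of_pos ?_
  rw [sub_pos, div_lt_one (by positivity)]
  gcongr

lemma radialBump_nonneg (ε t : ℝ) : 0 ≤ radialBump ε t := Real.smoothTransition.nonneg _

lemma support_radialBump_sub {ε : ℝ} (hε : 0 < ε) (z : ℂ) :
    tsupport (fun w : ℂ => radialBump ε ‖z - w‖) ⊆ Metric.closedBall z ε := by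
  refine closure_minimal (fun w hw => ?_) Metric.isClosed_closedBall
  rw [Metric.mem_closedBall', dist_eq_norm]
  by_contra h
  exact hw (radialBump_eq_zero hε (not_le.1 h).le)

lemma integral_radialBump_pos {ε : ℝ} (hε : 0 < ε) :
    0 < ∫ w in Metric.ball (0 : ℂ) ε, radialBump ε ‖w‖ := by
  rw [setIntegral_pos_iff_support_of_nonneg_ae (ae_of_all _ fun w => radialBump_nonneg _ _)]
  · refine (Metric.measure_ball_pos volume (0 : ℂ) hε).trans_le (measure_mono fun w hw => ⟨?_, hw⟩)
    exact (radialBump_pos hε (norm_nonneg _) (mem_ball_zero_iff.1 hw)).ne'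
  · exact ((contDiff_radialBump_norm ε).continuous.continuousOn.integrableOn_compact
      (isCompact_closedBall (0 : ℂ) ε)).mono_set Metric.ball_subset_closedBall

/-- A radial kernel reproduces holomorphic functions up to its mass, by the mean value property on
circles. -/
lemma mollify_eq {K : ℂ → ℂ} {z : ℂ} {ε : ℝ} (hε : 0 < ε)
    (hd : DifferentiableOn ℂ K (Metric.closedBall z ε)) :
    ∫ t, radialBump ε ‖z - t‖ • K t
      = (∫ w in Metric.ball (0 : ℂ) ε, radialBump ε ‖w‖) • K z := by
  rw [← setIntegral_radial (hd.mono Metric.ball_subset_closedBall) hd.continuousOn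
    (continuous_radialBump ε), ← integral_add_left_eq_self _ z]
  rw [setIntegral_eq_integral_of_forall_compl_eq_zero fun w hw => ?_]
  · simp
  · rw [mem_ball_zero_iff, not_lt] at hw
    rw [radialBump_eq_zero hε hw, zero_smul]

lemma convex_ball_inter_im (x₀ : ℂ) (ρ σ : ℝ) :
    Convex ℝ (Metric.ball x₀ ρ ∩ {z : ℂ | 0 < σ * z.im}) := by
  refine (convex_ball _ _).inter ?_
  have : IsLinearMap ℝ fun z : ℂ => σ * z.im :=
    ⟨fun x y => by simp [mul_add], fun c x => by simp; ring⟩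
  exact convex_halfSpace_gt this 0

/-- A locally integrable function that is holomorphic off the real line and satisfies the
Cauchy–Riemann equations weakly extends holomorphically across the line. -/
lemma exists_extension_of_weak {K : ℂ → ℂ} {x₀ ρ : ℝ} (hρ : 0 < ρ)
    (hK : IntegrableOn K (Metric.ball (x₀ : ℂ) ρ))
    (hd : DifferentiableOn ℂ K (Metric.ball (x₀ : ℂ) ρ ∩ {z | z.im ≠ 0}))
    (hw : ∀ φ : ℂ → ℝ, ContDiff ℝ ∞ φ → HasCompactSupport φ →
      tsupport φ ⊆ Metric.ball (x₀ : ℂ) ρ →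
      ∫ z in Metric.ball (x₀ : ℂ) ρ, K z * complexGrad φ z = 0) :
    ∃ G : ℂ → ℂ, DifferentiableOn ℂ G (Metric.ball (x₀ : ℂ) (ρ / 2)) ∧
      Set.EqOn G K (Metric.ball (x₀ : ℂ) (ρ / 2) ∩ {z | z.im ≠ 0}) := by
  -- Small enough that discs of radius ε about points of the half-size ball stay in the ball, and
  -- that the points at height ±ρ/4 are farther than ε from the real line.
  set ε := ρ / 8 with hε
  have hε0 : 0 < ε := by positivity
  set c := ∫ w in Metric.ball (0 : ℂ) ε, radialBump ε ‖w‖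
  have hc : 0 < c := integral_radialBump_pos hε0
  set K₀ := (Metric.ball (x₀ : ℂ) ρ).indicator K
  have hK₀ : Integrable K₀ := (integrable_indicator_iff Metric.isOpen_ball.measurableSet).2 hK
  set φ : ℂ → ℝ := fun w => radialBump ε ‖w‖ with hφ
  have hφs : ContDiff ℝ ∞ φ := contDiff_radialBump_norm ε
  have hball : ∀ z ∈ Metric.ball (x₀ : ℂ) (ρ / 2), Metric.closedBall z ε ⊆ Metric.ball (x₀ : ℂ) ρ :=
    fun z hz => Metric.closedBall_subset_ball' (by
      have := Metric.mem_ball.1 hz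
      linarith)
  have hφc : ∀ z, HasCompactSupport fun w : ℂ => φ (z - w) := fun z =>
    (isCompact_closedBall z ε).of_isClosed_subset (isClosed_tsupport _) (support_radialBump_sub hε0 z)
  have hφc0 : HasCompactSupport φ := by
    have := hφc 0
    simpa only [zero_sub, hφ, norm_neg] using this
  have hgrad : ∀ z t, complexGrad (fun w => φ (z - w)) t = - complexGrad φ (z - t) := by
    intro z t
    have : fderiv ℝ (fun w => φ (z - w)) t = - fderiv ℝ φ (z - t) := by
      have := ((hφs.differentiable (by simp) (z - t)).hasFDerivAt.comp t
        ((hasFDerivAt_id t).const_sub z)).fderiv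
      rw [Function.comp_def] at this
      rw [this]
      ext v
      all_goals simp
    simp [complexGrad, this]
    ring
  set G : ℂ → ℂ := fun z => c⁻¹ • ∫ t, φ (z - t) • K₀ t with hG
  have hGd : DifferentiableOn ℂ G (Metric.ball (x₀ : ℂ) (ρ / 2)) := fun z hz => by
    refine ((differentiableAt_mollify hK₀ hφs hφc0 ?_).const_smul c⁻¹).differentiableWithinAt
    have h1 := hw (fun w => φ (z - w)) (hφs.comp (contDiff_const.sub contDiff_id)) (hφc z)
      ((support_radialBump_sub hε0 z).trans (hball z hz))
    rw [← integral_indicator Metric.isOpen_ball.measurableSet] at h1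
    rw [← neg_eq_zero, ← integral_neg, ← h1]
    refine integral_congr_ae (ae_of_all _ fun t => ?_)
    by_cases ht : t ∈ Metric.ball (x₀ : ℂ) ρ
    · simp only [K₀, Set.indicator_of_mem ht, hgrad]
      ring
    · simp only [K₀, Set.indicator_of_notMem ht, mul_zero, neg_zero]
  refine ⟨G, hGd, ?_⟩
  have hfar : ∀ z ∈ Metric.ball (x₀ : ℂ) (ρ / 2), ε < |z.im| → G z = K z := by
    intro z hz him
    have hsub : Metric.closedBall z ε ⊆ Metric.ball (x₀ : ℂ) ρ ∩ {z | z.im ≠ 0} := fun w hw' => by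
      refine ⟨hball z hz hw', fun h0 => ?_⟩
      have h1 := Complex.abs_im_le_norm (z - w)
      rw [Complex.sub_im, h0, sub_zero] at h1
      have h2 := Metric.mem_closedBall'.1 hw'
      rw [dist_eq_norm] at h2
      linarith
    have hd' : DifferentiableOn ℂ K₀ (Metric.closedBall z ε) :=
      (hd.mono hsub).congr fun w hw' => Set.indicator_of_mem (hsub hw').1 K
    simp only [hG, hφ]
    rw [mollify_eq hε0 hd', inv_smul_smul₀ hc.ne']
    exact Set.indicator_of_mem (hball z hz (Metric.mem_closedBall_self hε0.le)) K
  -- The mollified function agrees with K at distance more than ε from the line. The identity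
  -- theorem on each half-ball, selected by the sign σ, carries this up to the line.
  have hside : ∀ σ : ℝ, |σ| = 1 →
      Set.EqOn G K (Metric.ball (x₀ : ℂ) (ρ / 2) ∩ {z | 0 < σ * z.im}) := by
    intro σ hσ
    have ho : IsOpen (Metric.ball (x₀ : ℂ) (ρ / 2) ∩ {z | 0 < σ * z.im}) :=
      Metric.isOpen_ball.inter (isOpen_lt continuous_const (by fun_prop))
    have h1 : AnalyticOnNhd ℂ G (Metric.ball (x₀ : ℂ) (ρ / 2) ∩ {z | 0 < σ * z.im}) :=
      (hGd.mono Set.inter_subset_left).analyticOnNhd ho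
    have h2 : AnalyticOnNhd ℂ K (Metric.ball (x₀ : ℂ) (ρ / 2) ∩ {z | 0 < σ * z.im}) :=
      (hd.mono fun z hz => ⟨Metric.ball_subset_ball (by linarith) hz.1, fun h => by
        have := hz.2
        simp [h] at this⟩).analyticOnNhd ho
    have hσ2 : σ * σ = 1 := by rw [← abs_mul_abs_self, hσ, mul_one]
    have hmem : (x₀ + (σ * (ρ / 4) : ℝ) * Complex.I : ℂ) ∈ Metric.ball (x₀ : ℂ) (ρ / 2) := by
      rw [mem_ball_iff_norm, add_sub_cancel_left, norm_mul, Complex.norm_I, Complex.norm_real,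
        Real.norm_eq_abs, abs_mul, hσ, abs_of_pos (by positivity)]
      linarith
    have him : (x₀ + (σ * (ρ / 4) : ℝ) * Complex.I : ℂ).im = σ * (ρ / 4) := by simp
    refine h1.eqOn_of_preconnected_of_eventuallyEq h2 (convex_ball_inter_im _ _ _).isPreconnected
      (z₀ := x₀ + (σ * (ρ / 4) : ℝ) * Complex.I) ⟨hmem, ?_⟩ ?_
    · rw [Set.mem_ofPred_eq, him, ← mul_assoc, hσ2]
      linarith
    · have hU : IsOpen (Metric.ball (x₀ : ℂ) (ρ / 2) ∩ {z : ℂ | ε < |z.im|}) :=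
        Metric.isOpen_ball.inter (isOpen_lt continuous_const (by fun_prop))
      filter_upwards [hU.mem_nhds ⟨hmem, by
        rw [Set.mem_ofPred_eq, him, abs_mul, hσ, abs_of_pos (by positivity)]; linarith⟩] with z hz
      exact hfar z hz.1 hz.2
  rintro z ⟨hz, h0⟩
  rcases lt_or_gt_of_ne h0 with h | h
  · exact hside (-1) (by simp) ⟨hz, by simpa using h⟩
  · exact hside 1 (by simp) ⟨hz, by simpa using h⟩

/-! ### Reflection across the real line -/

lemma integrableOn_norm_sq_of_continuousOn {f : ℂ → ℂ} {z : ℂ} {r : ℝ}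
    (hc : ContinuousOn f (Metric.closedBall z r)) :
    IntegrableOn (fun w => ‖f w‖ ^ 2) (Metric.ball z r) :=
  ((hc.norm.pow 2).integrableOn_compact (isCompact_closedBall z r)).mono_set
    Metric.ball_subset_closedBall

lemma norm_sq_le_setIntegral_ball {f : ℂ → ℂ} {z : ℂ} {r : ℝ} (hr : 0 < r)
    (hd : DifferentiableOn ℂ f (Metric.closedBall z r)) :
    Real.pi * r ^ 2 * ‖f z‖ ^ 2 ≤ ∫ w in Metric.ball z r, ‖f w‖ ^ 2 := by
  have h := enorm_sq_le_lintegral_ball hr (hd.mono Metric.ball_subset_closedBall) hd.continuousOn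
  simp only [enorm_sq_eq_ofReal] at h
  rw [← ofReal_integral_eq_lintegral_ofReal (integrableOn_norm_sq_of_continuousOn hd.continuousOn)
    (ae_of_all _ fun w => by positivity), ← ENNReal.ofReal_mul (by positivity)] at h
  exact (ENNReal.ofReal_le_ofReal_iff (setIntegral_nonneg Metric.isOpen_ball.measurableSet
    fun w _ => by positivity)).1 h

lemma volume_im_eq_zero : volume {z : ℂ | z.im = 0} = 0 := by
  refine Measure.addHaar_submodule volume (LinearMap.ker Complex.imLm) fun h => ?_
  have : Complex.I ∈ LinearMap.ker Complex.imLm := h ▸ Submodule.mem_top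
  simp at this

lemma integrableOn_mul_complexGrad {h : ℂ → ℂ} {A : Set ℂ}
    (hh : IntegrableOn h (halfPlane ∩ A)) {φ : ℂ → ℝ} (hφ : ContDiff ℝ ∞ φ)
    (hc : HasCompactSupport φ) (hA : tsupport φ ⊆ A) :
    IntegrableOn (fun z => h z * complexGrad φ z) halfPlane := by
  have hcg := continuous_complexGrad hφ
  have hcc : HasCompactSupport (complexGrad φ) := hc.of_isClosed_subset (isClosed_tsupport _)
    (closure_minimal (fun z hz => by
      by_contra h
      exact hz (complexGrad_eq_zero h)) (isClosed_tsupport _))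
  obtain ⟨C, hC⟩ := hcc.exists_bound_of_continuous hcg
  refine IntegrableOn.of_forall_sdiff_eq_zero (s := halfPlane ∩ A)
    (Integrable.mul_bdd (c := C) hh hcg.aestronglyMeasurable (ae_of_all _ hC))
    measurableSet_halfPlane fun z hz => ?_
  rw [complexGrad_eq_zero fun hz' => hz.2 ⟨hz.1, hA hz'⟩, mul_zero]

lemma integrableOn_of_norm_sq_of_finite {h : ℂ → ℂ} (hh : DifferentiableOn ℂ h halfPlane) {A : Set ℂ}
    (hA : MeasurableSet A) (hfin : volume A < ⊤)
    (hL : IntegrableOn (fun z => ‖h z‖ ^ 2) (halfPlane ∩ A)) : IntegrableOn h (halfPlane ∩ A) := by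
  refine Integrable.mono' (g := fun z => 1 + ‖h z‖ ^ 2) (Integrable.add (f := fun _ => (1 : ℝ))
      (integrableOn_const ((measure_mono Set.inter_subset_right).trans_lt hfin).ne) hL)
    ((hh.continuousOn.mono Set.inter_subset_left).aestronglyMeasurable
      (measurableSet_halfPlane.inter hA)) (ae_of_all _ fun z => ?_)
  nlinarith [sq_nonneg (‖h z‖ - 1)]

lemma integrableOn_of_norm_sq {h : ℂ → ℂ} (hh : DifferentiableOn ℂ h halfPlane) {x₀ : ℂ} {ρ : ℝ}
    (hL : IntegrableOn (fun z => ‖h z‖ ^ 2) (halfPlane ∩ Metric.ball x₀ ρ)) :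
    IntegrableOn h (halfPlane ∩ Metric.ball x₀ ρ) :=
  integrableOn_of_norm_sq_of_finite hh Metric.isOpen_ball.measurableSet measure_ball_lt_top hL

lemma conj_mem_ball {x₀ ρ : ℝ} {z : ℂ} (hz : z ∈ Metric.ball (x₀ : ℂ) ρ) :
    (starRingEnd ℂ) z ∈ Metric.ball (x₀ : ℂ) ρ := by
  rw [Metric.mem_ball, ← Complex.conj_ofReal, Complex.dist_conj_conj]
  exact hz

lemma complexGrad_comp_conj {φ : ℂ → ℝ} (hφ : ContDiff ℝ ∞ φ) (z : ℂ) :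
    complexGrad (fun w => φ ((starRingEnd ℂ) w)) z
      = (starRingEnd ℂ) (complexGrad φ ((starRingEnd ℂ) z)) := by
  have h1 := (hφ.differentiable (by simp) ((starRingEnd ℂ) z)).hasFDerivAt.comp z
    Complex.conjCLE.hasFDerivAt
  rw [Function.comp_def] at h1
  change HasFDerivAt (fun w => φ ((starRingEnd ℂ) w)) _ z at h1
  simp [complexGrad, h1.fderiv]

lemma tsupport_comp_conj_subset {φ : ℂ → ℝ} {x₀ ρ : ℝ}
    (hφ : tsupport φ ⊆ Metric.ball (x₀ : ℂ) ρ) :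
    tsupport (fun w => φ ((starRingEnd ℂ) w)) ⊆ Metric.ball (x₀ : ℂ) ρ := fun z hz => by
  have h1 := tsupport_comp_subset_preimage φ Complex.continuous_conj hz
  have := conj_mem_ball (hφ h1)
  rwa [Complex.conj_conj] at this

lemma hasCompactSupport_comp_conj {φ : ℂ → ℝ} (hφ : HasCompactSupport φ) :
    HasCompactSupport (fun w => φ ((starRingEnd ℂ) w)) :=
  hφ.comp_homeomorph Complex.conjCLE.toHomeomorph

/-- `t ‖h (x + i t)‖` tends to zero uniformly for a square integrable holomorphic function. -/
lemma norm_mul_im_le {h : ℂ → ℂ} (hh : DifferentiableOn ℂ h halfPlane) {x₀ ρ ρ' : ℝ}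
    (hL : IntegrableOn (fun z => ‖h z‖ ^ 2) (halfPlane ∩ Metric.ball (x₀ : ℂ) ρ))
    {x t : ℝ} (hx : |x - x₀| < ρ') (ht : 0 < t) (htρ : ρ' + 2 * t ≤ ρ) :
    t * ‖h (x + t * Complex.I)‖
      ≤ Real.sqrt (∫ z in halfPlane ∩ Metric.ball (x₀ : ℂ) ρ ∩ {z | z.im < 2 * t}, ‖h z‖ ^ 2) * 2 := by
  set z : ℂ := x + t * Complex.I with hz
  have him : z.im = t := by simp [hz]
  have hball : ∀ w ∈ Metric.closedBall z (t / 2), t / 2 ≤ w.im ∧ w.im ≤ 3 / 2 * t := fun w hw => by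
    have h1 := (Complex.abs_im_le_norm (w - z)).trans (mem_closedBall_iff_norm.1 hw)
    rw [Complex.sub_im, him, abs_le] at h1
    constructor <;> linarith
  -- The disc of radius t/2 about x + it lies in the strip 0 < Im < 2t and, by `htρ`, in the ball of
  -- radius ρ.
  have h1 := norm_sq_le_setIntegral_ball (f := h) (z := z) (half_pos ht)
    (hh.mono fun w hw => lt_of_lt_of_le (by positivity) (hball w hw).1)
  have h2 : ∫ w in Metric.ball z (t / 2), ‖h w‖ ^ 2
      ≤ ∫ z in halfPlane ∩ Metric.ball (x₀ : ℂ) ρ ∩ {z | z.im < 2 * t}, ‖h z‖ ^ 2 := by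
    refine setIntegral_mono_set (hL.mono_set Set.inter_subset_left)
      (ae_of_all _ fun w => by positivity) (Eventually.of_forall fun w hw => ?_)
    have h3 := hball w (Metric.ball_subset_closedBall hw)
    refine ⟨⟨lt_of_lt_of_le (by positivity) h3.1, ?_⟩, lt_of_le_of_lt h3.2 (by linarith)⟩
    have h4 : dist w z < t / 2 := hw
    have h5 : dist z x₀ ≤ |x - x₀| + t := by
      rw [dist_eq_norm, show z - x₀ = ((x - x₀ : ℝ) : ℂ) + t * Complex.I by rw [hz]; push_cast; ring]
      refine (norm_add_le _ _).trans_eq ?_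
      rw [norm_mul, Complex.norm_I, Complex.norm_real, Complex.norm_real, Real.norm_eq_abs,
        Real.norm_of_nonneg ht.le, mul_one]
    rw [Metric.mem_ball]
    linarith [dist_triangle w z x₀]
  have h6 : t ^ 2 * ‖h z‖ ^ 2
      ≤ (∫ z in halfPlane ∩ Metric.ball (x₀ : ℂ) ρ ∩ {z | z.im < 2 * t}, ‖h z‖ ^ 2) * 4 := by
    have h7 : 1 * (t ^ 2 * ‖h z‖ ^ 2) ≤ Real.pi * (t ^ 2 * ‖h z‖ ^ 2) :=
      mul_le_mul_of_nonneg_right (by linarith [Real.pi_gt_three]) (by positivity)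
    linarith
  have h8 := Real.sqrt_le_sqrt h6
  rw [← mul_pow, Real.sqrt_sq (by positivity), Real.sqrt_mul' _ (by norm_num),
    show (4 : ℝ) = 2 ^ 2 by norm_num, Real.sqrt_sq (by norm_num)] at h8
  exact h8

/-- A test function that vanishes on the real line does not see the boundary values. -/
lemma tendsto_integral_line_of_odd {h : ℂ → ℂ} (hh : DifferentiableOn ℂ h halfPlane) {x₀ ρ : ℝ}
    (hρ : 0 < ρ)
    (hL : IntegrableOn (fun z => ‖h z‖ ^ 2) (halfPlane ∩ Metric.ball (x₀ : ℂ) ρ))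
    {φ : ℂ → ℝ} (hφ : ContDiff ℝ ∞ φ) (hc : HasCompactSupport φ)
    (hs : tsupport φ ⊆ Metric.ball (x₀ : ℂ) ρ) :
    Tendsto (fun t : ℝ => ∫ x : ℝ, (φ (x + t * Complex.I) - φ (x - t * Complex.I))
      * (h (x + t * Complex.I)).im) (𝓝[>] 0) (𝓝 0) := by
  obtain ⟨ρ', hρ', hsub⟩ := exists_pos_lt_subset_ball hρ (isClosed_tsupport φ) hs
  -- The difference φ(x+it) - φ(x-it) is O(t). This compensates the possible growth of h, since t|h|
  -- tends to zero uniformly by `norm_mul_im_le`.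
  obtain ⟨C, hC⟩ := hφ.lipschitzWith_of_hasCompactSupport hc (by simp)
  set E : ℝ → ℝ := fun t =>
    ∫ z in halfPlane ∩ Metric.ball (x₀ : ℂ) ρ ∩ {z | z.im < 2 * t}, ‖h z‖ ^ 2
  have hm : ∀ c : ℝ, MeasurableSet {z : ℂ | z.im < c} := fun c =>
    measurableSet_lt Complex.measurable_im measurable_const
  have hT := measurableSet_halfPlane.inter (Metric.isOpen_ball (x := (x₀ : ℂ)) (ε := ρ)).measurableSet
  have hE : Tendsto E (𝓝[>] 0) (𝓝 0) := by
    refine tendsto_setIntegral_zero hL (fun t => hT.inter (hm _))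
      (Eventually.of_forall fun t => Set.inter_subset_left) hT fun z hz => ?_
    filter_upwards [(eventually_lt_nhds (half_pos (show 0 < z.im from hz.1))).filter_mono
      nhdsWithin_le_nhds] with t ht hmem
    have : z.im < 2 * t := hmem.2
    linarith
  have hlim : Tendsto (fun t => 2 * C * (Real.sqrt (E t) * 2) * (2 * ρ')) (𝓝[>] 0) (𝓝 0) := by
    have := (((Real.continuous_sqrt.tendsto 0).comp hE).mul_const 2).const_mul (2 * (C : ℝ))
    simpa using this.mul_const (2 * ρ')
  refine squeeze_zero_norm' ?_ hlim
  filter_upwards [self_mem_nhdsWithin, (eventually_lt_nhds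
    (show 0 < (ρ - ρ') / 2 by linarith [hρ'.2])).filter_mono nhdsWithin_le_nhds] with t ht htρ
  have ht' : 0 < t := ht
  have hz : ∀ x : ℝ, x ∉ Set.Ioo (x₀ - ρ') (x₀ + ρ') →
      (φ (x + t * Complex.I) - φ (x - t * Complex.I)) * (h (x + t * Complex.I)).im = 0 := by
    intro x hx
    have : ∀ s : ℝ, φ (x + s * Complex.I) = 0 := fun s => by
      refine image_eq_zero_of_notMem_tsupport fun hmem => hx ?_
      have h1 := hsub hmem
      rw [mem_ball_iff_norm] at h1
      have h2 := (Complex.abs_re_le_norm _).trans_lt h1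
      simp only [Complex.sub_re, Complex.add_re, Complex.ofReal_re, Complex.mul_re, Complex.I_re,
        mul_zero, Complex.ofReal_im, zero_mul, sub_zero, add_zero, abs_lt] at h2
      constructor <;> linarith
    have h2 := this (-t)
    rw [Complex.ofReal_neg, neg_mul, ← sub_eq_add_neg] at h2
    rw [this t, h2, sub_zero, zero_mul]
  rw [← setIntegral_eq_integral_of_forall_compl_eq_zero (s := Set.Ioo (x₀ - ρ') (x₀ + ρ')) hz]
  refine (norm_setIntegral_le_of_norm_le_const (C := 2 * C * (Real.sqrt (E t) * 2)) (by simp)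
    fun x hx => ?_).trans_eq ?_
  · have h1 := hC.dist_le_mul (x + t * Complex.I) (x - t * Complex.I)
    rw [Real.dist_eq, dist_eq_norm, show (x + t * Complex.I - (x - t * Complex.I) : ℂ)
      = (2 * t : ℝ) * Complex.I by push_cast; ring, norm_mul, Complex.norm_I, mul_one,
      Complex.norm_real, Real.norm_of_nonneg (by positivity)] at h1
    have h2 := norm_mul_im_le hh hL (x := x) (ρ' := ρ')
      (by rw [abs_lt]; constructor <;> linarith [hx.1, hx.2]) ht' (by linarith)
    rw [norm_mul, Real.norm_eq_abs, Real.norm_eq_abs]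
    calc _ ≤ (C * (2 * t)) * ‖h (x + t * Complex.I)‖ := by
          gcongr
          exact Complex.abs_im_le_norm _
      _ = 2 * C * (t * ‖h (x + t * Complex.I)‖) := by ring
      _ ≤ _ := by gcongr
  · rw [Measure.real, Real.volume_Ioo, ENNReal.toReal_ofReal (by linarith [hρ'.1])]
    ring

/-- The reflection `z ↦ - conj (h (conj z))` of a function on the upper half-plane. -/
noncomputable def oddReflection (h : ℂ → ℂ) (z : ℂ) : ℂ :=
  if 0 < z.im then h z else -(starRingEnd ℂ) (h ((starRingEnd ℂ) z))

lemma differentiableAt_oddReflection {h : ℂ → ℂ} (hh : DifferentiableOn ℂ h halfPlane) {z : ℂ}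
    (hz : z.im ≠ 0) : DifferentiableAt ℂ (oddReflection h) z := by
  rcases lt_or_gt_of_ne hz with h0 | h0
  · have h1 : (starRingEnd ℂ) z ∈ halfPlane := by simpa [halfPlane] using h0
    have h2 := (hh.differentiableAt (isOpen_halfPlane.mem_nhds h1)).conj_conj.neg
    rw [Complex.conj_conj] at h2
    refine h2.congr_of_eventuallyEq ?_
    filter_upwards [(isOpen_lt Complex.continuous_im continuous_const).mem_nhds h0] with w hw
    have : ¬ 0 < w.im := not_lt.2 (le_of_lt hw)
    simp [oddReflection, this]
  · refine (hh.differentiableAt (isOpen_halfPlane.mem_nhds h0)).congr_of_eventuallyEq ?_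
    filter_upwards [isOpen_halfPlane.mem_nhds h0] with w hw
    exact if_pos hw

/-- The reflection principle for square integrable holomorphic functions whose real part has zero
boundary values in the sense of distributions. -/
lemma exists_extension_oddReflection {h : ℂ → ℂ} (hh : DifferentiableOn ℂ h halfPlane) {x₀ ρ : ℝ}
    (hρ : 0 < ρ)
    (hL : IntegrableOn (fun z => ‖h z‖ ^ 2) (halfPlane ∩ Metric.ball (x₀ : ℂ) ρ))
    (hb : ∀ φ : ℂ → ℝ, ContDiff ℝ ∞ φ → HasCompactSupport φ →
      tsupport φ ⊆ Metric.ball (x₀ : ℂ) ρ →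
      Tendsto (fun t : ℝ => ∫ x : ℝ, φ (x + t * Complex.I) * (h (x + t * Complex.I)).re)
        (𝓝[>] 0) (𝓝 0)) :
    ∃ G : ℂ → ℂ, DifferentiableOn ℂ G (Metric.ball (x₀ : ℂ) (ρ / 2)) ∧
      Set.EqOn G (oddReflection h) (Metric.ball (x₀ : ℂ) (ρ / 2) ∩ {z | z.im ≠ 0}) := by
  have hh1 := integrableOn_of_norm_sq hh hL
  set h₀ := halfPlane.indicator h with hh0
  set h₁ : ℂ → ℂ := fun z => -(starRingEnd ℂ) (h₀ ((starRingEnd ℂ) z)) with hh1_def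
  have hae : oddReflection h =ᵐ[volume] fun z => h₀ z + h₁ z := by
    have : ∀ᵐ z : ℂ, z.im ≠ 0 := by
      rw [ae_iff]
      simpa using volume_im_eq_zero
    filter_upwards [this] with z hz
    rcases lt_or_gt_of_ne hz with h0 | h0
    · have h2 : z ∉ halfPlane := not_lt.2 h0.le
      have h3 : (starRingEnd ℂ) z ∈ halfPlane := by simpa [halfPlane] using h0
      simp only [oddReflection, h₁, h₀, Set.indicator_of_mem h3, Set.indicator_of_notMem h2,
        if_neg (not_lt.2 h0.le), zero_add]
    · have h2 : z ∈ halfPlane := h0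
      have h3 : (starRingEnd ℂ) z ∉ halfPlane := by
        simpa [halfPlane] using h0.le
      simp only [oddReflection, h₁, h₀, Set.indicator_of_mem h2, Set.indicator_of_notMem h3,
        if_pos h0, map_zero, neg_zero, add_zero]
  have hmp : MeasurePreserving (starRingEnd ℂ) (volume : Measure ℂ) volume :=
    Complex.conjLIE.measurePreserving
  have hemb : MeasurableEmbedding (starRingEnd ℂ : ℂ → ℂ) :=
    Complex.conjLIE.toHomeomorph.measurableEmbedding
  have hpre : (starRingEnd ℂ : ℂ → ℂ) ⁻¹' Metric.ball (x₀ : ℂ) ρ = Metric.ball (x₀ : ℂ) ρ := by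
    ext z
    refine ⟨fun hz => ?_, fun hz => conj_mem_ball hz⟩
    have := conj_mem_ball hz
    rwa [Complex.conj_conj] at this
  have hi0 : IntegrableOn h₀ (Metric.ball (x₀ : ℂ) ρ) := by
    rw [hh0, integrableOn_indicator_iff measurableSet_halfPlane]
    exact hh1
  have hi1 : IntegrableOn h₁ (Metric.ball (x₀ : ℂ) ρ) := by
    have := (hmp.integrableOn_comp_preimage hemb (s := Metric.ball (x₀ : ℂ) ρ) (f := h₀)).2 hi0
    rw [hpre] at this
    exact (Complex.conjLIE.toContinuousLinearEquiv.toContinuousLinearMap.integrable_comp this).neg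
  refine exists_extension_of_weak hρ ((hi0.add hi1).congr (ae_restrict_of_ae hae.symm))
    (fun z hz => (differentiableAt_oddReflection hh hz.2).differentiableWithinAt)
    fun φ hφ hc hs => ?_
  -- Green's formula for h gives the real part of the integral as the limit of ∫ φ Im h; applied to
  -- -ih it shows that the imaginary part is zero, by `hb`.
  have hX : ∀ φ : ℂ → ℝ, ContDiff ℝ ∞ φ → HasCompactSupport φ →
      tsupport φ ⊆ Metric.ball (x₀ : ℂ) ρ →
      Integrable (fun z => h₀ z * complexGrad φ z) ∧
      Tendsto (fun t : ℝ => ∫ x : ℝ, φ (x + t * Complex.I) * (h (x + t * Complex.I)).im) (𝓝[>] 0)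
        (𝓝 (∫ z, h₀ z * complexGrad φ z).re) ∧ (∫ z, h₀ z * complexGrad φ z).im = 0 := by
    intro φ hφ hc hs
    have hI := integrableOn_mul_complexGrad hh1 hφ hc hs
    have e : (fun z => h₀ z * complexGrad φ z)
        = halfPlane.indicator fun z => h z * complexGrad φ z := by
      ext z
      simp only [hh0, Set.indicator_mul_left]
    rw [e, integral_indicator measurableSet_halfPlane, integrable_indicator_iff measurableSet_halfPlane]
    have h1 := tendsto_integral_line hh hφ hc hI
    have h2 := tendsto_integral_line (hh.const_mul (-Complex.I)) hφ hc (by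
      simp only [mul_assoc]
      exact Integrable.const_mul hI (-Complex.I))
    have e1 : ∫ z in halfPlane, (h z * complexGrad φ z).re
        = (∫ z in halfPlane, h z * complexGrad φ z).re :=
      Complex.reCLM.integral_comp_comm hI
    have e2 : ∫ z in halfPlane, (h z * complexGrad φ z).im
        = (∫ z in halfPlane, h z * complexGrad φ z).im :=
      Complex.imCLM.integral_comp_comm hI
    refine ⟨hI, by rwa [e1] at h1, ?_⟩
    simp only [neg_mul, Complex.neg_im, Complex.I_mul_im, Complex.neg_re, mul_assoc, Complex.I_mul_re,
      neg_neg, mul_neg, integral_neg, e2] at h2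
    have := tendsto_nhds_unique h2 (by simpa using (hb φ hφ hc hs).neg)
    exact this
  obtain ⟨hI, hre, him⟩ := hX φ hφ hc hs
  obtain ⟨hI', hre', him'⟩ := hX (fun w => φ ((starRingEnd ℂ) w))
    (hφ.comp Complex.conjCLE.contDiff)
    (hasCompactSupport_comp_conj hc) (tsupport_comp_conj_subset hs)
  have hz : ∀ z ∉ Metric.ball (x₀ : ℂ) ρ, (h₀ z + h₁ z) * complexGrad φ z = 0 := fun z hz => by
    rw [complexGrad_eq_zero fun h => hz (hs h), mul_zero]
  have hcongr : ∫ z in Metric.ball (x₀ : ℂ) ρ, oddReflection h z * complexGrad φ z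
      = ∫ z, (h₀ z + h₁ z) * complexGrad φ z := by
    rw [← setIntegral_eq_integral_of_forall_compl_eq_zero hz]
    refine integral_congr_ae (ae_restrict_of_ae ?_)
    filter_upwards [hae] with z hz
    rw [hz]
  have e3 : ∀ z, h₁ z * complexGrad φ z = -(starRingEnd ℂ) (h₀ ((starRingEnd ℂ) z)
      * complexGrad (fun w => φ ((starRingEnd ℂ) w)) ((starRingEnd ℂ) z)) := fun z => by
    rw [complexGrad_comp_conj hφ, map_mul, Complex.conj_conj, Complex.conj_conj]
    ring
  have hI1 : Integrable fun z => h₁ z * complexGrad φ z := by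
    simp only [e3]
    exact (Complex.conjLIE.toContinuousLinearEquiv.toContinuousLinearMap.integrable_comp
      ((hmp.integrable_comp_emb hemb).2 hI')).neg
  have e4 : ∫ z, h₁ z * complexGrad φ z = -(starRingEnd ℂ)
      (∫ z, h₀ z * complexGrad (fun w => φ ((starRingEnd ℂ) w)) z) := by
    simp only [e3]
    rw [integral_neg, integral_conj, hmp.integral_comp hemb
      (fun z => h₀ z * complexGrad (fun w => φ ((starRingEnd ℂ) w)) z)]
  -- By `e4` the full integral is X(φ) - conj X(φ∘conj), where X is the integral over the upper
  -- half. Both terms are real, and their difference is the boundary limit for φ - φ∘conj, which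
  -- vanishes on the real line.
  have hodd := tendsto_integral_line_of_odd hh hρ hL hφ hc hs
  have hdiff : (∫ z, h₀ z * complexGrad φ z).re
      - (∫ z, h₀ z * complexGrad (fun w => φ ((starRingEnd ℂ) w)) z).re = 0 := by
    refine tendsto_nhds_unique (hre.sub hre') (hodd.congr' ?_)
    filter_upwards [self_mem_nhdsWithin] with t ht
    have hti : ∀ φ : ℂ → ℝ, Continuous φ → HasCompactSupport φ →
        Integrable fun x : ℝ => φ (x + t * Complex.I) * (h (x + t * Complex.I)).im := by
      intro φ hφ hc
      have hcl : Continuous fun x : ℝ => h (x + t * Complex.I) :=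
        hh.continuousOn.comp_continuous (by fun_prop) fun x => by
          change 0 < (x + t * Complex.I : ℂ).im
          simpa using ht
      refine Continuous.integrable_of_hasCompactSupport
        ((hφ.comp (by fun_prop)).mul (Complex.continuous_im.comp hcl)) ?_
      have : HasCompactSupport fun x : ℝ => φ (x + t * Complex.I) := by
        refine hc.comp_isClosedEmbedding (g := fun x : ℝ => (x + t * Complex.I : ℂ)) ?_
        exact (Homeomorph.addRight (t * Complex.I : ℂ)).isClosedEmbedding.comp
          Complex.isometry_ofReal.isClosedEmbedding
      exact this.mul_right
    rw [← integral_sub (hti φ hφ.continuous hc) (hti (fun w => φ ((starRingEnd ℂ) w))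
      (hφ.continuous.comp Complex.continuous_conj) (hasCompactSupport_comp_conj hc))]
    refine integral_congr_ae (ae_of_all _ fun x => ?_)
    simp [sub_eq_add_neg]
    ring
  rw [hcongr]
  simp only [add_mul]
  rw [integral_add hI hI1, e4]
  apply Complex.ext
  · simpa [sub_eq_add_neg] using hdiff
  · simp only [Complex.add_im, Complex.neg_im, Complex.conj_im, neg_neg, Complex.zero_im]
    rw [him]
    simpa using him'

/-! ### Boundary conditions in the sense of distributions -/

lemma hasDerivAt_horizontal {w : ℂ → ℝ} {h' : ℂ} {x t : ℝ}
    (hg : HasGradientAt w ((starRingEnd ℂ) h') (x + t * Complex.I)) :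
    HasDerivAt (fun x : ℝ => w (x + t * Complex.I)) h'.re x := by
  have h1 : HasDerivAt (fun x : ℝ => (x + t * Complex.I : ℂ)) 1 x :=
    (Complex.ofRealCLM.hasDerivAt (x := x)).add_const _
  have h2 := (hasGradientAt_iff_hasFDerivAt.1 hg).comp_hasDerivAt x h1
  convert! h2 using 1
  simp [Complex.inner]

lemma hasDerivAt_vertical {w : ℂ → ℝ} {h' : ℂ} {x t : ℝ}
    (hg : HasGradientAt w ((starRingEnd ℂ) h') (x + t * Complex.I)) :
    HasDerivAt (fun t : ℝ => w (x + t * Complex.I)) (-h'.im) t := by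
  have h1 : HasDerivAt (fun t : ℝ => (x + t * Complex.I : ℂ)) (1 * Complex.I) t :=
    ((Complex.ofRealCLM.hasDerivAt (x := t)).mul_const Complex.I).const_add _
  have h2 := (hasGradientAt_iff_hasFDerivAt.1 hg).comp_hasDerivAt t h1
  convert! h2 using 1
  simp [Complex.inner]

lemma ofReal_add_mul_I_mem {x t : ℝ} (ht : 0 < t) : (x + t * Complex.I : ℂ) ∈ halfPlane := by
  change 0 < (x + t * Complex.I : ℂ).im
  simpa using ht

lemma continuousOn_vertical {h : ℂ → ℂ} (hh : DifferentiableOn ℂ h halfPlane) (x : ℝ) :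
    ContinuousOn (fun s : ℝ => h (x + s * Complex.I)) (Set.Ioi 0) :=
  hh.continuousOn.comp (by fun_prop) fun _ hs => ofReal_add_mul_I_mem hs

/-- Integrating the vertical derivative from t to δ gives a bound independent of t. It is the
dominating function in `tendsto_integral_line_of_trace`. -/
lemma abs_le_of_integrable_vertical {w : ℂ → ℝ} {h : ℂ → ℂ} (hh : DifferentiableOn ℂ h halfPlane)
    (hg : ∀ z ∈ halfPlane, HasGradientAt w ((starRingEnd ℂ) (h z)) z) {x δ t : ℝ} (ht : 0 < t)
    (htδ : t < δ) (hi : IntegrableOn (fun s : ℝ => h (x + s * Complex.I)) (Set.Ioo 0 δ)) :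
    |w (x + t * Complex.I)| ≤ |w (x + δ * Complex.I)|
      + ∫ s in Set.Ioo 0 δ, ‖h (x + s * Complex.I)‖ := by
  have hsub : Set.Ioc t δ ⊆ Set.Ioi 0 := fun s hs => ht.trans hs.1
  have hI : IntervalIntegrable (fun s : ℝ => -(h (x + s * Complex.I)).im) volume t δ := by
    refine (ContinuousOn.intervalIntegrable ?_)
    rw [Set.uIcc_of_le htδ.le]
    exact (Complex.continuous_im.comp_continuousOn ((continuousOn_vertical hh x).mono
      fun s hs => ht.trans_le hs.1)).neg
  have h1 := intervalIntegral.integral_eq_sub_of_hasDerivAt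
    (f := fun s : ℝ => w (x + s * Complex.I)) (fun s hs => by
      rw [Set.uIcc_of_le htδ.le] at hs
      exact hasDerivAt_vertical (hg _ (ofReal_add_mul_I_mem (ht.trans_le hs.1)))) hI
  have h2 : |∫ s in t..δ, -(h (x + s * Complex.I)).im|
      ≤ ∫ s in Set.Ioo 0 δ, ‖h (x + s * Complex.I)‖ := by
    rw [intervalIntegral.integral_of_le htδ.le, integral_Ioc_eq_integral_Ioo]
    rw [← Real.norm_eq_abs]
    refine (norm_integral_le_integral_norm _).trans ?_
    refine (integral_mono_of_nonneg (ae_of_all _ fun s => norm_nonneg _)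
      (hi.mono_set (Set.Ioo_subset_Ioo_left ht.le)).norm (ae_of_all _ fun s => ?_)).trans
      (setIntegral_mono_set hi.norm (ae_of_all _ fun s => norm_nonneg _)
        (Set.Ioo_subset_Ioo_left ht.le).eventuallyLE)
    simpa using Complex.abs_im_le_norm (h (x + s * Complex.I))
  have h3 : w (x + t * Complex.I)
      = w (x + δ * Complex.I) - ∫ s in t..δ, -(h (x + s * Complex.I)).im := by
    rw [h1]; ring
  rw [h3]
  exact (abs_sub _ _).trans (by gcongr)

/-- The rectangle fits into the half-ball because ρ' + δ ≤ ρ. Fubini then makes h integrable along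
almost every vertical segment. -/
lemma integrableOn_prod_of_ball {h : ℂ → ℂ} {x₀ ρ ρ' δ : ℝ}
    (hh : IntegrableOn h (halfPlane ∩ Metric.ball (x₀ : ℂ) ρ)) (hδ : ρ' + δ ≤ ρ) :
    Integrable (fun p : ℝ × ℝ => h (p.1 + p.2 * Complex.I))
      ((volume.restrict (Set.Ioo (x₀ - ρ') (x₀ + ρ'))).prod (volume.restrict (Set.Ioo 0 δ))) := by
  have hmp := Complex.volume_preserving_equiv_real_prod
  have hemb := Complex.measurableEquivRealProd.measurableEmbedding
  have e2 : h = (fun p => h (Complex.measurableEquivRealProd.symm p)) ∘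
      Complex.measurableEquivRealProd := by
    ext z; simp
  rw [Measure.prod_restrict, ← Measure.volume_eq_prod]
  have h1 : IntegrableOn h
      (Complex.measurableEquivRealProd ⁻¹' (Set.Ioo (x₀ - ρ') (x₀ + ρ') ×ˢ Set.Ioo 0 δ)) := by
    refine hh.mono_set fun z hz => ?_
    have h1 : z.re ∈ Set.Ioo (x₀ - ρ') (x₀ + ρ') := hz.1
    have h2 : z.im ∈ Set.Ioo 0 δ := hz.2
    refine ⟨h2.1, ?_⟩
    rw [mem_ball_iff_norm]
    refine (Complex.norm_le_abs_re_add_abs_im _).trans_lt ?_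
    have h3 : |z.re - x₀| < ρ' := by
      rw [abs_lt]
      constructor <;> linarith [h1.1, h1.2]
    simp only [Complex.sub_re, Complex.ofReal_re, Complex.sub_im, Complex.ofReal_im, sub_zero,
      abs_of_pos h2.1]
    linarith [h2.2]
  rw [e2, hmp.integrableOn_comp_preimage hemb] at h1
  refine h1.congr (ae_of_all _ fun p => ?_)
  simp only [Complex.measurableEquivRealProd_symm_apply]
  congr 1
  apply Complex.ext <;> simp

lemma hasCompactSupport_horizontal {φ : ℂ → ℝ} (hc : HasCompactSupport φ) (t : ℝ) :
    HasCompactSupport fun x : ℝ => φ (x + t * Complex.I) :=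
  hc.comp_isClosedEmbedding (g := fun x : ℝ => (x + t * Complex.I : ℂ))
    ((Homeomorph.addRight (t * Complex.I : ℂ)).isClosedEmbedding.comp
      Complex.isometry_ofReal.isClosedEmbedding)

/-- If a harmonic function has zero boundary values almost everywhere, then its tangential
derivative has zero boundary values in the sense of distributions. -/
lemma tendsto_integral_line_of_trace {w : ℂ → ℝ} {h : ℂ → ℂ} (hh : DifferentiableOn ℂ h halfPlane)
    (hg : ∀ z ∈ halfPlane, HasGradientAt w ((starRingEnd ℂ) (h z)) z) {x₀ ρ : ℝ} (hρ : 0 < ρ)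
    (hL : IntegrableOn (fun z => ‖h z‖ ^ 2) (halfPlane ∩ Metric.ball (x₀ : ℂ) ρ))
    (htr : ∀ᵐ x : ℝ, x ∈ Set.Ioo (x₀ - ρ) (x₀ + ρ) →
      Tendsto (fun t : ℝ => w (x + t * Complex.I)) (𝓝[>] 0) (𝓝 0))
    {φ : ℂ → ℝ} (hφ : ContDiff ℝ ∞ φ) (hc : HasCompactSupport φ)
    (hs : tsupport φ ⊆ Metric.ball (x₀ : ℂ) ρ) :
    Tendsto (fun t : ℝ => ∫ x : ℝ, φ (x + t * Complex.I) * (h (x + t * Complex.I)).re)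
      (𝓝[>] 0) (𝓝 0) := by
  obtain ⟨ρ', hρ', hsub⟩ := exists_pos_lt_subset_ball hρ (isClosed_tsupport φ) hs
  set δ := ρ - ρ' with hδ
  have hδ0 : 0 < δ := by linarith [hρ'.2]
  set J := Set.Ioo (x₀ - ρ') (x₀ + ρ') with hJ
  have hprod := integrableOn_prod_of_ball (integrableOn_of_norm_sq hh hL)
    (show ρ' + δ ≤ ρ by linarith)
  set ψ : ℂ → ℝ := fun z => fderiv ℝ φ z 1 with hψ
  have hψc : Continuous ψ := (hφ.continuous_fderiv (by simp)).clm_apply continuous_const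
  have hψs : HasCompactSupport ψ :=
    (hc.fderiv ℝ).comp_left (g := fun l : ℂ →L[ℝ] ℝ => l 1) rfl
  obtain ⟨C, hC⟩ := hψs.exists_bound_of_continuous hψc
  have hC0 : 0 ≤ C := (norm_nonneg _).trans (hC 0)
  have hψ0 : ∀ x : ℝ, x ∉ J → ∀ t : ℝ, ψ (x + t * Complex.I) = 0 := fun x hx t => by
    have : (x + t * Complex.I : ℂ) ∉ tsupport φ := fun hm => hx (by
      have h1 := hsub hm
      rw [mem_ball_iff_norm] at h1
      have h2 := (Complex.abs_re_le_norm _).trans_lt h1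
      simp only [Complex.sub_re, Complex.add_re, Complex.ofReal_re, Complex.mul_re, Complex.I_re,
        mul_zero, Complex.ofReal_im, zero_mul, sub_zero, add_zero, abs_lt] at h2
      constructor <;> linarith)
    have h2 : fderiv ℝ φ (x + t * Complex.I) = 0 := by
      by_contra h
      exact this (support_fderiv_subset ℝ h)
    rw [hψ]
    simp only [h2, zero_apply]
  have hwc : ContinuousOn w halfPlane := fun z hz =>
    (hg z hz).hasFDerivAt.continuousAt.continuousWithinAt
  have hwt : ∀ t : ℝ, 0 < t → Continuous fun x : ℝ => w (x + t * Complex.I) := fun t ht =>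
    hwc.comp_continuous (by fun_prop) fun x => ofReal_add_mul_I_mem ht
  have hht : ∀ t : ℝ, 0 < t → Continuous fun x : ℝ => (h (x + t * Complex.I)).re := fun t ht =>
    Complex.continuous_re.comp
      (hh.continuousOn.comp_continuous (by fun_prop) fun x => ofReal_add_mul_I_mem ht)
  -- Integration by parts along the line moves the tangential derivative from w to φ, so that only
  -- the trace of w matters in the limit.
  have hparts : ∀ t : ℝ, 0 < t →
      ∫ x : ℝ, φ (x + t * Complex.I) * (h (x + t * Complex.I)).re
        = -∫ x in J, ψ (x + t * Complex.I) * w (x + t * Complex.I) := by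
    intro t ht
    have hφt : Continuous fun x : ℝ => φ (x + t * Complex.I) := hφ.continuous.comp (by fun_prop)
    have hψt : Continuous fun x : ℝ => ψ (x + t * Complex.I) := hψc.comp (by fun_prop)
    have hcφ := hasCompactSupport_horizontal hc t
    have hcψ := hasCompactSupport_horizontal hψs t
    rw [integral_mul_deriv_eq_deriv_mul_of_integrable
      (u := fun x : ℝ => φ (x + t * Complex.I)) (u' := fun x : ℝ => ψ (x + t * Complex.I))
      (v := fun x : ℝ => w (x + t * Complex.I)) (v' := fun x : ℝ => (h (x + t * Complex.I)).re)
      (fun x _ => ?_) (fun x _ => hasDerivAt_horizontal (hg _ (ofReal_add_mul_I_mem ht)))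
      ((hφt.mul (hht t ht)).integrable_of_hasCompactSupport hcφ.mul_right)
      ((hψt.mul (hwt t ht)).integrable_of_hasCompactSupport hcψ.mul_right)
      ((hφt.mul (hwt t ht)).integrable_of_hasCompactSupport hcφ.mul_right)]
    · rw [setIntegral_eq_integral_of_forall_compl_eq_zero fun x hx => ?_]
      rw [hψ0 x hx t, zero_mul]
    · have h1 : HasDerivAt (fun x : ℝ => (x + t * Complex.I : ℂ)) 1 x :=
        (Complex.ofRealCLM.hasDerivAt (x := x)).add_const _
      exact (hφ.differentiable (by simp) _).hasFDerivAt.comp_hasDerivAt x h1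
  have hlim : Tendsto (fun t : ℝ => ∫ x in J, ψ (x + t * Complex.I) * w (x + t * Complex.I))
      (𝓝[>] 0) (𝓝 (∫ x in J, (0 : ℝ))) := by
    refine tendsto_integral_filter_of_dominated_convergence (fun x => C * (|w (x + δ * Complex.I)|
      + ∫ s in Set.Ioo 0 δ, ‖h (x + s * Complex.I)‖)) ?_ ?_ ?_ ?_
    · filter_upwards [self_mem_nhdsWithin] with t ht
      exact ((hψc.comp (by fun_prop)).mul (hwt t ht)).aestronglyMeasurable
    · filter_upwards [self_mem_nhdsWithin, (eventually_lt_nhds hδ0).filter_mono nhdsWithin_le_nhds]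
        with t ht htδ
      filter_upwards [hprod.prod_right_ae] with x hx
      rw [norm_mul]
      exact mul_le_mul (hC _) (abs_le_of_integrable_vertical hh hg ht htδ hx) (norm_nonneg _) hC0
    · refine (Integrable.add ?_ hprod.integral_norm_prod_left).const_mul C
      exact ((hwt δ hδ0).abs.continuousOn.integrableOn_compact isCompact_Icc).mono_set
        Set.Ioo_subset_Icc_self
    · filter_upwards [ae_restrict_of_ae htr, ae_restrict_mem measurableSet_Ioo] with x hx hxJ
      have h1 := hx ⟨by linarith [hxJ.1, hρ'.2], by linarith [hxJ.2, hρ'.2]⟩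
      refine squeeze_zero_norm (a := fun t : ℝ => C * |w (x + t * Complex.I)|) (fun t => ?_) ?_
      · rw [norm_mul]
        exact mul_le_mul_of_nonneg_right (hC _) (norm_nonneg _)
      · simpa using h1.abs.const_mul C
  rw [integral_zero] at hlim
  have h2 := hlim.neg
  rw [neg_zero] at h2
  refine h2.congr' ?_
  filter_upwards [self_mem_nhdsWithin] with t ht
  exact (hparts t ht).symm

/-! ### The homogeneous problem -/

/-- A solution `w` of the homogeneous mixed problem, with complex derivative `h`. -/
structure IsHomogeneousSolution {N : ℕ} (a : Fin N → ℝ) (w : ℂ → ℝ) (h : ℂ → ℂ) : Prop where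
  holomorphic : DifferentiableOn ℂ h halfPlane
  gradient : ∀ z ∈ halfPlane, HasGradientAt w ((starRingEnd ℂ) (h z)) z
  growth : ∃ C : ℝ, ∀ r : ℝ, 0 < r →
    ∫⁻ z in perforated a r, ‖h z‖ₑ ^ 2 ≤ ENNReal.ofReal (C * Real.log (1 / r + 2))
  trace : ∀ᵐ x : ℝ, x ∈ Set.Ioo (-1 : ℝ) 1 →
    Tendsto (fun t : ℝ => w (x + t * Complex.I)) (𝓝[>] 0) (𝓝 0)
  neumann : ∀ ζ : ℂ → ℝ, ContDiff ℝ ∞ ζ → HasCompactSupport ζ → Disjoint (tsupport ζ) segmentIcc →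
    ∫ z in halfPlane, (h z * complexGrad ζ z).re = 0

/-- A function holomorphic off the real line extends holomorphically across `p`. -/
def ExtendsAt (K : ℂ → ℂ) (p : ℂ) : Prop :=
  ∃ ρ > 0, ∃ G : ℂ → ℂ, DifferentiableOn ℂ G (Metric.ball p ρ) ∧
    Set.EqOn G K (Metric.ball p ρ ∩ {z | z.im ≠ 0})

/-- The reflection of `i √(1 - z²) h`, which is real on the boundary. -/
noncomputable def boundaryReflection (h : ℂ → ℂ) (z : ℂ) : ℂ :=
  Complex.I * oddReflection (fun z => sqrtOneSubSq z * h z) z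

lemma exists_ball_inter_subset_perforated {N : ℕ} (a : Fin N → ℝ) {p : ℂ} (hp : ∀ n, p ≠ a n) :
    ∃ r > 0, halfPlane ∩ Metric.ball p r ⊆ perforated a r := by
  have h : ∀ᶠ r : ℝ in 𝓝[>] 0, ∀ n, 2 * r < dist p (a n) := by
    refine eventually_all.2 fun n => ?_
    filter_upwards [(eventually_lt_nhds (half_pos (dist_pos.2 (hp n)))).filter_mono
      nhdsWithin_le_nhds] with r hr
    linarith
  obtain ⟨r, hr, hr0⟩ := (h.and self_mem_nhdsWithin).exists
  refine ⟨r, hr0, fun z hz => ⟨hz.1, ?_⟩⟩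
  simp only [Set.mem_iUnion, not_exists, Metric.mem_ball, not_lt]
  intro n
  have h1 : dist z p < r := hz.2
  have h2 := dist_triangle_left p (a n : ℂ) z
  linarith [hr n]

namespace IsHomogeneousSolution

variable {N : ℕ} {a : Fin N → ℝ} {w : ℂ → ℝ} {h : ℂ → ℂ}

lemma lintegral_lt_top (hw : IsHomogeneousSolution a w h) {r : ℝ} (hr : 0 < r) :
    ∫⁻ z in perforated a r, ‖h z‖ₑ ^ 2 < ⊤ := by
  obtain ⟨C, hC⟩ := hw.growth
  exact (hC r hr).trans_lt ENNReal.ofReal_lt_top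

lemma integrableOn (hw : IsHomogeneousSolution a w h) {r : ℝ} (hr : 0 < r) :
    IntegrableOn (fun z => ‖h z‖ ^ 2) (perforated a r) := by
  refine ⟨(((hw.holomorphic.continuousOn.mono Set.sdiff_subset).norm.pow 2).aestronglyMeasurable
    (measurableSet_perforated a r)), ?_⟩
  rw [HasFiniteIntegral]
  simpa only [enorm_pow, enorm_norm] using hw.lintegral_lt_top hr

lemma exists_integrableOn_ball (hw : IsHomogeneousSolution a w h) {p : ℂ} (hp : ∀ n, p ≠ a n) :
    ∃ r > 0, ∀ ρ ≤ r, IntegrableOn (fun z => ‖h z‖ ^ 2) (halfPlane ∩ Metric.ball p ρ) := by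
  obtain ⟨r, hr, hsub⟩ := exists_ball_inter_subset_perforated a hp
  exact ⟨r, hr, fun ρ hρ => (hw.integrableOn hr).mono_set
    ((Set.inter_subset_inter_right _ (Metric.ball_subset_ball hρ)).trans hsub)⟩

end IsHomogeneousSolution

/-! ### Symmetries of the square roots and extension across regular boundary points -/

lemma conj_cpow_half {w : ℂ} (hw : w ∈ Complex.slitPlane) :
    (starRingEnd ℂ) (((starRingEnd ℂ) w) ^ (1 / 2 : ℂ)) = w ^ (1 / 2 : ℂ) := by
  rw [← Complex.cpow_conj _ _ (Complex.slitPlane_arg_ne_pi hw)]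
  congr 1
  rw [map_div₀, map_one, map_ofNat]

lemma conj_sqrtOneSubSq {z : ℂ} (hz : z.im ≠ 0) :
    (starRingEnd ℂ) (sqrtOneSubSq ((starRingEnd ℂ) z)) = sqrtOneSubSq z := by
  rw [sqrtOneSubSq, sqrtOneSubSq,
    ← conj_cpow_half (one_sub_sq_mem_slitPlane_iff.2 (Or.inl hz))]
  simp

lemma conj_outerSqrt {z : ℂ} (hz : z.im ≠ 0) :
    (starRingEnd ℂ) (outerSqrt ((starRingEnd ℂ) z)) = -outerSqrt z := by
  rw [outerSqrt, outerSqrt, map_mul, map_mul, map_neg, Complex.conj_I, Complex.conj_conj,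
    ← conj_cpow_half (inv_mem_slitPlane_of_notMem fun h => hz h.1)]
  simp

lemma boundaryReflection_of_pos {h : ℂ → ℂ} {z : ℂ} (hz : 0 < z.im) :
    boundaryReflection h z = Complex.I * (sqrtOneSubSq z * h z) := by
  rw [boundaryReflection, oddReflection, if_pos hz]

/-- The form used on the Dirichlet part: this root is symmetric under conjugation and holomorphic
across (-1,1), so only the reflection of h, whose real part vanishes there, has to be extended. -/
lemma boundaryReflection_eq_sqrtOneSubSq {h : ℂ → ℂ} {z : ℂ} (hz : z.im ≠ 0) :
    boundaryReflection h z = Complex.I * (sqrtOneSubSq z * oddReflection h z) := by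
  rcases lt_or_gt_of_ne hz with h0 | h0
  · rw [boundaryReflection, oddReflection, oddReflection, if_neg h0.not_gt, if_neg h0.not_gt, map_mul,
      conj_sqrtOneSubSq hz]
    ring
  · rw [boundaryReflection, oddReflection, oddReflection, if_pos h0, if_pos h0]

/-- The form used on the Neumann part: the outer root is antisymmetric and holomorphic across the
rays. The sign is absorbed by reflecting ih, whose real part -Im h vanishes there. -/
lemma boundaryReflection_eq_outerSqrt {h : ℂ → ℂ} {z : ℂ} (hz : z.im ≠ 0) :
    boundaryReflection h z = outerSqrt z * oddReflection (fun z => Complex.I * h z) z := by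
  rcases lt_or_gt_of_ne hz with h0 | h0
  · have h1 : (starRingEnd ℂ) z ∈ halfPlane := by simpa [halfPlane] using h0
    rw [boundaryReflection, oddReflection, oddReflection, if_neg h0.not_gt, if_neg h0.not_gt,
      ← outerSqrt_eq h1, map_mul, map_mul, Complex.conj_I, conj_outerSqrt hz]
    ring
  · rw [boundaryReflection, oddReflection, oddReflection, if_pos h0, if_pos h0,
      ← outerSqrt_eq h0]
    ring

lemma differentiableAt_boundaryReflection {h : ℂ → ℂ} (hh : DifferentiableOn ℂ h halfPlane) {z : ℂ}
    (hz : z.im ≠ 0) : DifferentiableAt ℂ (boundaryReflection h) z :=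
  (differentiableAt_oddReflection (DifferentiableOn.mul (fun _ hz =>
    (hasDerivAt_sqrtOneSubSq (mem_slitPlane_of_mem_halfPlane hz)).differentiableAt.differentiableWithinAt)
    hh) hz).const_mul _

lemma extendsAt_of_im_ne_zero {h : ℂ → ℂ} (hh : DifferentiableOn ℂ h halfPlane) {p : ℂ}
    (hp : p.im ≠ 0) : ExtendsAt (boundaryReflection h) p := by
  have ho : IsOpen {z : ℂ | z.im ≠ 0} := isOpen_ne_fun Complex.continuous_im continuous_const
  obtain ⟨ρ, hρ, hsub⟩ := Metric.isOpen_iff.1 ho p hp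
  exact ⟨ρ, hρ, _, fun z hz =>
    (differentiableAt_boundaryReflection hh (hsub hz)).differentiableWithinAt, fun z _ => rfl⟩

namespace IsHomogeneousSolution

variable {N : ℕ} {a : Fin N → ℝ} {w : ℂ → ℝ} {h : ℂ → ℂ}

/-- Zero trace of w gives zero boundary values of Re h = ∂₁w in the sense of distributions, and the
reflection principle applies. The radius keeps the ball in the strip |Re z| < 1, where the root is
holomorphic. -/
lemma extendsAt_dirichlet (hw : IsHomogeneousSolution a w h) {x₀ : ℝ}
    (hx : x₀ ∈ Set.Ioo (-1 : ℝ) 1) (hxa : ∀ n, x₀ ≠ a n) :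
    ExtendsAt (boundaryReflection h) x₀ := by
  obtain ⟨r, hr, hint⟩ := hw.exists_integrableOn_ball (p := x₀) fun n => by exact_mod_cast hxa n
  obtain ⟨ρ, hρ, hρr, h1, h2⟩ : ∃ ρ > 0, ρ ≤ r ∧ -1 ≤ x₀ - ρ ∧ x₀ + ρ ≤ 1 := by
    refine ⟨min r (min (x₀ + 1) (1 - x₀)), lt_min hr (lt_min (by linarith [hx.1]) (by linarith [hx.2])),
      min_le_left _ _, ?_, ?_⟩
    · linarith [(min_le_right r (min (x₀ + 1) (1 - x₀))).trans (min_le_left _ _)]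
    · linarith [(min_le_right r (min (x₀ + 1) (1 - x₀))).trans (min_le_right _ _)]
  obtain ⟨G, hG, hGe⟩ := exists_extension_oddReflection hw.holomorphic hρ (hint ρ hρr)
    fun φ hφ hc hs => tendsto_integral_line_of_trace hw.holomorphic hw.gradient hρ (hint ρ hρr)
      (by
        filter_upwards [hw.trace] with x hx hxm
        exact hx (Set.Ioo_subset_Ioo h1 h2 hxm)) hφ hc hs
  refine ⟨ρ / 2, half_pos hρ, fun z => Complex.I * (sqrtOneSubSq z * G z), ?_, fun z hz => ?_⟩
  · refine DifferentiableOn.const_mul (DifferentiableOn.mul (fun z hz => ?_) hG) _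
    refine (hasDerivAt_sqrtOneSubSq (one_sub_sq_mem_slitPlane_iff.2 (Or.inr ?_)))
      |>.differentiableAt.differentiableWithinAt
    have h3 := (Complex.abs_re_le_norm _).trans_lt (mem_ball_iff_norm.1 hz)
    rw [Complex.sub_re, Complex.ofReal_re, abs_lt] at h3
    constructor <;> linarith
  · rw [boundaryReflection_eq_sqrtOneSubSq hz.2, ← hGe hz]

/-- By Green's formula the weak Neumann condition says that Im h has zero boundary values in the
sense of distributions; this is the hypothesis of the reflection principle for ih. -/
lemma extendsAt_neumann (hw : IsHomogeneousSolution a w h) (ha : ∀ n, a n ∈ Set.Ioo (-1 : ℝ) 1)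
    {x₀ : ℝ} (hx : (x₀ : ℂ) ∉ segmentIcc) : ExtendsAt (boundaryReflection h) x₀ := by
  obtain ⟨r, hr, hint⟩ := hw.exists_integrableOn_ball (p := x₀) fun n hn => hx (by
    rw [hn]
    exact ⟨Complex.ofReal_im _, Set.Ioo_subset_Icc_self (ha n)⟩)
  obtain ⟨r', hr', hsub⟩ := Metric.isOpen_iff.1 isClosed_segmentIcc.isOpen_compl _ hx
  set ρ := min r r' with hρ_def
  have hρ : 0 < ρ := lt_min hr hr'
  have hL := hint ρ (min_le_left _ _)
  have hsub' : Metric.ball (x₀ : ℂ) ρ ⊆ segmentIccᶜ :=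
    (Metric.ball_subset_ball (min_le_right _ _)).trans hsub
  have hLI : IntegrableOn (fun z => ‖Complex.I * h z‖ ^ 2) (halfPlane ∩ Metric.ball (x₀ : ℂ) ρ) := by
    simpa only [norm_mul, Complex.norm_I, one_mul] using hL
  obtain ⟨G, hG, hGe⟩ := exists_extension_oddReflection (hw.holomorphic.const_mul Complex.I) hρ hLI
    fun φ hφ hc hs => by
      have h1 := tendsto_integral_line hw.holomorphic hφ hc (integrableOn_mul_complexGrad
        (integrableOn_of_norm_sq hw.holomorphic hL) hφ hc hs)
      rw [hw.neumann φ hφ hc (Set.disjoint_left.2 fun z hz => hsub' (hs hz))] at h1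
      have h2 := h1.neg
      rw [neg_zero] at h2
      refine h2.congr fun t => ?_
      rw [← integral_neg]
      refine integral_congr_ae (ae_of_all _ fun x => ?_)
      simp
  refine ⟨ρ / 2, half_pos hρ, fun z => outerSqrt z * G z, ?_, fun z hz => ?_⟩
  · refine DifferentiableOn.mul (fun z hz => ?_) hG
    exact (differentiableAt_outerSqrt (hsub' (Metric.ball_subset_ball (by linarith) hz))).differentiableWithinAt
  · rw [boundaryReflection_eq_outerSqrt hz.2, ← hGe hz]

/-- The reflected function extends across every point but the walls and the endpoints. -/
lemma extendsAt (hw : IsHomogeneousSolution a w h) (ha : ∀ n, a n ∈ Set.Ioo (-1 : ℝ) 1)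
    {p : ℂ} (hp : ∀ n, p ≠ a n) (h1 : p ≠ 1) (h2 : p ≠ -1) :
    ExtendsAt (boundaryReflection h) p := by
  by_cases hi : p.im = 0
  · obtain ⟨x, rfl⟩ : ∃ x : ℝ, (x : ℂ) = p := ⟨p.re, Complex.ext (by simp) (by simp [hi])⟩
    by_cases hs : (x : ℂ) ∈ segmentIcc
    · have hx : x ∈ Set.Icc (-1 : ℝ) 1 := by simpa using hs.2
      refine hw.extendsAt_dirichlet ⟨hx.1.lt_of_ne fun h => h2 ?_, hx.2.lt_of_ne fun h => h1 ?_⟩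
        fun n => by exact_mod_cast hp n
      · rw [← h]; simp
      · rw [h]; simp
    · exact hw.extendsAt_neumann ha hs
  · exact extendsAt_of_im_ne_zero hw.holomorphic hi

end IsHomogeneousSolution

/-! ### The extension across the real line -/

/-- The values on the real line are defined by passing to the limit. -/
noncomputable def extend (K : ℂ → ℂ) (z : ℂ) : ℂ := limUnder (𝓝[{z : ℂ | z.im ≠ 0}] z) K

lemma neBot_nhdsWithin_im_ne_zero (z : ℂ) : (𝓝[{z : ℂ | z.im ≠ 0}] z).NeBot := by
  rw [← mem_closure_iff_nhdsWithin_neBot]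
  have h1 : Dense ({z : ℂ | z.im = 0}ᶜ) := by
    rw [← interior_eq_empty_iff_dense_compl]
    exact Measure.interior_eq_empty_of_null volume_im_eq_zero
  exact h1 z

/-- The limit is taken off the real line, whose complement is dense. Every local extension therefore
has the same values, and they fit together into one function without choices. -/
lemma extend_eq {K : ℂ → ℂ} {p : ℂ} {ρ : ℝ} {G : ℂ → ℂ}
    (hG : DifferentiableOn ℂ G (Metric.ball p ρ))
    (he : Set.EqOn G K (Metric.ball p ρ ∩ {z | z.im ≠ 0})) {z : ℂ} (hz : z ∈ Metric.ball p ρ) :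
    extend K z = G z := by
  have := neBot_nhdsWithin_im_ne_zero z
  have h1 : Tendsto G (𝓝[{z : ℂ | z.im ≠ 0}] z) (𝓝 (G z)) :=
    (hG.differentiableAt (Metric.isOpen_ball.mem_nhds hz)).continuousAt.tendsto.mono_left
      nhdsWithin_le_nhds
  refine (h1.congr' ?_).limUnder_eq
  filter_upwards [self_mem_nhdsWithin, nhdsWithin_le_nhds (Metric.isOpen_ball.mem_nhds hz)]
    with w hw hw2
  exact he ⟨hw2, hw⟩

lemma ExtendsAt.differentiableAt {K : ℂ → ℂ} {p : ℂ} (hp : ExtendsAt K p) :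
    DifferentiableAt ℂ (extend K) p := by
  obtain ⟨ρ, hρ, G, hG, he⟩ := hp
  refine (hG.differentiableAt (Metric.ball_mem_nhds p hρ)).congr_of_eventuallyEq ?_
  filter_upwards [Metric.ball_mem_nhds p hρ] with z hz
  exact extend_eq hG he hz

lemma extend_boundaryReflection {h : ℂ → ℂ} (hh : DifferentiableOn ℂ h halfPlane) {z : ℂ}
    (hz : z.im ≠ 0) : extend (boundaryReflection h) z = boundaryReflection h z := by
  obtain ⟨ρ, hρ, G, hG, he⟩ := extendsAt_of_im_ne_zero hh hz
  rw [extend_eq hG he (Metric.mem_ball_self hρ), he ⟨Metric.mem_ball_self hρ, hz⟩]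

/-! ### Growth of the reflected function -/

lemma lintegral_oddReflection_le {h : ℂ → ℂ} (hh : DifferentiableOn ℂ h halfPlane) {A : Set ℂ}
    (hA : MeasurableSet A) (hAc : ∀ z ∈ A, (starRingEnd ℂ) z ∈ A) :
    ∫⁻ z in A, ‖oddReflection h z‖ₑ ^ 2 ≤ 2 * ∫⁻ z in halfPlane ∩ A, ‖h z‖ₑ ^ 2 := by
  have hmp : MeasurePreserving (starRingEnd ℂ) (volume : Measure ℂ) volume :=
    Complex.conjLIE.measurePreserving
  have hemb : MeasurableEmbedding (starRingEnd ℂ : ℂ → ℂ) :=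
    Complex.conjLIE.toHomeomorph.measurableEmbedding
  have hT := measurableSet_halfPlane.inter hA
  set f : ℂ → ℝ≥0∞ := (halfPlane ∩ A).indicator fun z => ‖h z‖ₑ ^ 2 with hf
  have hfm : AEMeasurable f := by
    rw [hf, aemeasurable_indicator_iff hT]
    exact ((hh.continuousOn.mono Set.inter_subset_left).enorm.aemeasurable hT).pow_const 2
  have hle : ∀ᵐ z : ℂ, A.indicator (fun z => ‖oddReflection h z‖ₑ ^ 2) z
      ≤ f z + f ((starRingEnd ℂ) z) := by
    have : ∀ᵐ z : ℂ, z.im ≠ 0 := by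
      rw [ae_iff]
      simpa using volume_im_eq_zero
    filter_upwards [this] with z hz
    by_cases hzA : z ∈ A
    · rw [Set.indicator_of_mem hzA]
      rcases lt_or_gt_of_ne hz with h0 | h0
      · have h3 : (starRingEnd ℂ) z ∈ halfPlane ∩ A := ⟨by simpa [halfPlane] using h0, hAc z hzA⟩
        refine le_add_left ?_
        rw [hf, Set.indicator_of_mem h3, oddReflection, if_neg h0.not_gt, enorm_neg,
          RCLike.enorm_conj]
      · refine le_add_right ?_
        rw [hf, Set.indicator_of_mem (show z ∈ halfPlane ∩ A from ⟨h0, hzA⟩), oddReflection, if_pos h0]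
    · rw [Set.indicator_of_notMem hzA]
      exact zero_le
  rw [← lintegral_indicator hA, ← lintegral_indicator hT]
  refine (lintegral_mono_ae hle).trans_eq ?_
  rw [lintegral_add_left' hfm, hmp.lintegral_comp_emb hemb, two_mul]

lemma norm_sqrtOneSubSq_sq (z : ℂ) : ‖sqrtOneSubSq z‖ₑ ^ 2 = ‖1 - z ^ 2‖ₑ := by
  rw [← enorm_pow, sqrtOneSubSq_sq]

/-- Pointwise bound of the reflected function by the energy on an annulus. -/
lemma norm_extend_sq_le {h : ℂ → ℂ} (hh : DifferentiableOn ℂ h halfPlane) {p : ℝ} {z : ℂ}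
    (hz : z ≠ p)
    (hd : ∀ w : ℂ, ‖w - p‖ < 2 * ‖z - p‖ → w ≠ p →
      DifferentiableAt ℂ (extend (boundaryReflection h)) w)
    {M E : ℝ} (hE0 : 0 ≤ E) (hM : ∀ w : ℂ, ‖w - p‖ < 2 * ‖z - p‖ → ‖1 - w ^ 2‖ ≤ M)
    (hE : ∫⁻ w in halfPlane ∩ {w : ℂ | ‖z - p‖ / 2 ≤ ‖w - p‖ ∧ ‖w - p‖ < 2 * ‖z - p‖}, ‖h w‖ₑ ^ 2
      ≤ ENNReal.ofReal E) :
    (‖z - p‖ * ‖extend (boundaryReflection h) z‖) ^ 2 ≤ 4 * M * E := by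
  set d := ‖z - p‖ with hd_def
  have hd0 : 0 < d := norm_pos_iff.2 (sub_ne_zero.2 hz)
  set A : Set ℂ := {w : ℂ | d / 2 ≤ ‖w - p‖ ∧ ‖w - p‖ < 2 * d}
  have hA : MeasurableSet A :=
    (measurableSet_le (f := fun _ => d / 2) (g := fun w : ℂ => ‖w - p‖) (by fun_prop)
      (by fun_prop)).inter (measurableSet_lt (f := fun w : ℂ => ‖w - p‖) (g := fun _ => 2 * d)
        (by fun_prop) (by fun_prop))
  have hAc : ∀ z ∈ A, (starRingEnd ℂ) z ∈ A := fun w hw => by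
    have : ‖(starRingEnd ℂ) w - p‖ = ‖w - p‖ := by
      rw [← Complex.norm_conj (w - p), map_sub, Complex.conj_ofReal]
    simpa only [A, Set.mem_ofPred_eq, this] using hw
  -- The mean value inequality on this disc costs only the energy on the annulus, whose reflection
  -- doubles that on the upper half.
  have hball : Metric.closedBall z (d / 2) ⊆ A := fun w hw => by
    have h1 : ‖w - z‖ ≤ d / 2 := mem_closedBall_iff_norm.1 hw
    have h2 : d ≤ ‖w - z‖ + ‖w - p‖ := by
      rw [hd_def, norm_sub_rev w z]
      simpa using norm_add_le (z - w) (w - p)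
    have h3 : ‖w - p‖ ≤ ‖w - z‖ + d := by
      simpa using norm_add_le (w - z) (z - p)
    constructor <;> linarith
  have hM0 : 0 ≤ M := (norm_nonneg _).trans (hM z (by linarith))
  have hdiff : DifferentiableOn ℂ (extend (boundaryReflection h)) (Metric.closedBall z (d / 2)) :=
    fun w hw => (hd w (hball hw).2 fun h0 => by
      have := (hball hw).1
      rw [h0, sub_self, norm_zero] at this
      linarith).differentiableWithinAt
  have h1 := enorm_sq_le_lintegral_ball (half_pos hd0) (hdiff.mono Metric.ball_subset_closedBall)
    hdiff.continuousOn
  have h2 : ∫⁻ w in Metric.ball z (d / 2), ‖extend (boundaryReflection h) w‖ₑ ^ 2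
      ≤ ENNReal.ofReal M * (2 * ENNReal.ofReal E) := by
    calc _ ≤ ∫⁻ w in A, ‖extend (boundaryReflection h) w‖ₑ ^ 2 :=
          lintegral_mono_set (Metric.ball_subset_closedBall.trans hball)
      _ ≤ ∫⁻ w in A, ENNReal.ofReal M * ‖oddReflection h w‖ₑ ^ 2 := by
          have : ∀ᵐ z : ℂ, z.im ≠ 0 := by
            rw [ae_iff]
            simpa using volume_im_eq_zero
          refine lintegral_mono_ae ?_
          filter_upwards [ae_restrict_of_ae this, ae_restrict_mem hA] with w hw hwA
          rw [extend_boundaryReflection hh hw, boundaryReflection_eq_sqrtOneSubSq hw, enorm_mul,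
            enorm_mul, mul_pow, mul_pow, norm_sqrtOneSubSq_sq, ← ofReal_norm Complex.I,
            Complex.norm_I, ENNReal.ofReal_one, one_pow, one_mul, ← ofReal_norm (1 - w ^ 2)]
          gcongr
          exact hM w hwA.2
      _ = ENNReal.ofReal M * ∫⁻ w in A, ‖oddReflection h w‖ₑ ^ 2 :=
          lintegral_const_mul' _ _ ENNReal.ofReal_ne_top
      _ ≤ _ := by
          gcongr
          exact (lintegral_oddReflection_le hh hA hAc).trans (by gcongr)
  have h3 := h1.trans h2
  rw [enorm_sq_eq_ofReal, ← ENNReal.ofReal_mul (by positivity),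
    show (2 : ℝ≥0∞) = ENNReal.ofReal 2 by simp, ← ENNReal.ofReal_mul (by norm_num),
    ← ENNReal.ofReal_mul hM0, ENNReal.ofReal_le_ofReal_iff (by positivity)] at h3
  -- The mean value inequality gives (π/4) d²|K|² ≤ 2ME, and π ≥ 3 makes the constant 8/π less than
  -- 4.
  have h4 : 3 * (d ^ 2 * ‖extend (boundaryReflection h) z‖ ^ 2)
      ≤ Real.pi * (d ^ 2 * ‖extend (boundaryReflection h) z‖ ^ 2) :=
    mul_le_mul_of_nonneg_right Real.pi_gt_three.le (by positivity)
  have h5 : 0 ≤ M * E := mul_nonneg hM0 hE0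
  rw [mul_pow]
  nlinarith

lemma exists_extension_of_tendsto {f : ℂ → ℂ} {p : ℂ}
    (hd : ∀ᶠ z in 𝓝[≠] p, DifferentiableAt ℂ f z)
    (ht : Tendsto (fun z => (z - p) * f z) (𝓝[≠] p) (𝓝 0)) :
    ∃ ρ > 0, ∃ G : ℂ → ℂ, DifferentiableOn ℂ G (Metric.ball p ρ) ∧
      (∀ z ∈ Metric.ball p ρ, z ≠ p → DifferentiableAt ℂ f z) ∧
      ∀ z ∈ Metric.ball p ρ, z ≠ p → G z = f z := by
  rw [eventually_nhdsWithin_iff, Metric.eventually_nhds_iff_ball] at hd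
  obtain ⟨ρ, hρ, hd⟩ := hd
  refine ⟨ρ, hρ, _, Complex.differentiableOn_update_limUnder_of_isLittleO
    (Metric.ball_mem_nhds p hρ) (fun z hz => (hd z hz.1 hz.2).differentiableWithinAt) ?_, hd,
    fun z _ hz => Function.update_of_ne hz _ _⟩
  rw [Asymptotics.isLittleO_iff_tendsto']
  · have h1 : Tendsto (fun z => (z - p) * f p) (𝓝[≠] p) (𝓝 0) := by
      have : Tendsto (fun z => (z - p) * f p) (𝓝 p) (𝓝 ((p - p) * f p)) :=
        Continuous.tendsto (by fun_prop) p
      rw [sub_self, zero_mul] at this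
      exact this.mono_left nhdsWithin_le_nhds
    have h2 := ht.sub h1
    rw [sub_zero] at h2
    refine h2.congr fun z => ?_
    rw [div_inv_eq_mul]
    ring
  · filter_upwards [self_mem_nhdsWithin] with z hz h0
    exact absurd (inv_eq_zero.1 h0) (sub_ne_zero.2 hz)

lemma tendsto_zero_of_sq_le {f : ℂ → ℂ} {g : ℂ → ℝ} {l : Filter ℂ}
    (hfg : ∀ᶠ z in l, ‖f z‖ ^ 2 ≤ g z) (hg : Tendsto g l (𝓝 0)) : Tendsto f l (𝓝 0) := by
  have h1 : Tendsto (fun z => Real.sqrt (g z)) l (𝓝 0) := by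
    have := (Real.continuous_sqrt.tendsto 0).comp hg
    rwa [Real.sqrt_zero] at this
  refine squeeze_zero_norm' ?_ h1
  filter_upwards [hfg] with z hz
  exact Real.le_sqrt_of_sq_le hz

lemma tendsto_norm_sub_nhdsNE (p : ℂ) : Tendsto (fun z => ‖z - p‖) (𝓝[≠] p) (𝓝[>] 0) := by
  refine tendsto_nhdsWithin_iff.2 ⟨?_, ?_⟩
  · have : Tendsto (fun z => ‖z - p‖) (𝓝 p) (𝓝 ‖p - p‖) := Continuous.tendsto (by fun_prop) p
    rw [sub_self, norm_zero] at this
    exact this.mono_left nhdsWithin_le_nhds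
  · filter_upwards [self_mem_nhdsWithin] with z hz
    exact norm_pos_iff.2 (sub_ne_zero.2 hz)

lemma norm_one_sub_sq_le {w : ℂ} {R : ℝ} (hw : ‖w‖ ≤ R) : ‖1 - w ^ 2‖ ≤ 1 + R ^ 2 := by
  refine (norm_sub_le _ _).trans ?_
  rw [norm_one, norm_pow]
  gcongr

namespace IsHomogeneousSolution

variable {N : ℕ} {a : Fin N → ℝ} {w : ℂ → ℝ} {h : ℂ → ℂ}

lemma lintegral_eq_ofReal (hw : IsHomogeneousSolution a w h) {T : Set ℂ} {r : ℝ} (hr : 0 < r)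
    (hT : T ⊆ perforated a r) :
    ∫⁻ z in T, ‖h z‖ₑ ^ 2 = ENNReal.ofReal (∫ z in T, ‖h z‖ ^ 2) := by
  rw [ofReal_integral_eq_lintegral_ofReal ((hw.integrableOn hr).mono_set hT)
    (ae_of_all _ fun z => by positivity)]
  simp only [enorm_sq_eq_ofReal]

lemma eventually_differentiableAt (hw : IsHomogeneousSolution a w h)
    (ha : ∀ n, a n ∈ Set.Ioo (-1 : ℝ) 1) (p : ℂ) :
    ∃ ρ > 0, ∀ z ∈ Metric.ball p ρ, z ≠ p →
      DifferentiableAt ℂ (extend (boundaryReflection h)) z := by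
  have hfin : (({1, -1} ∪ Set.range fun n => (a n : ℂ)) \ {p}).Finite :=
    (((Set.finite_singleton _).insert _).union (Set.finite_range _)).sdiff
  obtain ⟨ρ, hρ, hsub⟩ := Metric.isOpen_iff.1 hfin.isClosed.isOpen_compl p (by simp)
  refine ⟨ρ, hρ, fun z hz hzp => (hw.extendsAt ha (fun n hn => ?_) (fun h1 => ?_)
    fun h1 => ?_).differentiableAt⟩
  all_goals
    refine hsub hz ⟨?_, hzp⟩
    simp_all

/-- The reflected function extends across the endpoints. -/
lemma extendsAt_endpoint (hw : IsHomogeneousSolution a w h) (ha : ∀ n, a n ∈ Set.Ioo (-1 : ℝ) 1)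
    {p : ℝ} (hp : |p| = 1) : ExtendsAt (boundaryReflection h) p := by
  obtain ⟨ρ, hρ, hd⟩ := hw.eventually_differentiableAt ha p
  obtain ⟨r, hr, hsub⟩ := exists_ball_inter_subset_perforated a (p := p) fun n hn => by
    have h1 : p = a n := by exact_mod_cast hn
    have h2 : |a n| < 1 := abs_lt.2 (ha n)
    rw [← h1] at h2
    linarith
  have hT := measurableSet_halfPlane.inter (Metric.isOpen_ball (x := (p : ℂ)) (ε := r)).measurableSet
  -- An endpoint is not a wall, so the energy near it is finite and tends to zero on shrinking
  -- balls. The factor 20 is 4M with M = 5, from |1-w²| ≤ 5 for |w| ≤ 2.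
  have hlim : Tendsto (fun d : ℝ => 20 * ∫ w in halfPlane ∩ Metric.ball (p : ℂ) (2 * d), ‖h w‖ ^ 2)
      (𝓝[>] 0) (𝓝 0) := by
    refine LE.le.trans_eq ((tendsto_setIntegral_zero ((hw.integrableOn hr).mono_set hsub)
      (fun d => measurableSet_halfPlane.inter Metric.isOpen_ball.measurableSet) ?_ hT
      fun z hz => ?_).const_mul 20) (congrArg 𝓝 (mul_zero 20))
    · filter_upwards [(eventually_lt_nhds (half_pos hr)).filter_mono nhdsWithin_le_nhds] with d hd
      exact Set.inter_subset_inter_right _ (Metric.ball_subset_ball (by linarith))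
    · have h0 : z ≠ p := fun h0 => by
        have h1 : 0 < z.im := hz.1
        simp [h0] at h1
      filter_upwards [(eventually_lt_nhds (half_pos (dist_pos.2 h0))).filter_mono
        nhdsWithin_le_nhds] with d hd hm
      have : dist z p < 2 * d := hm.2
      linarith
  have ht : Tendsto (fun z => (z - p) * extend (boundaryReflection h) z) (𝓝[≠] (p : ℂ)) (𝓝 0) := by
    refine tendsto_zero_of_sq_le ?_ (hlim.comp (tendsto_norm_sub_nhdsNE (p : ℂ)))
    have hs : ∀ᶠ d : ℝ in 𝓝[>] 0, d < ρ / 2 ∧ d < r / 2 ∧ d < 1 / 2 :=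
      ((eventually_lt_nhds (half_pos hρ)).and ((eventually_lt_nhds (half_pos hr)).and
        (eventually_lt_nhds (by norm_num)))).filter_mono nhdsWithin_le_nhds
    filter_upwards [self_mem_nhdsWithin, (tendsto_norm_sub_nhdsNE (p : ℂ)).eventually hs]
      with z hz hzs
    rw [norm_mul]
    have hE0 : 0 ≤ ∫ w in halfPlane ∩ Metric.ball (p : ℂ) (2 * ‖z - p‖), ‖h w‖ ^ 2 :=
      integral_nonneg fun _ => by positivity
    refine (norm_extend_sq_le hw.holomorphic hz (fun w hw' hne => hd w ?_ hne) (M := 5) hE0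
      (fun w hw' => ?_) ?_).trans_eq ?_
    · rw [mem_ball_iff_norm]
      linarith [hzs.1]
    · have h1 : ‖w‖ ≤ 2 := by
        have h2 : ‖w‖ ≤ ‖w - p‖ + ‖(p : ℂ)‖ := by simpa using norm_add_le (w - p) (p : ℂ)
        rw [Complex.norm_real, Real.norm_eq_abs, hp] at h2
        linarith [hzs.2.2]
      exact (norm_one_sub_sq_le h1).trans (by norm_num)
    · rw [← hw.lintegral_eq_ofReal hr ((Set.inter_subset_inter_right _
        (Metric.ball_subset_ball (by linarith [hzs.2.1]))).trans hsub)]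
      refine lintegral_mono_set (Set.inter_subset_inter_right _ fun w hw' => ?_)
      exact mem_ball_iff_norm.2 hw'.2
    · simp only [Function.comp_apply]
      ring
  obtain ⟨ρ', hρ', G, hG, -, hGe⟩ := exists_extension_of_tendsto
    (eventually_nhdsWithin_iff.2 (Metric.eventually_nhds_iff_ball.2 ⟨ρ, hρ, hd⟩)) ht
  refine ⟨ρ', hρ', G, hG, fun z hz => ?_⟩
  rw [hGe z hz.1 fun h0 => hz.2 (by simp [h0]), extend_boundaryReflection hw.holomorphic hz.2]

/-- At a wall the reflected function has at most a simple pole. -/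
lemma exists_extension_wall (hw : IsHomogeneousSolution a w h)
    (ha : ∀ n, a n ∈ Set.Ioo (-1 : ℝ) 1) (hinj : Function.Injective a) (n : Fin N) :
    ∃ ρ > 0, ∃ G : ℂ → ℂ, DifferentiableOn ℂ G (Metric.ball (a n : ℂ) ρ) ∧
      ∀ z ∈ Metric.ball (a n : ℂ) ρ, z.im ≠ 0 → G z = (z - a n) * boundaryReflection h z := by
  obtain ⟨ρ, hρ, hd⟩ := hw.eventually_differentiableAt ha (a n)
  obtain ⟨C, hC⟩ := hw.growth
  -- The growth condition at radius d/2 and log x ≤ x - 1 give |(z-a)K|² ≤ 20|C|(2/d + 1). One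
  -- further factor z-a makes this tend to zero, so (z-a)K has a removable singularity.
  have hlim : Tendsto (fun d : ℝ => d ^ 2 * (20 * (|C| * (2 / d + 1)))) (𝓝[>] 0) (𝓝 0) := by
    have h1 : Tendsto (fun d : ℝ => 20 * |C| * (2 * d + d ^ 2)) (𝓝[>] 0) (𝓝 0) := by
      have : Tendsto (fun d : ℝ => 20 * |C| * (2 * d + d ^ 2)) (𝓝 0)
          (𝓝 (20 * |C| * (2 * 0 + 0 ^ 2))) := Continuous.tendsto (by fun_prop) 0
      simp only [mul_zero, zero_pow two_ne_zero, add_zero] at this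
      exact this.mono_left nhdsWithin_le_nhds
    refine h1.congr' ?_
    filter_upwards [self_mem_nhdsWithin] with d hd
    have : d ≠ 0 := ne_of_gt hd
    field_simp
  have ht : Tendsto (fun z => (z - a n) * ((z - a n) * extend (boundaryReflection h) z))
      (𝓝[≠] (a n : ℂ)) (𝓝 0) := by
    refine tendsto_zero_of_sq_le ?_ (hlim.comp (tendsto_norm_sub_nhdsNE (a n : ℂ)))
    -- With 4d below the distance to the other walls, the annulus between d/2 and 2d avoids all
    -- discs of radius d/2.
    have hs : ∀ᶠ d : ℝ in 𝓝[>] 0, d < ρ / 2 ∧ d < 1 / 2 ∧ ∀ k, k ≠ n → 4 * d < |a k - a n| := by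
      refine Eventually.filter_mono nhdsWithin_le_nhds ((eventually_lt_nhds (half_pos hρ)).and
        ((eventually_lt_nhds (by norm_num)).and (eventually_all.2 fun k => ?_)))
      by_cases hk : k = n
      · simp [hk]
      · have h1 : 0 < |a k - a n| / 4 := by
          have := abs_pos.2 (sub_ne_zero.2 (hinj.ne hk))
          positivity
        filter_upwards [eventually_lt_nhds h1] with d hd _
        linarith
    filter_upwards [self_mem_nhdsWithin, (tendsto_norm_sub_nhdsNE (a n : ℂ)).eventually hs]
      with z hz hzs
    have hd0 : 0 < ‖z - a n‖ := norm_pos_iff.2 (sub_ne_zero.2 hz)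
    have key := norm_extend_sq_le hw.holomorphic hz (fun w hw' hne => hd w (by
        rw [mem_ball_iff_norm]
        linarith [hzs.1]) hne) (M := 5) (E := |C| * (2 / ‖z - a n‖ + 1)) (by positivity)
      (fun w hw' => by
        have h1 : ‖w‖ ≤ 2 := by
          have h2 : ‖w‖ ≤ ‖w - a n‖ + ‖(a n : ℂ)‖ := by simpa using norm_add_le (w - a n) (a n : ℂ)
          have h3 : |a n| < 1 := abs_lt.2 (ha n)
          rw [Complex.norm_real, Real.norm_eq_abs] at h2
          linarith [hzs.2.1]
        exact (norm_one_sub_sq_le h1).trans (by norm_num)) (by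
        have hlog : Real.log (1 / (‖z - a n‖ / 2) + 2) ≤ 2 / ‖z - a n‖ + 1 := by
          have h1 : 0 < 1 / (‖z - a n‖ / 2) + 2 := by positivity
          refine (Real.log_le_sub_one_of_pos h1).trans (le_of_eq ?_)
          field_simp
          ring
        have hlog0 : 0 ≤ Real.log (1 / (‖z - a n‖ / 2) + 2) :=
          Real.log_nonneg (by linarith [show 0 < 1 / (‖z - a n‖ / 2) by positivity])
        refine (lintegral_mono_set ?_).trans ((hC (‖z - a n‖ / 2) (by positivity)).trans
          (ENNReal.ofReal_le_ofReal (mul_le_mul (le_abs_self C) hlog hlog0 (abs_nonneg C))))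
        rintro w ⟨hwH, hw1, hw2⟩
        refine ⟨hwH, ?_⟩
        simp only [Set.mem_iUnion, not_exists, Metric.mem_ball, not_lt, dist_eq_norm]
        intro k
        by_cases hk : k = n
        · rw [hk]; exact hw1
        · have h1 := hzs.2.2 k hk
          have h2 : |a k - a n| ≤ ‖w - a k‖ + ‖w - a n‖ := by
            have h3 := norm_sub_le (w - a n) (w - a k)
            rw [sub_sub_sub_cancel_left, ← Complex.ofReal_sub, Complex.norm_real,
              Real.norm_eq_abs] at h3
            linarith
          linarith)
    rw [norm_mul, norm_mul, mul_pow]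
    simp only [Function.comp_apply]
    refine (mul_le_mul_of_nonneg_left key (by positivity)).trans_eq ?_
    ring
  obtain ⟨ρ', hρ', G, hG, -, hGe⟩ := exists_extension_of_tendsto
    (eventually_nhdsWithin_iff.2 (Metric.eventually_nhds_iff_ball.2 ⟨ρ, hρ, fun z hz hne =>
      (differentiableAt_id.sub_const (a n : ℂ)).mul (hd z hz hne)⟩)) ht
  refine ⟨ρ', hρ', G, hG, fun z hz hi => ?_⟩
  rw [hGe z hz fun h0 => hi (by simp [h0])]
  simp [extend_boundaryReflection hw.holomorphic hi]

/-- The reflected function vanishes at infinity. -/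
lemma tendsto_extend_cocompact (hw : IsHomogeneousSolution a w h)
    (ha : ∀ n, a n ∈ Set.Ioo (-1 : ℝ) 1)
    (hd : ∀ z, z ≠ 0 → DifferentiableAt ℂ (extend (boundaryReflection h)) z) :
    Tendsto (extend (boundaryReflection h)) (cocompact ℂ) (𝓝 0) := by
  have hT := measurableSet_perforated a 1
  have hsub : ∀ d : ℝ, MeasurableSet (perforated a 1 ∩ {w : ℂ | d / 2 ≤ ‖w‖}) := fun d =>
    hT.inter (measurableSet_le measurable_const measurable_norm)
  have hlim : Tendsto (fun d : ℝ => 20 * ∫ w in perforated a 1 ∩ {w : ℂ | d / 2 ≤ ‖w‖}, ‖h w‖ ^ 2)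
      atTop (𝓝 0) := by
    rw [← mul_zero (20 : ℝ)]
    refine (tendsto_setIntegral_zero (hw.integrableOn one_pos) hsub
      (Eventually.of_forall fun d => Set.inter_subset_left) hT fun z hz => ?_).const_mul 20
    filter_upwards [eventually_gt_atTop (2 * ‖z‖)] with d hd hm
    have : d / 2 ≤ ‖z‖ := hm.2
    linarith
  refine tendsto_zero_of_sq_le ?_ (hlim.comp (tendsto_norm_cocompact_atTop (E := ℂ)))
  -- For |z| ≥ 4 the points with |w| ≥ |z|/2 are outside the unit discs about the walls. There M =
  -- 5|z|², and |z|² cancels against the left-hand side, leaving 20 times the tail of the energy.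
  filter_upwards [(tendsto_norm_cocompact_atTop (E := ℂ)).eventually_ge_atTop 4] with z hz
  have hz0 : z ≠ 0 := fun h0 => by
    rw [h0, norm_zero] at hz
    linarith
  have hE0 : 0 ≤ ∫ w in perforated a 1 ∩ {w : ℂ | ‖z‖ / 2 ≤ ‖w‖}, ‖h w‖ ^ 2 :=
    integral_nonneg fun _ => by positivity
  have key := norm_extend_sq_le hw.holomorphic (p := 0) (z := z) (by simpa using hz0)
    (fun w _ hne => hd w (by simpa using hne)) (M := 5 * ‖z‖ ^ 2) hE0 (fun w hw' => by
      rw [Complex.ofReal_zero, sub_zero, sub_zero] at hw'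
      refine (norm_one_sub_sq_le hw'.le).trans ?_
      nlinarith) (by
      simp only [Complex.ofReal_zero, sub_zero]
      rw [← hw.lintegral_eq_ofReal one_pos Set.inter_subset_left]
      refine lintegral_mono_set fun w hw' => ⟨⟨hw'.1, ?_⟩, hw'.2.1⟩
      simp only [Set.mem_iUnion, not_exists, Metric.mem_ball, not_lt, dist_eq_norm]
      intro k
      have h1 : ‖w‖ ≤ ‖w - a k‖ + ‖(a k : ℂ)‖ := by simpa using norm_add_le (w - a k) (a k : ℂ)
      have h3 : |a k| < 1 := abs_lt.2 (ha k)
      rw [Complex.norm_real, Real.norm_eq_abs] at h1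
      linarith [hw'.2.1])
  rw [Complex.ofReal_zero, sub_zero, mul_pow] at key
  refine le_of_mul_le_mul_left (key.trans_eq ?_) (show 0 < ‖z‖ ^ 2 by positivity)
  simp only [Function.comp_apply]
  ring

end IsHomogeneousSolution

/-! ### Uniqueness -/

lemma exists_eq_add_of_gradient {U : Set ℂ} (hU : IsOpen U) (hU' : IsPreconnected U) {f g : ℂ → ℝ}
    {F : ℂ → ℂ} (hf : ∀ z ∈ U, HasGradientAt f (F z) z) (hg : ∀ z ∈ U, HasGradientAt g (F z) z) :
    ∃ c, ∀ z ∈ U, f z = g z + c := by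
  obtain ⟨c, hc⟩ := hU.exists_eq_add_of_fderiv_eq (𝕜 := ℝ) hU'
    (fun z hz => (hf z hz).hasFDerivAt.differentiableAt.differentiableWithinAt)
    (fun z hz => (hg z hz).hasFDerivAt.differentiableAt.differentiableWithinAt)
    fun z hz => by rw [(hf z hz).hasFDerivAt.fderiv, (hg z hz).hasFDerivAt.fderiv]
  exact ⟨c, fun z hz => hc hz⟩

/-- A simple pole of the complex derivative at the boundary forces a jump of the trace or a
logarithmic singularity. -/
lemma residue_eq_zero {w : ℂ → ℝ} {h : ℂ → ℂ}
    (hg : ∀ z ∈ halfPlane, HasGradientAt w ((starRingEnd ℂ) (h z)) z) {a ρ : ℝ} (hρ : 0 < ρ)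
    {F : ℂ → ℂ} (hF : DifferentiableOn ℂ F (Metric.ball (a : ℂ) ρ))
    (hh : ∀ z ∈ halfPlane ∩ Metric.ball (a : ℂ) ρ, h z = F z / (z - a))
    (htr : ∀ᵐ x : ℝ, x ∈ Set.Ioo (a - ρ) (a + ρ) →
      Tendsto (fun t : ℝ => w (x + t * Complex.I)) (𝓝[>] 0) (𝓝 0)) :
    F a = 0 := by
  set c := F a with hc
  have ha : (a : ℂ) ∈ Metric.ball (a : ℂ) ρ := Metric.mem_ball_self hρ
  -- Splitting F(z)/(z-a) = c/(z-a) + `dslope` and integrating gives w = Re(c log(z-a) + ψ) up to a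
  -- constant.
  obtain ⟨ψ, hψ⟩ := ((Complex.differentiableOn_dslope (Metric.ball_mem_nhds _ hρ)).2
    hF).isExactOn_ball
  have hψc : ContinuousOn ψ (Metric.ball (a : ℂ) ρ) := fun z hz =>
    (hψ z hz).continuousAt.continuousWithinAt
  set W : ℂ → ℂ := fun z => c * Complex.log (z - a) + ψ z
  obtain ⟨c₀, hc₀⟩ := exists_eq_add_of_gradient (isOpen_halfPlane.inter Metric.isOpen_ball)
    ((convex_halfSpace_im_gt 0).inter (convex_ball (a : ℂ) ρ)).isPreconnected
    (f := w) (g := fun z => (W z).re) (F := fun z => (starRingEnd ℂ) (h z))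
    (fun z hz => hg z hz.1) fun z hz => by
      have hne : z - a ≠ 0 := sub_ofReal_ne_zero hz.1
      have hsl : z - a ∈ Complex.slitPlane := Or.inr (by
        rw [Complex.sub_im, Complex.ofReal_im, sub_zero]
        exact ne_of_gt hz.1)
      refine hasGradientAt_re ?_
      have h1 := (((hasDerivAt_id z).sub_const (a : ℂ)).clog hsl).const_mul c |>.add (hψ z hz.2)
      convert! h1 using 1
      rw [dslope_of_ne _ (sub_ne_zero.1 hne), slope_def_field, hh z hz]
      simp only [id]
      field_simp
      ring
  have hmem : ∀ x ∈ Set.Ioo (a - ρ) (a + ρ), (x : ℂ) ∈ Metric.ball (a : ℂ) ρ := fun x hx => by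
    rw [mem_ball_iff_norm, ← Complex.ofReal_sub, Complex.norm_real, Real.norm_eq_abs, abs_lt]
    constructor <;> linarith [hx.1, hx.2]
  have hlim : ∀ x ∈ Set.Ioo (a - ρ) (a + ρ), ∀ L : ℂ,
      Tendsto Complex.log (𝓝[{z : ℂ | 0 ≤ z.im}] (x - a : ℂ)) (𝓝 L) →
      Tendsto (fun t : ℝ => w (x + t * Complex.I)) (𝓝[>] 0) (𝓝 0) →
      (c * L).re + (ψ x).re + c₀ = 0 := by
    intro x hx L hL hw
    have hline : Tendsto (fun t : ℝ => (x + t * Complex.I : ℂ)) (𝓝[>] 0) (𝓝 (x : ℂ)) := by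
      have : Tendsto (fun t : ℝ => (x + t * Complex.I : ℂ)) (𝓝 0) (𝓝 (x + (0 : ℝ) * Complex.I)) :=
        Continuous.tendsto (by fun_prop) 0
      rw [Complex.ofReal_zero, zero_mul, add_zero] at this
      exact this.mono_left nhdsWithin_le_nhds
    have h1 : Tendsto (fun t : ℝ => Complex.log (x + t * Complex.I - a)) (𝓝[>] 0) (𝓝 L) := by
      refine hL.comp (tendsto_nhdsWithin_iff.2 ⟨hline.sub_const _, ?_⟩)
      filter_upwards [self_mem_nhdsWithin] with t ht
      have ht' : 0 < t := ht
      simpa using ht'.le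
    have h2 : Tendsto (fun t : ℝ => ψ (x + t * Complex.I)) (𝓝[>] 0) (𝓝 (ψ x)) :=
      (hψ x (hmem x hx)).continuousAt.tendsto.comp hline
    have h3 := ((Complex.continuous_re.tendsto _).comp ((h1.const_mul c).add h2)).add_const c₀
    rw [Complex.add_re] at h3
    refine tendsto_nhds_unique h3 (hw.congr' ?_)
    filter_upwards [self_mem_nhdsWithin, hline (Metric.isOpen_ball.mem_nhds (hmem x hx))] with t ht htb
    exact hc₀ _ ⟨ofReal_add_mul_I_mem ht, htb⟩
  -- The vanishing trace holds almost everywhere on each side of a; as the limit is a continuous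
  -- function of δ, it vanishes everywhere. On the left the logarithm contributes the extra term -π
  -- Im c.
  have hplus : Set.EqOn (fun δ : ℝ => c.re * Real.log δ + (ψ (a + δ : ℝ)).re + c₀) (fun _ => 0)
      (Set.Ioo 0 ρ) := by
    refine Measure.eqOn_open_of_ae_eq (μ := volume) ?_ isOpen_Ioo ?_ continuousOn_const
    · filter_upwards [ae_restrict_of_ae ((measurePreserving_add_left volume a).quasiMeasurePreserving.ae
        htr), ae_restrict_mem measurableSet_Ioo] with δ hδ hδm
      have hx : a + δ ∈ Set.Ioo (a - ρ) (a + ρ) := ⟨by linarith [hδm.1], by linarith [hδm.2]⟩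
      have := hlim (a + δ) hx (Real.log δ) ?_ (hδ hx)
      · rw [Complex.re_mul_ofReal] at this
        exact this
      · rw [show ((a + δ : ℝ) - a : ℂ) = (δ : ℂ) by push_cast; ring, Complex.ofReal_log hδm.1.le]
        exact (continuousAt_clog (Or.inl (by simpa using hδm.1))).tendsto.mono_left
          nhdsWithin_le_nhds
    · refine ((ContinuousOn.const_mul ?_ _).add ?_).add continuousOn_const
      · exact Real.continuousOn_log.mono fun δ hδ => ne_of_gt hδ.1
      · exact Complex.continuous_re.comp_continuousOn (hψc.comp (by fun_prop) fun δ hδ =>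
          hmem _ ⟨by linarith [hδ.1], by linarith [hδ.2]⟩)
  have hminus : Set.EqOn
      (fun δ : ℝ => c.re * Real.log δ - c.im * Real.pi + (ψ (a - δ : ℝ)).re + c₀) (fun _ => 0)
      (Set.Ioo 0 ρ) := by
    refine Measure.eqOn_open_of_ae_eq (μ := volume) ?_ isOpen_Ioo ?_ continuousOn_const
    · filter_upwards [ae_restrict_of_ae ((Measure.measurePreserving_sub_left volume a).quasiMeasurePreserving.ae
        htr), ae_restrict_mem measurableSet_Ioo] with δ hδ hδm
      have hx : a - δ ∈ Set.Ioo (a - ρ) (a + ρ) := ⟨by linarith [hδm.2], by linarith [hδm.1]⟩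
      have := hlim (a - δ) hx (Real.log δ + Real.pi * Complex.I) ?_ (hδ hx)
      · simpa [Complex.log_ofReal_re] using this
      · have e : ((a - δ : ℝ) - a : ℂ) = ((-δ : ℝ) : ℂ) := by push_cast; ring
        have h1 := Complex.tendsto_log_nhdsWithin_im_nonneg_of_re_neg_of_im_zero
          (z := ((-δ : ℝ) : ℂ)) (by simpa using hδm.1) (Complex.ofReal_im _)
        rw [Complex.norm_real, norm_neg, Real.norm_of_nonneg hδm.1.le] at h1
        rwa [e]
    · refine (((ContinuousOn.const_mul ?_ _).sub continuousOn_const).add ?_).add continuousOn_const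
      · exact Real.continuousOn_log.mono fun δ hδ => ne_of_gt hδ.1
      · exact Complex.continuous_re.comp_continuousOn (hψc.comp (by fun_prop) fun δ hδ =>
          hmem _ ⟨by linarith [hδ.2], by linarith [hδ.1]⟩)
  have hψlim : ∀ σ : ℝ, Tendsto (fun δ : ℝ => (ψ (a + σ * δ : ℝ)).re) (𝓝[>] 0) (𝓝 (ψ a).re) := by
    intro σ
    have h1 : Tendsto (fun δ : ℝ => ((a + σ * δ : ℝ) : ℂ)) (𝓝 0) (𝓝 ((a + σ * 0 : ℝ) : ℂ)) :=
      Continuous.tendsto (by fun_prop) 0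
    rw [mul_zero, add_zero] at h1
    exact (Complex.continuous_re.tendsto _).comp
      ((hψ a ha).continuousAt.tendsto.comp (h1.mono_left nhdsWithin_le_nhds))
  have hev : ∀ᶠ δ : ℝ in 𝓝[>] 0, δ ∈ Set.Ioo 0 ρ := Ioo_mem_nhdsGT hρ
  -- The two one-sided identities differ by π Im c, while ψ is continuous at a.
  have him : c.im = 0 := by
    have h1 := (hψlim (-1)).sub (hψlim 1)
    rw [sub_self] at h1
    have h2 : c.im * Real.pi = 0 := by
      refine tendsto_nhds_unique (tendsto_const_nhds.congr' ?_) h1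
      filter_upwards [hev] with δ hδ
      have e1 := hplus hδ
      have e2 := hminus hδ
      simp only at e1 e2
      rw [one_mul, neg_one_mul, ← sub_eq_add_neg]
      linarith
    exact (mul_eq_zero.1 h2).resolve_right Real.pi_ne_zero
  -- Otherwise log δ would have a finite limit as δ tends to zero.
  have hre : c.re = 0 := by
    by_contra hne
    have h1 := (((hψlim 1).neg.sub_const c₀).div_const c.re)
    refine not_tendsto_nhds_of_tendsto_atBot Real.tendsto_log_nhdsGT_zero _ (h1.congr' ?_)
    filter_upwards [hev] with δ hδ
    have e1 := hplus hδ
    simp only at e1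
    rw [one_mul, div_eq_iff hne]
    linarith
  exact Complex.ext hre him

namespace IsHomogeneousSolution

variable {N : ℕ} {a : Fin N → ℝ} {w : ℂ → ℝ} {h : ℂ → ℂ}

/-- The residue of h at the wall is `G (a n)` divided by the non-zero number i√(1-a²). It vanishes
by `residue_eq_zero`, and then `dslope G` extends K. -/
lemma extendsAt_wall (hw : IsHomogeneousSolution a w h) (ha : ∀ n, a n ∈ Set.Ioo (-1 : ℝ) 1)
    (hinj : Function.Injective a) (n : Fin N) : ExtendsAt (boundaryReflection h) (a n) := by
  obtain ⟨ρ₀, hρ₀, G, hG₀, hGe₀⟩ := hw.exists_extension_wall ha hinj n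
  obtain ⟨ρ, hρ, hρr, h1, h2⟩ : ∃ ρ > 0, ρ ≤ ρ₀ ∧ -1 ≤ a n - ρ ∧ a n + ρ ≤ 1 := by
    refine ⟨min ρ₀ (min (a n + 1) (1 - a n)),
      lt_min hρ₀ (lt_min (by linarith [(ha n).1]) (by linarith [(ha n).2])), min_le_left _ _, ?_, ?_⟩
    · linarith [(min_le_right ρ₀ (min (a n + 1) (1 - a n))).trans (min_le_left _ _)]
    · linarith [(min_le_right ρ₀ (min (a n + 1) (1 - a n))).trans (min_le_right _ _)]
  have hsub : Metric.ball (a n : ℂ) ρ ⊆ Metric.ball (a n : ℂ) ρ₀ := Metric.ball_subset_ball hρr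
  have hG := hG₀.mono hsub
  have hslit : ∀ z ∈ Metric.ball (a n : ℂ) ρ, 1 - z ^ 2 ∈ Complex.slitPlane := fun z hz => by
    refine one_sub_sq_mem_slitPlane_iff.2 (Or.inr ?_)
    have h3 := (Complex.abs_re_le_norm _).trans_lt (mem_ball_iff_norm.1 hz)
    rw [Complex.sub_re, Complex.ofReal_re, abs_lt] at h3
    constructor <;> linarith
  have hne : ∀ z ∈ Metric.ball (a n : ℂ) ρ, Complex.I * sqrtOneSubSq z ≠ 0 := fun z hz =>
    mul_ne_zero Complex.I_ne_zero (sqrtOneSubSq_ne_zero (hslit z hz))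
  have hres := residue_eq_zero hw.gradient hρ (F := fun z => G z / (Complex.I * sqrtOneSubSq z))
    (hG.div (DifferentiableOn.const_mul (fun z hz =>
      (hasDerivAt_sqrtOneSubSq (hslit z hz)).differentiableAt.differentiableWithinAt) _) hne)
    (fun z hz => by
      have h3 : z.im ≠ 0 := ne_of_gt hz.1
      have h4 := sqrtOneSubSq_ne_zero (hslit z hz.2)
      have h5 : z - a n ≠ 0 := sub_ofReal_ne_zero hz.1
      rw [hGe₀ z (hsub hz.2) h3, boundaryReflection_of_pos hz.1]
      field_simp) (by
      filter_upwards [hw.trace] with x hx hxm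
      exact hx (Set.Ioo_subset_Ioo h1 h2 hxm))
  have hc : (a n : ℂ) ∈ Metric.ball (a n : ℂ) ρ := Metric.mem_ball_self hρ
  have hG0 : G (a n) = 0 := (div_eq_zero_iff.1 hres).resolve_right (hne _ hc)
  refine ⟨ρ, hρ, dslope G (a n),
    (Complex.differentiableOn_dslope (Metric.ball_mem_nhds _ hρ)).2 hG, fun z hz => ?_⟩
  have hza : z ≠ a n := fun h0 => hz.2 (by simp [h0])
  rw [dslope_of_ne _ hza, slope_def_field, hG0, sub_zero, hGe₀ z (hsub hz.1) hz.2,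
    mul_div_cancel_left₀ _ (sub_ne_zero.2 hza)]

/-- The homogeneous problem has only the trivial solution. -/
lemma eq_zero (hw : IsHomogeneousSolution a w h) (ha : ∀ n, a n ∈ Set.Ioo (-1 : ℝ) 1)
    (hinj : Function.Injective a) {z : ℂ} (hz : z ∈ halfPlane) : w z = 0 := by
  have hd : ∀ p, DifferentiableAt ℂ (extend (boundaryReflection h)) p := fun p => by
    refine ExtendsAt.differentiableAt ?_
    by_cases h1 : p = 1
    · rw [h1, ← Complex.ofReal_one]
      exact hw.extendsAt_endpoint ha abs_one
    by_cases h2 : p = -1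
    · rw [h2, ← Complex.ofReal_one, ← Complex.ofReal_neg]
      exact hw.extendsAt_endpoint ha (by simp)
    by_cases h3 : ∃ n, p = a n
    · obtain ⟨n, rfl⟩ := h3
      exact hw.extendsAt_wall ha hinj n
    · exact hw.extendsAt ha (not_exists.1 h3) h1 h2
  have hzero : ∀ z ∈ halfPlane, h z = 0 := fun z hz => by
    -- Liouville: the extension is entire and tends to zero at infinity.
    have h1 := Differentiable.apply_eq_of_tendsto_cocompact hd z
      (hw.tendsto_extend_cocompact ha fun z _ => hd z)
    rw [extend_boundaryReflection hw.holomorphic (ne_of_gt hz), boundaryReflection_of_pos hz] at h1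
    have h2 := sqrtOneSubSq_ne_zero (mem_slitPlane_of_mem_halfPlane hz)
    simpa [h2] using h1
  obtain ⟨c, hc⟩ := exists_eq_add_of_gradient isOpen_halfPlane isPreconnected_halfPlane
    (f := w) (g := fun _ => 0) (F := fun _ => 0)
    (fun z hz => by simpa [hzero z hz] using hw.gradient z hz) fun z _ => hasGradientAt_const z 0
  -- Since h = 0, w is a constant, and a single point of (-1,1) where the trace exists determines
  -- it.
  obtain ⟨x, hx, htr⟩ : ∃ x ∈ Set.Ioo (-1 : ℝ) 1,
      Tendsto (fun t : ℝ => w (x + t * Complex.I)) (𝓝[>] 0) (𝓝 0) := by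
    by_contra! hcon
    have h1 : volume (Set.Ioo (-1 : ℝ) 1) = 0 := by
      refine measure_mono_null (fun x hx => ?_) (ae_iff.1 hw.trace)
      exact fun himp => hcon x hx (himp hx)
    simp at h1
    norm_num at h1
  have hc0 : c = 0 := by
    refine tendsto_nhds_unique (tendsto_const_nhds.congr' ?_) htr
    filter_upwards [self_mem_nhdsWithin] with t ht
    rw [hc _ (ofReal_add_mul_I_mem ht), zero_add]
  rw [hc z hz, hc0, zero_add]

end IsHomogeneousSolution

/-! ### The difference of two solutions -/

/-- The complex derivative `∂₁ u - i ∂₂ u` of a real function. -/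
noncomputable def complexDeriv (u : ℂ → ℝ) (z : ℂ) : ℂ :=
  fderiv ℝ u z 1 - Complex.I * fderiv ℝ u z Complex.I

lemma hasGradientAt_complexDeriv {u : ℂ → ℝ} {z : ℂ} (hu : DifferentiableAt ℝ u z) :
    HasGradientAt u ((starRingEnd ℂ) (complexDeriv u z)) z := by
  rw [hasGradientAt_iff_hasFDerivAt]
  refine hu.hasFDerivAt.congr_fderiv ?_
  ext v
  have hv : v = v.re • (1 : ℂ) + v.im • Complex.I := by
    apply Complex.ext <;> simp
  rw [InnerProductSpace.toDual_apply_apply, Complex.inner, Complex.conj_conj]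
  conv_lhs => rw [hv]
  rw [map_add, map_smul, map_smul]
  simp [complexDeriv]

namespace IsLimitPotential

variable {N : ℕ} {a γ : Fin N → ℝ} {u v : ℂ → ℝ}

lemma differentiableAt (hu : IsLimitPotential a γ u) {z : ℂ} (hz : z ∈ halfPlane) :
    DifferentiableAt ℝ u z :=
  (hu.harmonic z hz).1.differentiableAt (by norm_num)

lemma differentiableOn_complexDeriv (hu : IsLimitPotential a γ u) :
    DifferentiableOn ℂ (complexDeriv u) halfPlane := fun z hz =>
  (HarmonicAt.differentiableAt_complex_partial (hu.harmonic z hz)).differentiableWithinAt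

lemma hasGradientAt (hu : IsLimitPotential a γ u) {z : ℂ} (hz : z ∈ halfPlane) :
    HasGradientAt u ((starRingEnd ℂ) (complexDeriv u z)) z :=
  hasGradientAt_complexDeriv (hu.differentiableAt hz)

lemma growth (hu : IsLimitPotential a γ u) : ∃ C : ℝ, ∀ r : ℝ, 0 < r →
    ∫⁻ z in perforated a r, ‖complexDeriv u z‖ₑ ^ 2 ≤ ENNReal.ofReal (C * Real.log (1 / r + 2)) := by
  obtain ⟨C, hC⟩ := hu.energy_growth
  refine ⟨C, fun r hr => (lintegral_mono_ae ?_).trans (hC r hr)⟩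
  filter_upwards [ae_restrict_mem (measurableSet_perforated a r)] with z hz
  rw [(hu.hasGradientAt hz.1).gradient, RCLike.enorm_conj]

/-- Needed to split the Neumann integral of a difference. The support of ζ misses small discs about
the walls, and outside these the energy is finite. -/
lemma integrableOn_mul_complexGrad (hu : IsLimitPotential a γ u)
    (ha : ∀ n, a n ∈ Set.Ioo (-1 : ℝ) 1) {ζ : ℂ → ℝ} (hζ : ContDiff ℝ ∞ ζ)
    (hc : HasCompactSupport ζ) (hs : Disjoint (tsupport ζ) segmentIcc) :
    IntegrableOn (fun z => complexDeriv u z * complexGrad ζ z) halfPlane := by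
  obtain ⟨r, hr, hr0⟩ : ∃ r : ℝ, (∀ n, Metric.ball (a n : ℂ) r ⊆ (tsupport ζ)ᶜ) ∧ 0 < r := by
    have : ∀ᶠ r : ℝ in 𝓝[>] 0, ∀ n, Metric.ball (a n : ℂ) r ⊆ (tsupport ζ)ᶜ := by
      refine eventually_all.2 fun n => ?_
      have hn : (a n : ℂ) ∈ (tsupport ζ)ᶜ := Set.disjoint_right.1 hs
        ⟨Complex.ofReal_im _, Set.Ioo_subset_Icc_self (ha n)⟩
      obtain ⟨ε, hε, hsub⟩ := Metric.isOpen_iff.1 (isClosed_tsupport ζ).isOpen_compl _ hn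
      filter_upwards [(eventually_lt_nhds hε).filter_mono nhdsWithin_le_nhds] with r hr
      exact (Metric.ball_subset_ball hr.le).trans hsub
    exact (this.and self_mem_nhdsWithin).exists
  have hsub : halfPlane ∩ tsupport ζ ⊆ perforated a r := fun z hz => ⟨hz.1, by
    rw [Set.mem_iUnion]
    rintro ⟨n, hn⟩
    exact hr n hn hz.2⟩
  obtain ⟨C, hC⟩ := hu.growth
  have hL : IntegrableOn (fun z => ‖complexDeriv u z‖ ^ 2) (halfPlane ∩ tsupport ζ) := by
    have hm := measurableSet_halfPlane.inter (isClosed_tsupport ζ).measurableSet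
    refine ⟨((hu.differentiableOn_complexDeriv.continuousOn.mono
      Set.inter_subset_left).norm.pow 2).aestronglyMeasurable hm, ?_⟩
    rw [HasFiniteIntegral]
    simp only [enorm_pow, enorm_norm]
    exact (lintegral_mono_set hsub).trans_lt ((hC r hr0).trans_lt ENNReal.ofReal_lt_top)
  exact NeelWall.integrableOn_mul_complexGrad (integrableOn_of_norm_sq_of_finite
    hu.differentiableOn_complexDeriv (isClosed_tsupport ζ).measurableSet hc.isCompact.measure_lt_top hL)
    hζ hc subset_rfl

lemma setIntegral_mul_complexGrad (hu : IsLimitPotential a γ u) {ζ : ℂ → ℝ} (hζ : ContDiff ℝ ∞ ζ)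
    (hc : HasCompactSupport ζ) (hs : Disjoint (tsupport ζ) segmentIcc) :
    ∫ z in halfPlane, (complexDeriv u z * complexGrad ζ z).re = 0 := by
  rw [← hu.neumann ζ hζ hc hs]
  refine setIntegral_congr_fun measurableSet_halfPlane fun z hz => ?_
  simp only [(hu.hasGradientAt hz).gradient, inner_gradient_eq, complexGrad]

end IsLimitPotential

lemma exists_mem_piece {N : ℕ} {a : Fin N → ℝ} (ha : StrictMono a) {x : ℝ}
    (hx : x ∈ Set.Ioo (-1 : ℝ) 1) (hxa : ∀ n, x ≠ a n) : ∃ n, x ∈ piece a n := by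
  classical
  by_cases h : ∃ m, ∃ hm : m < N, x < a ⟨m, hm⟩
  -- The number of the interval is the index of the first wall to the right of x, or N if there is
  -- none.
  · obtain ⟨hm, hlt⟩ := Nat.find_spec h
    refine ⟨⟨Nat.find h, by omega⟩, hx, fun k hk => ?_, fun k hk => ?_⟩
    · have := Nat.find_min h hk
      push Not at this
      exact (this k.2).lt_of_ne (hxa k).symm
    · exact hlt.trans_le (ha.monotone (show (⟨Nat.find h, hm⟩ : Fin N) ≤ k from hk))
  · push Not at h
    exact ⟨Fin.last N, hx, fun k _ => (h k k.2).lt_of_ne (hxa k).symm,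
      fun k hk => absurd k.2 (not_lt.2 hk)⟩

lemma measurableSet_piece {N : ℕ} (a : Fin N → ℝ) (n : Fin (N + 1)) : MeasurableSet (piece a n) := by
  have e : piece a n = Set.Ioo (-1 : ℝ) 1 ∩
      ((⋂ k : Fin N, ⋂ _ : k.val < n.val, Set.Ioi (a k)) ∩
        ⋂ k : Fin N, ⋂ _ : n.val ≤ k.val, Set.Iio (a k)) := by
    ext x
    simp [piece]
  rw [e]
  exact measurableSet_Ioo.inter ((MeasurableSet.iInter fun k => MeasurableSet.iInter fun _ =>
    measurableSet_Ioi).inter (MeasurableSet.iInter fun k => MeasurableSet.iInter fun _ =>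
    measurableSet_Iio))

lemma enorm_sub_sq_le (x y : ℂ) : ‖x - y‖ₑ ^ 2 ≤ 2 * (‖x‖ₑ ^ 2 + ‖y‖ₑ ^ 2) := by
  rw [enorm_sq_eq_ofReal, enorm_sq_eq_ofReal, enorm_sq_eq_ofReal,
    ← ENNReal.ofReal_add (by positivity) (by positivity), show (2 : ℝ≥0∞) = ENNReal.ofReal 2 by simp,
    ← ENNReal.ofReal_mul (by norm_num)]
  refine ENNReal.ofReal_le_ofReal ?_
  nlinarith [norm_sub_le x y, norm_nonneg (x - y), sq_nonneg (‖x‖ - ‖y‖)]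

/-- The difference of two limit potentials solves the homogeneous problem. -/
lemma IsLimitPotential.sub {N : ℕ} {a γ : Fin N → ℝ} {u v : ℂ → ℝ} (ha : a ∈ Positions N)
    (hv : IsLimitPotential a γ v) (hu : IsLimitPotential a γ u) :
    IsHomogeneousSolution a (fun z => v z - u z) fun z => complexDeriv v z - complexDeriv u z where
  holomorphic := hv.differentiableOn_complexDeriv.sub hu.differentiableOn_complexDeriv
  gradient := fun z hz => by
    rw [map_sub, hasGradientAt_iff_hasFDerivAt, map_sub]
    exact (hv.hasGradientAt hz).hasFDerivAt.sub (hu.hasGradientAt hz).hasFDerivAt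
  growth := by
    obtain ⟨C, hC⟩ := hv.growth
    obtain ⟨D, hD⟩ := hu.growth
    refine ⟨2 * (|C| + |D|), fun r hr => ?_⟩
    have hlog : 0 ≤ Real.log (1 / r + 2) :=
      Real.log_nonneg (by linarith [show 0 < 1 / r by positivity])
    have hm : AEMeasurable (fun z => ‖complexDeriv v z‖ₑ ^ 2) (volume.restrict (perforated a r)) :=
      ((hv.differentiableOn_complexDeriv.continuousOn.mono Set.sdiff_subset).enorm.aemeasurable
        (measurableSet_perforated a r)).pow_const 2
    calc _ ≤ ∫⁻ z in perforated a r, 2 * (‖complexDeriv v z‖ₑ ^ 2 + ‖complexDeriv u z‖ₑ ^ 2) :=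
          lintegral_mono fun z => enorm_sub_sq_le _ _
      _ = 2 * ((∫⁻ z in perforated a r, ‖complexDeriv v z‖ₑ ^ 2)
            + ∫⁻ z in perforated a r, ‖complexDeriv u z‖ₑ ^ 2) := by
          rw [lintegral_const_mul' _ _ (by simp), lintegral_add_left' hm]
      _ ≤ 2 * (ENNReal.ofReal (|C| * Real.log (1 / r + 2))
            + ENNReal.ofReal (|D| * Real.log (1 / r + 2))) := by
          gcongr
          · exact (hC r hr).trans (ENNReal.ofReal_le_ofReal
              (mul_le_mul_of_nonneg_right (le_abs_self C) hlog))
          · exact (hD r hr).trans (ENNReal.ofReal_le_ofReal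
              (mul_le_mul_of_nonneg_right (le_abs_self D) hlog))
      _ = _ := by
          rw [← ENNReal.ofReal_add (by positivity) (by positivity),
            show (2 : ℝ≥0∞) = ENNReal.ofReal 2 by simp, ← ENNReal.ofReal_mul (by norm_num)]
          congr 1
          ring
  trace := by
    have h1 : ∀ᵐ x : ℝ, ∀ n, x ∈ piece a n →
        Tendsto (fun t : ℝ => v ⟨x, t⟩ - u ⟨x, t⟩) (𝓝[>] 0) (𝓝 0) := by
      refine ae_all_iff.2 fun n => ?_
      filter_upwards [(ae_restrict_iff' (measurableSet_piece a n)).1 (hv.trace_eq n),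
        (ae_restrict_iff' (measurableSet_piece a n)).1 (hu.trace_eq n)] with x h1 h2 hx
      have := (h1 hx).sub (h2 hx)
      rwa [sub_self] at this
    -- The pieces cover (-1,1) up to the finitely many walls, so the traces on them combine to an
    -- almost everywhere statement on the interval.
    have h2 : ∀ᵐ x : ℝ, ∀ n, x ≠ a n := ae_all_iff.2 fun n => Measure.ae_ne volume (a n)
    filter_upwards [h1, h2] with x h1 h2 hx
    obtain ⟨n, hn⟩ := exists_mem_piece ha.1 hx h2
    simpa only [Complex.mk_eq_add_mul_I] using h1 n hn
  neumann := fun ζ hζ hc hs => by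
    have hiv := hv.integrableOn_mul_complexGrad ha.2 hζ hc hs
    have hiu := hu.integrableOn_mul_complexGrad ha.2 hζ hc hs
    simp only [sub_mul, Complex.sub_re]
    rw [integral_sub (f := fun z => (complexDeriv v z * complexGrad ζ z).re)
      (g := fun z => (complexDeriv u z * complexGrad ζ z).re) hiv.re hiu.re,
      hv.setIntegral_mul_complexGrad hζ hc hs, hu.setIntegral_mul_complexGrad hζ hc hs, sub_zero]

/-- The limit potential is unique. -/
theorem IsLimitPotential.eqOn {N : ℕ} {a γ : Fin N → ℝ} {u v : ℂ → ℝ} (ha : a ∈ Positions N)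
    (hv : IsLimitPotential a γ v) (hu : IsLimitPotential a γ u) : Set.EqOn v u halfPlane :=
  fun _ hz => sub_eq_zero.1 ((IsLimitPotential.sub ha hv hu).eq_zero ha.2 ha.1.injective hz)

end NeelWall

theorem mainTheorem2 (N : ℕ) (α : ℝ) (hα : α ∈ Set.Ioo 0 Real.pi)
    (a : Fin N → ℝ) (ha : a ∈ NeelWall.Positions N)
    (d : Fin N → ℝ) (hd : ∀ n, d n = 1 ∨ d n = -1)
    (γ : Fin N → ℝ) (hγ : γ = NeelWall.weight α d) :
    ∃ u : ℂ → ℝ, NeelWall.IsLimitPotential a γ u ∧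
      (∀ v : ℂ → ℝ, NeelWall.IsLimitPotential a γ v → Set.EqOn v u NeelWall.halfPlane) ∧
      NeelWall.renormalisedEnergy a γ u =
        ((Real.pi / 2 * ∑ n, γ n ^ 2 * Real.log (2 - 2 * a n ^ 2)
          + Real.pi / 2 * ∑ n, ∑ k with k ≠ n, γ k * γ n *
              Real.log ((1 + Real.sqrt (1 - NeelWall.rho (a k) (a n) ^ 2))
                / NeelWall.rho (a k) (a n)) : ℝ) : EReal) := by
  exact ⟨NeelWall.potential a γ, NeelWall.isLimitPotential_potential γ ha.2,
    fun v hv => hv.eqOn ha (NeelWall.isLimitPotential_potential γ ha.2),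
    NeelWall.renormalisedEnergy_eq ha.1.injective ha.2 fun z hz => by
      rw [(NeelWall.hasGradientAt_potential γ ha.2 hz).gradient, RCLike.enorm_conj]⟩
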